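/- For $v\in\mathbb R^3$ let $L_v$ be the translation $x\mapsto x+v$. Let $\Lambda=\operatorname{span}_{\mathbb Z}\{(2,0,0),(1,\sqrt3,0),(0,0,1)\}$ and $$H=\begin{pmatrix}1/2&-\sqrt3/2&0\\ \sqrt3/2&1/2&0\\0&0&1\end{pmatrix},\qquad R=\begin{pmatrix}1&0&0\\0&-1&0\\0&0&-1\end{pmatrix}$$ ($H$ is the rotation by $\pi/3$ around the $x_3$-axis, $R$ the half-turn around the $x_1$-axis). Let $\Gamma_1$ be the group of isometries of $\mathbb R^3$ generated by $\{L_v: v\in\Lambda\}$ and $H$, and let $\Gamma_2$ be the one generated by $\{L_v: v\in\Lambda\}$, $H^2$ and $R$. Put $\mathcal O_i=\Gamma_i\backslash\mathbb R^3$ with the structure induced by the Euclidean metric. The isotropy group of the class of $x$ is the stabilizer of $x$ in $\Gamma_i$ (up to isomorphism); functions and $k$-forms on $\mathcal O_i$ are the $\Gamma_i$-invariant smooth functions and $k$-forms on $\mathbb R^3$, with Laplace operator $-\sum_j\partial_j^2$, respectively $dd^*+d^*d$; isospectral means that all eigenvalues have the same multiplicities. Then: 1. $\Gamma_1=\{H^jL_v: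 0\le j\le5,\ v\in\Lambda\}$ and $\Gamma_2=\{H^{2j}R^kL_v: 0\le j\le2,\ 0\le k\le1,\ v\in\Lambda\}$. Both act properly discontinuously with compact quotient, and for both a fundamental domain is the prism of height one over the triangle with vertices $(0,0,0)$, $(2,0,0)$, $(1,1/\sqrt3,0)$. 2. $\mathcal O_1$ and $\mathcal O_2$ are isospectral on functions, but not on $1$-forms. 3. The points of maximal isotropy order have isotropy group $\mathbb Z_6$ in $\mathcal O_1$ and $D_6$ (the dihedral group with six elements) in $\mathcal O_2$. In $\mathcal O_1$ these points form a circle of length one, the image of the $x_3$-axis; in $\mathcal O_2$ they are exactly two points, the images of $(0,0,0)$ and $(0,0,1/2)$. 4. $\mathcal O_1$ is the Riemannian product of a $236$-orbifold (a compact flat $2$-orbifold whose singular points are exactly three cone points, of orders $2,3,6$) and a circle of length one. All other nontrivial isotropy groups of $\mathcal O_1$ are $\mathbb Z_2$ or $\mathbb Z_3$; the points with isotropy $\mathbb Z_2$ form a circle of length one, and so do those with isotropy $\mathbb Z_3$. 5. All other nontrivial isotropy groups of $\mathcal O_2$ are $\mathbb Z_2$ or $\mathbb Z_3$. The points with isotropy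 $\mathbb Z_2$ form two disjoint open segments of length two, the images of $\{(t,0,0):0<t<2\}$ and $\{(t,0,1/2):0<t<2\}$. The points with isotropy $\mathbb Z_3$ form the disjoint union of an open segment of length $1/2$, the image of $\{(0,0,t):0<t<1/2\}$ (which joins the two points of maximal isotropy), and a circle of length one, the image of the line $\{(1,1/\sqrt3,t):t\in\mathbb R\}$. -/

import Mathlib

open scoped ContDiff Matrix Pointwise

namespace FlatOrbifold

noncomputable section

/-! ### Good flat orbifolds `Γ \ V` -/

section Quotients

variable {V : Type*} [NormedAddCommGroup V] [InnerProductSpace ℝ V]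
variable {W : Type*} [NormedAddCommGroup W] [InnerProductSpace ℝ W]

/-- Two points are equivalent if they lie in the same `Γ`-orbit. -/
def orbitSetoid (Γ : Subgroup (V ≃ᵃⁱ[ℝ] V)) : Setoid V where
  r x y := ∃ g ∈ Γ, g x = y
  iseqv :=
    { refl := fun x => ⟨1, Γ.one_mem, rfl⟩
      symm := by
        rintro x y ⟨g, hg, rfl⟩
        exact ⟨g⁻¹, Γ.inv_mem hg, g.symm_apply_apply x⟩
      trans := by
        rintro x y z ⟨g, hg, rfl⟩ ⟨h, hh, rfl⟩
        exact ⟨h * g, Γ.mul_mem hh hg, rfl⟩ }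

/-- The orbifold `Γ \ V`, as a set of orbits. -/
def Orbifold (Γ : Subgroup (V ≃ᵃⁱ[ℝ] V)) : Type _ := Quotient (orbitSetoid Γ)

/-- The canonical projection `V → Γ \ V`. -/
def proj (Γ : Subgroup (V ≃ᵃⁱ[ℝ] V)) (x : V) : Orbifold Γ := Quotient.mk (orbitSetoid Γ) x

/-- `Γ \ V` carries the quotient topology. -/
instance (Γ : Subgroup (V ≃ᵃⁱ[ℝ] V)) : TopologicalSpace (Orbifold Γ) :=
  inferInstanceAs (TopologicalSpace (Quotient (orbitSetoid Γ)))

/-- The distance on `Γ \ V` induced by that of `V`: the distance between orbits. -/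
def orbitDist (Γ : Subgroup (V ≃ᵃⁱ[ℝ] V)) (a b : Orbifold Γ) : ℝ :=
  sInf {r : ℝ | ∃ x y : V, proj Γ x = a ∧ proj Γ y = b ∧ r = dist x y}

/-- `Γ` acts properly discontinuously on `V` with compact quotient. -/
def IsCrystallographic (Γ : Subgroup (V ≃ᵃⁱ[ℝ] V)) : Prop :=
  (∀ K : Set V, IsCompact K → {g : V ≃ᵃⁱ[ℝ] V | g ∈ Γ ∧ (g '' K ∩ K).Nonempty}.Finite) ∧
    CompactSpace (Orbifold Γ)

/-- A closed set whose `Γ`-translates cover `V` and have pairwise disjoint interiors. -/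
def IsFundamentalDomain (Γ : Subgroup (V ≃ᵃⁱ[ℝ] V)) (D : Set V) : Prop :=
  IsClosed D ∧ (∀ x : V, ∃ g ∈ Γ, g x ∈ D) ∧
    ∀ g ∈ Γ, g ≠ 1 → Disjoint (interior D) (g '' interior D)

/-- The stabilizer of `x` in `Γ`. -/
def stabilizer (Γ : Subgroup (V ≃ᵃⁱ[ℝ] V)) (x : V) : Subgroup (V ≃ᵃⁱ[ℝ] V) where
  carrier := {g | g ∈ Γ ∧ g x = x}
  one_mem' := ⟨Γ.one_mem, rfl⟩
  mul_mem' := by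
    rintro a b ⟨ha, ha'⟩ ⟨hb, hb'⟩
    exact ⟨Γ.mul_mem ha hb, by rw [AffineIsometryEquiv.coe_mul, Function.comp_apply, hb', ha']⟩
  inv_mem' := by
    rintro a ⟨ha, ha'⟩
    exact ⟨Γ.inv_mem ha, (AffineIsometryEquiv.symm_apply_eq a).2 ha'.symm⟩

/-- The point `a` of `Γ \ V` has isotropy group (isomorphic to) `G`. -/
def HasIsotropy (Γ : Subgroup (V ≃ᵃⁱ[ℝ] V)) (a : Orbifold Γ) (G : Type) [Group G] : Prop :=
  ∃ x : V, proj Γ x = a ∧ Nonempty (stabilizer Γ x ≃* G)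

/-- The set of points of `Γ \ V` at which the isotropy order attains its maximum. -/
def maximalIsotropySet (Γ : Subgroup (V ≃ᵃⁱ[ℝ] V)) : Set (Orbifold Γ) :=
  {a | ∃ x : V, proj Γ x = a ∧
    ∀ y : V, Nat.card (stabilizer Γ y) ≤ Nat.card (stabilizer Γ x)}

/-- The subset `S` of `Γ \ V` is an embedded copy of the metric space `Y` whose
arc length agrees with that of `Y`: it is the image of a topological embedding of `Y` that
locally preserves distances. -/
def IsLocallyIsometricCopy (Γ : Subgroup (V ≃ᵃⁱ[ℝ] V)) (Y : Type) [MetricSpace Y]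
    (S : Set (Orbifold Γ)) : Prop :=
  ∃ f : Y → Orbifold Γ, Topology.IsEmbedding f ∧
    (∀ y : Y, ∃ U ∈ nhds y, ∀ p ∈ U, ∀ q ∈ U, orbitDist Γ (f p) (f q) = dist p q) ∧
    Set.range f = S

/-- `S` is a circle of length `ℓ` in `Γ \ V`. -/
def IsCircleOfLength (Γ : Subgroup (V ≃ᵃⁱ[ℝ] V)) (ℓ : ℝ) (S : Set (Orbifold Γ)) : Prop :=
  IsLocallyIsometricCopy Γ (AddCircle ℓ) S

/-- `S` is an open segment of length `ℓ` in `Γ \ V`. -/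
def IsOpenSegmentOfLength (Γ : Subgroup (V ≃ᵃⁱ[ℝ] V)) (ℓ : ℝ) (S : Set (Orbifold Γ)) : Prop :=
  IsLocallyIsometricCopy Γ (Set.Ioo (0 : ℝ) ℓ) S

/-- The group `L_A` of translations by the elements of `A`. -/
def translationGroup (A : AddSubgroup V) : Subgroup (V ≃ᵃⁱ[ℝ] V) where
  carrier := {g | ∃ v ∈ A, g = AffineIsometryEquiv.constVAdd ℝ V v}
  one_mem' := ⟨0, A.zero_mem, by ext x; simp⟩
  mul_mem' := by
    rintro _ _ ⟨v, hv, rfl⟩ ⟨w, hw, rfl⟩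
    exact ⟨v + w, A.add_mem hv hw, by ext x; simp [add_assoc]⟩
  inv_mem' := by
    rintro _ ⟨v, hv, rfl⟩
    refine ⟨-v, A.neg_mem hv, ?_⟩
    rw [inv_eq_iff_mul_eq_one]
    ext x
    simp

/-- The group `Γ × Γ'` acting on the Riemannian product `V × W`, which defines the product of
the orbifolds `Γ \ V` and `Γ' \ W`. -/
def prodGroup (Γ : Subgroup (V ≃ᵃⁱ[ℝ] V)) (Γ' : Subgroup (W ≃ᵃⁱ[ℝ] W)) :
    Subgroup (WithLp 2 (V × W) ≃ᵃⁱ[ℝ] WithLp 2 (V × W)) where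
  carrier := {k | ∃ g ∈ Γ, ∃ h ∈ Γ', ∀ (v : V) (w : W),
    k (WithLp.toLp 2 (v, w)) = WithLp.toLp 2 (g v, h w)}
  one_mem' := ⟨1, Γ.one_mem, 1, Γ'.one_mem, fun _ _ => rfl⟩
  mul_mem' := by
    rintro k l ⟨g, hg, h, hh, hk⟩ ⟨g', hg', h', hh', hl⟩
    exact ⟨g * g', Γ.mul_mem hg hg', h * h', Γ'.mul_mem hh hh', fun v w => by
      rw [AffineIsometryEquiv.coe_mul, Function.comp_apply, hl, hk]; rfl⟩
  inv_mem' := by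
    rintro k ⟨g, hg, h, hh, hk⟩
    refine ⟨g⁻¹, Γ.inv_mem hg, h⁻¹, Γ'.inv_mem hh, fun v w => ?_⟩
    refine (AffineIsometryEquiv.symm_apply_eq k).2 ?_
    rw [hk]
    exact congrArg (WithLp.toLp 2)
      (Prod.ext (g.apply_symm_apply v).symm (h.apply_symm_apply w).symm)

/-- The orbifolds `Γ \ V` and `Γ' \ W` are isometric: some isometry `V → W` conjugates
`Γ` to `Γ'`. -/
def AreIsometric (Γ : Subgroup (V ≃ᵃⁱ[ℝ] V)) (Γ' : Subgroup (W ≃ᵃⁱ[ℝ] W)) : Prop :=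
  ∃ φ : V ≃ᵃⁱ[ℝ] W, ∀ g : V ≃ᵃⁱ[ℝ] V, g ∈ Γ ↔ (φ.symm.trans g).trans φ ∈ Γ'

/-- `a` is a cone point of order `m`: its isotropy group is cyclic of order `m` and consists of
rotations (orientation preserving isometries). -/
def IsConePoint (Γ : Subgroup (V ≃ᵃⁱ[ℝ] V)) (m : ℕ) (a : Orbifold Γ) : Prop :=
  HasIsotropy Γ a (Multiplicative (ZMod m)) ∧
    ∃ x : V, proj Γ x = a ∧ ∀ g ∈ stabilizer Γ x,
      LinearMap.det (g.linearIsometryEquiv.toLinearEquiv : V →ₗ[ℝ] V) = 1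

end Quotients

/-! ### Laplace spectra of functions and forms -/

/-- Euclidean space `ℝⁿ`. -/
abbrev E (n : ℕ) : Type := EuclideanSpace ℝ (Fin n)

/-- The isometry group `I(ℝⁿ) = O(n) ⋉ ℝⁿ`. -/
abbrev I (n : ℕ) : Type := E n ≃ᵃⁱ[ℝ] E n

/-- A `236`-orbifold: a compact flat `2`-orbifold whose singular points are exactly three cone
points, of orders `2`, `3` and `6`. -/
def Is236Orbifold (Δ : Subgroup (I 2)) : Prop :=
  IsCrystallographic Δ ∧ ∃ a b c : Orbifold Δ,
    IsConePoint Δ 2 a ∧ IsConePoint Δ 3 b ∧ IsConePoint Δ 6 c ∧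
    ∀ d : Orbifold Δ, d ≠ a → d ≠ b → d ≠ c → HasIsotropy Δ d Unit

section Spectra

variable {n : ℕ}

/-- Smooth `k`-forms are smooth maps of this type. -/
abbrev Form (n k : ℕ) : Type := E n → E n [⋀^Fin k]→L[ℝ] ℝ

/-- The codifferential `d* = - ∑ᵢ ι(eᵢ) ∂ᵢ` of euclidean space. -/
def codiff {k : ℕ} (α : Form n (k + 1)) : Form n k := fun x =>
  -∑ i : Fin n, (fderiv ℝ α x (EuclideanSpace.single i (1 : ℝ))).curryLeft
    (EuclideanSpace.single i (1 : ℝ))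

/-- The Laplace operator `d d* + d* d` on `k`-forms of euclidean space. -/
def hodgeLaplacian : {k : ℕ} → Form n k → Form n k
  | 0, α => codiff (extDeriv α)
  | _ + 1, α => extDeriv (codiff α) + codiff (extDeriv α)

theorem contDiff_extDeriv {k : ℕ} {α : Form n k} (h : ContDiff ℝ ∞ α) :
    ContDiff ℝ ∞ (extDeriv α) := by
  have h1 : ContDiff ℝ ∞ (fderiv ℝ α) := h.fderiv_right (by simp)
  exact (ContinuousAlternatingMap.alternatizeUncurryFinCLM ℝ (E n) ℝ (n := k)).contDiff.comp h1

theorem contDiff_codiff {k : ℕ} {α : Form n (k + 1)} (h : ContDiff ℝ ∞ α) :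
    ContDiff ℝ ∞ (codiff α) := by
  have h1 : ContDiff ℝ ∞ (fderiv ℝ α) := h.fderiv_right (by simp)
  unfold codiff
  refine (ContDiff.sum fun i _ => ?_).neg
  have h2 : ContDiff ℝ ∞ (fun x => fderiv ℝ α x (EuclideanSpace.single i (1 : ℝ))) :=
    h1.clm_apply contDiff_const
  exact ((ContinuousAlternatingMap.curryLeftLI (𝕜 := ℝ) (E := E n) (F := ℝ)
    (n := k)).contDiff.comp h2).clm_apply contDiff_const

theorem codiff_add {k : ℕ} {α β : Form n (k + 1)} (hα : ContDiff ℝ ∞ α) (hβ : ContDiff ℝ ∞ β) :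
    codiff (α + β) = codiff α + codiff β := by
  funext x
  have h1 := (hα.differentiable (by simp)) x
  have h2 := (hβ.differentiable (by simp)) x
  have h3 : fderiv ℝ (α + β) x = fderiv ℝ α x + fderiv ℝ β x := fderiv_add h1 h2
  unfold codiff
  rw [h3, Pi.add_apply, ← neg_add, ← Finset.sum_add_distrib]
  exact congrArg Neg.neg (Finset.sum_congr rfl fun i _ => rfl)

theorem codiff_smul {k : ℕ} (c : ℝ) (α : Form n (k + 1)) : codiff (c • α) = c • codiff α := by
  funext x
  have h3 : fderiv ℝ (c • α) x = c • fderiv ℝ α x :=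
    congrFun (fderiv_const_smul_field (𝕜 := ℝ) (f := α) c) x
  unfold codiff
  rw [h3, Pi.smul_apply, smul_neg, Finset.smul_sum]
  exact congrArg Neg.neg (Finset.sum_congr rfl fun i _ => rfl)

theorem extDeriv_add' {k : ℕ} {α β : Form n k} (hα : ContDiff ℝ ∞ α) (hβ : ContDiff ℝ ∞ β) :
    extDeriv (α + β) = extDeriv α + extDeriv β :=
  funext fun x => extDeriv_add ((hα.differentiable (by simp)) x) ((hβ.differentiable (by simp)) x)

theorem extDeriv_smul' {k : ℕ} (c : ℝ) (α : Form n k) : extDeriv (c • α) = c • extDeriv α :=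
  funext fun _ => extDeriv_smul c α

theorem hodgeLaplacian_add {k : ℕ} {α β : Form n k} (hα : ContDiff ℝ ∞ α)
    (hβ : ContDiff ℝ ∞ β) :
    hodgeLaplacian (α + β) = hodgeLaplacian α + hodgeLaplacian β := by
  cases k with
  | zero =>
    simp only [hodgeLaplacian]
    rw [extDeriv_add' hα hβ, codiff_add (contDiff_extDeriv hα) (contDiff_extDeriv hβ)]
  | succ k =>
    simp only [hodgeLaplacian]
    rw [extDeriv_add' hα hβ, codiff_add (contDiff_extDeriv hα) (contDiff_extDeriv hβ),
      codiff_add hα hβ, extDeriv_add' (contDiff_codiff hα) (contDiff_codiff hβ)]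
    abel

theorem hodgeLaplacian_smul {k : ℕ} (c : ℝ) (α : Form n k) :
    hodgeLaplacian (c • α) = c • hodgeLaplacian α := by
  cases k with
  | zero =>
    simp only [hodgeLaplacian]
    rw [extDeriv_smul', codiff_smul]
  | succ k =>
    simp only [hodgeLaplacian]
    rw [extDeriv_smul', codiff_smul, codiff_smul, extDeriv_smul', smul_add]

/-- The smooth functions on `Γ \ ℝⁿ`: the `Γ`-invariant smooth functions on `ℝⁿ`. -/
def smoothFunctions (Γ : Subgroup (I n)) : Submodule ℝ (E n → ℝ) where
  carrier := {f | ContDiff ℝ ∞ f ∧ ∀ g ∈ Γ, ∀ x, f (g x) = f x}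
  add_mem' := by
    rintro f h ⟨hf, hf'⟩ ⟨hh, hh'⟩
    exact ⟨hf.add hh, fun g hg x => by simp [hf' g hg x, hh' g hg x]⟩
  zero_mem' := ⟨contDiff_const, fun _ _ _ => rfl⟩
  smul_mem' := by
    rintro c f ⟨hf, hf'⟩
    exact ⟨hf.const_smul c, fun g hg x => by simp [hf' g hg x]⟩

/-- The smooth `k`-forms on `Γ \ ℝⁿ`: the smooth `k`-forms `α` on `ℝⁿ` with `g^* α = α` for all
`g` in `Γ`. -/
def smoothForms (k : ℕ) (Γ : Subgroup (I n)) : Submodule ℝ (Form n k) where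
  carrier := {α | ContDiff ℝ ∞ α ∧
    ∀ g ∈ Γ, ∀ x, (α (g x)).compContinuousLinearMap (fderiv ℝ g x) = α x}
  add_mem' := by
    rintro α β ⟨hα, hα'⟩ ⟨hβ, hβ'⟩
    refine ⟨hα.add hβ, fun g hg x => ?_⟩
    have h1 := hα' g hg x
    have h2 := hβ' g hg x
    ext v
    rw [Pi.add_apply, Pi.add_apply, ← h1, ← h2]
    rfl
  zero_mem' := ⟨contDiff_const, fun _ _ _ => by ext v; rfl⟩
  smul_mem' := by
    rintro c α ⟨hα, hα'⟩
    refine ⟨hα.const_smul c, fun g hg x => ?_⟩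
    have h1 := hα' g hg x
    ext v
    rw [Pi.smul_apply, Pi.smul_apply, ← h1]
    rfl

/-- The eigenspace of the (positive) Laplace operator on functions on `Γ \ ℝⁿ` for the
eigenvalue `c`; `Laplacian.laplacian` is the sum of the second partial derivatives. -/
def functionEigenspace (Γ : Subgroup (I n)) (c : ℝ) : Submodule ℝ (E n → ℝ) where
  carrier := {f | f ∈ smoothFunctions Γ ∧ -(Laplacian.laplacian f) = c • f}
  add_mem' := by
    rintro f h ⟨hf, hf'⟩ ⟨hh, hh'⟩
    refine ⟨Submodule.add_mem _ hf hh, ?_⟩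
    funext x
    have h1 : ContDiffAt ℝ 2 f x := (hf.1.of_le (by norm_cast)).contDiffAt
    have h2 : ContDiffAt ℝ 2 h x := (hh.1.of_le (by norm_cast)).contDiffAt
    rw [smul_add, ← hf', ← hh', Pi.neg_apply, h1.laplacian_add h2]
    simp [add_comm]
  zero_mem' := by
    refine ⟨Submodule.zero_mem _, ?_⟩
    have h : Laplacian.laplacian (0 : E n → ℝ) = (0 : E n → ℝ) :=
      InnerProductSpace.laplacian_const (c := (0 : ℝ))
    rw [h, neg_zero, smul_zero]
  smul_mem' := by
    rintro a f ⟨hf, hf'⟩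
    refine ⟨Submodule.smul_mem _ a hf, ?_⟩
    funext x
    have h1 : ContDiffAt ℝ 2 f x := (hf.1.of_le (by norm_cast)).contDiffAt
    rw [smul_comm, ← hf', Pi.neg_apply, InnerProductSpace.laplacian_smul a h1]
    simp

/-- The eigenspace of the Laplace operator on `k`-forms on `Γ \ ℝⁿ` for the eigenvalue `c`. -/
def formEigenspace (k : ℕ) (Γ : Subgroup (I n)) (c : ℝ) : Submodule ℝ (Form n k) where
  carrier := {α | α ∈ smoothForms k Γ ∧ hodgeLaplacian α = c • α}
  add_mem' := by
    rintro α β ⟨hα, hα'⟩ ⟨hβ, hβ'⟩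
    exact ⟨Submodule.add_mem _ hα hβ, by
      rw [hodgeLaplacian_add hα.1 hβ.1, hα', hβ', smul_add]⟩
  zero_mem' := by
    refine ⟨Submodule.zero_mem _, ?_⟩
    have h := hodgeLaplacian_smul (0 : ℝ) (0 : Form n k)
    rw [zero_smul, zero_smul] at h
    rw [h, smul_zero]
  smul_mem' := by
    rintro a α ⟨hα, hα'⟩
    exact ⟨Submodule.smul_mem _ a hα, by rw [hodgeLaplacian_smul, hα', smul_comm]⟩

/-- Isospectrality on functions: every real number has the same multiplicity (possibly zero) as
an eigenvalue of the Laplace operator on functions. -/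
def IsospectralOnFunctions (Γ Γ' : Subgroup (I n)) : Prop :=
  ∀ c : ℝ, Module.rank ℝ (functionEigenspace Γ c) = Module.rank ℝ (functionEigenspace Γ' c)

/-- Isospectrality on `k`-forms: every real number has the same multiplicity (possibly zero) as
an eigenvalue of the Laplace operator on `k`-forms. -/
def IsospectralOnForms (k : ℕ) (Γ Γ' : Subgroup (I n)) : Prop :=
  ∀ c : ℝ, Module.rank ℝ (formEigenspace k Γ c) = Module.rank ℝ (formEigenspace k Γ' c)

end Spectra

/-! ### The two groups -/

/-- The lattice spanned over `ℤ` by `(2,0,0)`, `(1,√3,0)`, `(0,0,1)`. -/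
def hexLattice : AddSubgroup (E 3) :=
  AddSubgroup.closure {!₂[2, 0, 0], !₂[1, √3, 0], !₂[0, 0, 1]}

/-- The matrix `H`, the rotation by `π/3` around the third axis. -/
def matH : Matrix (Fin 3) (Fin 3) ℝ :=
  !![1 / 2, -(√3) / 2, 0; √3 / 2, 1 / 2, 0; 0, 0, 1]

/-- The matrix `R`, the half-turn around the first axis. -/
def matR : Matrix (Fin 3) (Fin 3) ℝ :=
  !![1, 0, 0; 0, -1, 0; 0, 0, -1]

theorem matH_mem : matH ∈ Matrix.orthogonalGroup (Fin 3) ℝ := by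
  have h3 : √3 * √3 = (3 : ℝ) := Real.mul_self_sqrt (by norm_num)
  rw [Matrix.mem_orthogonalGroup_iff]
  ext i j
  fin_cases i <;> fin_cases j <;>
    simp [matH, Matrix.mul_apply, Fin.sum_univ_three] <;> nlinarith

theorem matR_mem : matR ∈ Matrix.orthogonalGroup (Fin 3) ℝ := by
  rw [Matrix.mem_orthogonalGroup_iff]
  ext i j
  fin_cases i <;> fin_cases j <;>
    simp [matR, Matrix.mul_apply, Fin.sum_univ_three]

/-- The isometry `x ↦ A x` of `ℝⁿ` given by an orthogonal matrix `A`. -/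
def ofOrthogonal {n : ℕ} (A : Matrix (Fin n) (Fin n) ℝ)
    (hA : A ∈ Matrix.orthogonalGroup (Fin n) ℝ) : I n :=
  (Unitary.linearIsometryEquiv
    ⟨Matrix.toEuclideanCLM (n := Fin n) (𝕜 := ℝ) A,
      Unitary.map_mem (Matrix.toEuclideanCLM (n := Fin n) (𝕜 := ℝ)) hA⟩).toAffineIsometryEquiv

theorem ofOrthogonal_apply {n : ℕ} (A : Matrix (Fin n) (Fin n) ℝ)
    (hA : A ∈ Matrix.orthogonalGroup (Fin n) ℝ) (x : E n) :
    ofOrthogonal A hA x = WithLp.toLp 2 (A *ᵥ x.ofLp) := rfl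

/-- `H` as an isometry of `ℝ³`. -/
def isoH : I 3 := ofOrthogonal matH matH_mem

/-- `R` as an isometry of `ℝ³`. -/
def isoR : I 3 := ofOrthogonal matR matR_mem

/-- The translation `L_v`. -/
def trans (v : E 3) : I 3 := AffineIsometryEquiv.constVAdd ℝ (E 3) v

/-- `Γ₁`, generated by the lattice translations and `H`. -/
def Γ₁ : Subgroup (I 3) :=
  Subgroup.closure ((translationGroup hexLattice : Set (I 3)) ∪ {isoH})

/-- `Γ₂`, generated by the lattice translations, `H²` and `R`. -/
def Γ₂ : Subgroup (I 3) :=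
  Subgroup.closure ((translationGroup hexLattice : Set (I 3)) ∪ {isoH ^ 2, isoR})

/-- The prism of height one over the triangle with vertices `(0,0,0)`, `(2,0,0)`,
`(1,1/√3,0)`. -/
def prism : Set (E 3) :=
  convexHull ℝ {!₂[0, 0, 0], !₂[2, 0, 0], !₂[1, 1 / √3, 0]} +
    segment ℝ !₂[0, 0, 0] !₂[0, 0, 1]

end

end FlatOrbifold

/-! In coordinates with respect to the lattice basis, every element of either group is an affine map
with integral coefficients and one of six linear parts: the powers of `H` for `Γ₁`; the powers of
`H²` and three horizontal half-turns for `Γ₂`. The group elements, proper discontinuity, the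
fundamental domain and the isotropy groups thereby reduce to linear equations and inequalities with
integral unknowns. In particular a fixed point of x ↦ Ax + w solves (1 - A)x = w with w integral,
which leaves few orbits (`classification_Γ₁`, `classification_Γ₂`). Lengths in the quotient are read
off from lower bounds for the distance between a curve and its images under the group.

Isospectrality on functions: an eigenfunction is a finite Fourier sum over dual lattice vectors of
one fixed length, and invariance under a group becomes invariance of its coefficients. Both groups
contain `H²`, and on `H²`-invariant coefficients `H` and `R` act as commuting involutions. Sorted by
the signs of (`H`, `R`), the coefficients for `Γ₁` are of types (+,+) and (+,-), those for `Γ₂` of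
types (+,+) and (-,+), so the types (+,-) and (-,+) have to be compared. Multiplication by `factor`,
which is odd under both involutions, exchanges them away from its zeros. These zeros are the
vertical frequencies (0,0,m), where type (-,+) vanishes, and the horizontal frequencies on three
lines, where type (+,-) vanishes. The values which remain are matched by (0,0,m) ↔ (2m,m,0), two
frequencies of equal length. This gives injections in both directions (`rank_le₁₂`, `rank_le₂₁`).

1-forms are distinguished by the eigenvalue zero. The components of a harmonic form are periodic
harmonic functions, hence constant, so only linear forms fixed by the linear parts remain. For `Γ₁`
there is dx₃; for `Γ₂` there is none, because `R` kills the vertical direction and averaging over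
`H²` kills the horizontal ones.

The product structure of the first orbifold comes from the fact that `Γ₁` shifts heights by
integers, independently of the planar part. -/

namespace FlatOrbifold

noncomputable section

/-! ### Lattice coordinates -/

/-- The point with coordinates `s, t, u` with respect to the basis `(2,0,0)`, `(1,√3,0)`, `(0,0,1)`
of the lattice. -/
def pt (s t u : ℝ) : E 3 := !₂[2 * s + t, √3 * t, u]

theorem sqrt_three_pos : (0 : ℝ) < √3 := Real.sqrt_pos.2 (by norm_num)

theorem sqrt_three_mul_self : √3 * √3 = (3 : ℝ) := Real.mul_self_sqrt (by norm_num)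

theorem exists_pt (x : E 3) : ∃ s t u : ℝ, x = pt s t u := by
  refine ⟨(x 0 - x 1 / √3) / 2, x 1 / √3, x 2, ?_⟩
  have := sqrt_three_pos.ne'
  ext i
  fin_cases i
  · simp [pt]
    field_simp
    ring
  · simp [pt]
    field_simp
  · simp [pt]

theorem pt_inj {s t u s' t' u' : ℝ} : pt s t u = pt s' t' u' ↔ s = s' ∧ t = t' ∧ u = u' := by
  constructor
  · intro h
    have h0 := congrArg (fun x : E 3 => x 0) h
    have h1 := congrArg (fun x : E 3 => x 1) h
    have h2 := congrArg (fun x : E 3 => x 2) h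
    simp [pt] at h0 h1 h2
    refine ⟨by linarith, h1, h2⟩
  · rintro ⟨rfl, rfl, rfl⟩; rfl

theorem pt_add (s t u s' t' u' : ℝ) : pt s t u + pt s' t' u' = pt (s + s') (t + t') (u + u') := by
  ext i
  fin_cases i <;> simp [pt] <;> ring

theorem pt_smul (c s t u : ℝ) : c • pt s t u = pt (c * s) (c * t) (c * u) := by
  ext i
  fin_cases i <;> simp [pt] <;> ring

theorem pt_sub (s t u s' t' u' : ℝ) : pt s t u - pt s' t' u' = pt (s - s') (t - t') (u - u') := by
  ext i
  fin_cases i <;> simp [pt] <;> ring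

theorem pt_zero : pt 0 0 0 = 0 := by
  ext i
  fin_cases i <;> simp [pt]

theorem norm_pt_sq (s t u : ℝ) : ‖pt s t u‖ ^ 2 = 4 * (s ^ 2 + s * t + t ^ 2) + u ^ 2 := by
  rw [EuclideanSpace.norm_sq_eq]
  simp [Fin.sum_univ_three, pt]
  nlinarith [sqrt_three_mul_self]

theorem dist_pt_sq (s t u s' t' u' : ℝ) : dist (pt s t u) (pt s' t' u') ^ 2 =
    4 * ((s - s') ^ 2 + (s - s') * (t - t') + (t - t') ^ 2) + (u - u') ^ 2 := by
  rw [dist_eq_norm, pt_sub, norm_pt_sq]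

theorem continuous_pt : Continuous fun p : ℝ × ℝ × ℝ => pt p.1 p.2.1 p.2.2 := by
  unfold pt
  refine (PiLp.continuous_toLp 2 _).comp (continuous_pi fun i => ?_)
  fin_cases i <;> simp <;> fun_prop

theorem mem_hexLattice {v : E 3} : v ∈ hexLattice ↔ ∃ a b c : ℤ, v = pt a b c := by
  constructor
  · intro h
    refine AddSubgroup.closure_induction (p := fun v _ => ∃ a b c : ℤ, v = pt a b c)
      ?_ ?_ ?_ ?_ h
    · rintro x (rfl | rfl | rfl)
      · exact ⟨1, 0, 0, by simp [pt]⟩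
      · exact ⟨0, 1, 0, by simp [pt]⟩
      · exact ⟨0, 0, 1, by simp [pt]⟩
    · exact ⟨0, 0, 0, by simp [pt_zero]⟩
    · rintro x y - - ⟨a, b, c, rfl⟩ ⟨a', b', c', rfl⟩
      exact ⟨a + a', b + b', c + c', by rw [pt_add]; push_cast; rfl⟩
    · rintro x - ⟨a, b, c, rfl⟩
      refine ⟨-a, -b, -c, ?_⟩
      rw [neg_eq_iff_add_eq_zero, pt_add]
      simp [pt_zero]
  · rintro ⟨a, b, c, rfl⟩
    have h : pt a b c = a • !₂[2, 0, 0] + b • !₂[1, √3, 0] + c • !₂[0, 0, 1] := by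
      ext i
      fin_cases i <;> simp [pt] <;> ring
    rw [h]
    refine add_mem (add_mem ?_ ?_) ?_ <;>
      exact zsmul_mem (AddSubgroup.subset_closure (by simp)) _

/-! ### Affine maps with integral coefficients -/

/-- The isometry `g` is given in lattice coordinates by the integral affine map with linear part
`(s, t, u) ↦ (m s + n t, p s + q t, e u)` and translation part `(a, b, c)`. -/
def Acts (g : I 3) (m n p q e a b c : ℤ) : Prop :=
  ∀ s t u : ℝ, g (pt s t u) = pt (m * s + n * t + a) (p * s + q * t + b) (e * u + c)

theorem Acts.ext {g h : I 3} {m n p q e a b c : ℤ} (hg : Acts g m n p q e a b c)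
    (hh : Acts h m n p q e a b c) : g = h := by
  ext1 x
  obtain ⟨s, t, u, rfl⟩ := exists_pt x
  rw [hg, hh]

theorem Acts.mul {g h : I 3} {m n p q e a b c m' n' p' q' e' a' b' c' : ℤ}
    (hg : Acts g m n p q e a b c) (hh : Acts h m' n' p' q' e' a' b' c') :
    Acts (g * h) (m * m' + n * p') (m * n' + n * q') (p * m' + q * p') (p * n' + q * q') (e * e')
      (m * a' + n * b' + a) (p * a' + q * b' + b) (e * c' + c) := by
  intro s t u
  rw [AffineIsometryEquiv.coe_mul, Function.comp_apply, hh, hg, pt_inj]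
  push_cast
  refine ⟨?_, ?_, ?_⟩ <;> ring

/-- The eight equations say that `g` composed with the candidate is the identity; as `g` is
bijective, a right inverse is the inverse. -/
theorem Acts.inv {g : I 3} {m n p q e a b c m' n' p' q' e' a' b' c' : ℤ}
    (hg : Acts g m n p q e a b c)
    (h1 : m * m' + n * p' = 1) (h2 : m * n' + n * q' = 0) (h3 : p * m' + q * p' = 0)
    (h4 : p * n' + q * q' = 1) (h5 : e * e' = 1) (h6 : m * a' + n * b' + a = 0)
    (h7 : p * a' + q * b' + b = 0) (h8 : e * c' + c = 0) :
    Acts g⁻¹ m' n' p' q' e' a' b' c' := by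
  intro s t u
  refine (AffineIsometryEquiv.symm_apply_eq g).2 ?_
  rw [hg, pt_inj]
  rify at h1 h2 h3 h4 h5 h6 h7 h8
  refine ⟨?_, ?_, ?_⟩
  · linear_combination -s * h1 - t * h2 - h6
  · linear_combination -s * h3 - t * h4 - h7
  · linear_combination -u * h5 - h8

theorem acts_one : Acts 1 1 0 0 1 1 0 0 0 := by
  intro s t u
  simp

theorem acts_trans (a b c : ℤ) : Acts (trans (pt a b c)) 1 0 0 1 1 a b c := by
  intro s t u
  simp only [trans, AffineIsometryEquiv.coe_constVAdd, vadd_eq_add, pt_add, pt_inj]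
  push_cast
  refine ⟨?_, ?_, ?_⟩ <;> ring

theorem acts_isoH : Acts isoH 0 (-1) 1 1 1 0 0 0 := by
  intro s t u
  ext i
  rw [isoH, ofOrthogonal_apply]
  have := sqrt_three_mul_self
  fin_cases i
  · simp [pt, matH, Matrix.mulVec, dotProduct, Fin.sum_univ_three]
    linear_combination (-t / 2) * this
  · simp [pt, matH, Matrix.mulVec, dotProduct, Fin.sum_univ_three]
    ring
  · simp [pt, matH, Matrix.mulVec, dotProduct, Fin.sum_univ_three]

theorem acts_isoR : Acts isoR 1 1 0 (-1) (-1) 0 0 0 := by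
  intro s t u
  ext i
  rw [isoR, ofOrthogonal_apply]
  fin_cases i <;> simp [pt, matR, Matrix.mulVec, dotProduct, Fin.sum_univ_three]
  ring

theorem acts_isoH_inv : Acts isoH⁻¹ 1 1 (-1) 0 1 0 0 0 :=
  acts_isoH.inv (by simp) (by simp) (by simp) (by simp) (by simp) (by simp) (by simp) (by simp)

theorem acts_isoR_inv : Acts isoR⁻¹ 1 1 0 (-1) (-1) 0 0 0 :=
  acts_isoR.inv (by simp) (by simp) (by simp) (by simp) (by simp) (by simp) (by simp) (by simp)

theorem acts_isoH_sq : Acts (isoH ^ 2) (-1) (-1) 1 0 1 0 0 0 := by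
  simpa [pow_succ] using acts_isoH.mul acts_isoH

theorem acts_isoH_pow_three : Acts (isoH ^ 3) (-1) 0 0 (-1) 1 0 0 0 := by
  simpa [pow_succ] using acts_isoH_sq.mul acts_isoH

theorem acts_isoH_pow_four : Acts (isoH ^ 4) 0 1 (-1) (-1) 1 0 0 0 := by
  simpa [pow_succ] using acts_isoH_pow_three.mul acts_isoH

theorem acts_isoH_pow_five : Acts (isoH ^ 5) 1 1 (-1) 0 1 0 0 0 := by
  simpa [pow_succ] using acts_isoH_pow_four.mul acts_isoH

theorem acts_isoH_sq_inv : Acts (isoH ^ 2)⁻¹ 0 1 (-1) (-1) 1 0 0 0 :=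
  acts_isoH_sq.inv (by simp) (by simp) (by simp) (by simp) (by simp) (by simp) (by simp) (by simp)

theorem trans_mem {v : E 3} (hv : v ∈ hexLattice) : trans v ∈ translationGroup hexLattice :=
  ⟨v, hv, rfl⟩

theorem exists_acts_of_mem_translationGroup {g : I 3} (hg : g ∈ translationGroup hexLattice) :
    ∃ a b c : ℤ, Acts g 1 0 0 1 1 a b c := by
  obtain ⟨v, hv, rfl⟩ := hg
  obtain ⟨a, b, c, rfl⟩ := mem_hexLattice.1 hv
  exact ⟨a, b, c, acts_trans a b c⟩

theorem translationGroup_le_Γ₁ : translationGroup hexLattice ≤ Γ₁ := fun _ hg =>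
  Subgroup.subset_closure (Or.inl hg)

theorem translationGroup_le_Γ₂ : translationGroup hexLattice ≤ Γ₂ := fun _ hg =>
  Subgroup.subset_closure (Or.inl hg)

theorem isoH_mem : isoH ∈ Γ₁ := Subgroup.subset_closure (by simp)

theorem isoH_sq_mem : isoH ^ 2 ∈ Γ₂ := Subgroup.subset_closure (by simp)

theorem isoR_mem : isoR ∈ Γ₂ := Subgroup.subset_closure (by simp)

/-- The isometries of the form `H ^ j L_v`, in lattice coordinates. -/
def IsForm₁ (g : I 3) : Prop :=
  ∃ a b c : ℤ, Acts g 1 0 0 1 1 a b c ∨ Acts g 0 (-1) 1 1 1 a b c ∨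
    Acts g (-1) (-1) 1 0 1 a b c ∨ Acts g (-1) 0 0 (-1) 1 a b c ∨
    Acts g 0 1 (-1) (-1) 1 a b c ∨ Acts g 1 1 (-1) 0 1 a b c

/-- The isometries of the form `H ^ (2 j) R ^ k L_v`, in lattice coordinates. -/
def IsForm₂ (g : I 3) : Prop :=
  ∃ a b c : ℤ, Acts g 1 0 0 1 1 a b c ∨ Acts g (-1) (-1) 1 0 1 a b c ∨
    Acts g 0 1 (-1) (-1) 1 a b c ∨ Acts g 1 1 0 (-1) (-1) a b c ∨
    Acts g (-1) 0 1 1 (-1) a b c ∨ Acts g 0 (-1) (-1) 0 (-1) a b c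

/-- The subgroup is generated by translations and one rotation, so membership of the normal form
needs only left multiplication by a generator or its inverse. In each of the six cases the product
of linear parts is again in the list. -/
theorem IsForm₁.translation_mul {g h : I 3} {a b c : ℤ} (hg : Acts g 1 0 0 1 1 a b c)
    (hh : IsForm₁ h) : IsForm₁ (g * h) := by
  obtain ⟨a', b', c', hh | hh | hh | hh | hh | hh⟩ := hh <;> replace hh := hg.mul hh <;>
    norm_num at hh <;> exact ⟨_, _, _, by tauto⟩

theorem IsForm₁.rotation_mul {g h : I 3} {a b c : ℤ} (hg : Acts g 0 (-1) 1 1 1 a b c)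
    (hh : IsForm₁ h) : IsForm₁ (g * h) := by
  obtain ⟨a', b', c', hh | hh | hh | hh | hh | hh⟩ := hh <;> replace hh := hg.mul hh <;>
    norm_num at hh <;> exact ⟨_, _, _, by tauto⟩

theorem IsForm₁.rotation_inv_mul {g h : I 3} {a b c : ℤ} (hg : Acts g 1 1 (-1) 0 1 a b c)
    (hh : IsForm₁ h) : IsForm₁ (g * h) := by
  obtain ⟨a', b', c', hh | hh | hh | hh | hh | hh⟩ := hh <;> replace hh := hg.mul hh <;>
    norm_num at hh <;> exact ⟨_, _, _, by tauto⟩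

theorem IsForm₂.translation_mul {g h : I 3} {a b c : ℤ} (hg : Acts g 1 0 0 1 1 a b c)
    (hh : IsForm₂ h) : IsForm₂ (g * h) := by
  obtain ⟨a', b', c', hh | hh | hh | hh | hh | hh⟩ := hh <;> replace hh := hg.mul hh <;>
    norm_num at hh <;> exact ⟨_, _, _, by tauto⟩

theorem IsForm₂.rotation_mul {g h : I 3} {a b c : ℤ} (hg : Acts g (-1) (-1) 1 0 1 a b c)
    (hh : IsForm₂ h) : IsForm₂ (g * h) := by
  obtain ⟨a', b', c', hh | hh | hh | hh | hh | hh⟩ := hh <;> replace hh := hg.mul hh <;>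
    norm_num at hh <;> exact ⟨_, _, _, by tauto⟩

theorem IsForm₂.rotation_inv_mul {g h : I 3} {a b c : ℤ} (hg : Acts g 0 1 (-1) (-1) 1 a b c)
    (hh : IsForm₂ h) : IsForm₂ (g * h) := by
  obtain ⟨a', b', c', hh | hh | hh | hh | hh | hh⟩ := hh <;> replace hh := hg.mul hh <;>
    norm_num at hh <;> exact ⟨_, _, _, by tauto⟩

/-- `R` and its inverse have the same coordinates, so this single lemma serves for both. -/
theorem IsForm₂.halfturn_mul {g h : I 3} {a b c : ℤ} (hg : Acts g 1 1 0 (-1) (-1) a b c)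
    (hh : IsForm₂ h) : IsForm₂ (g * h) := by
  obtain ⟨a', b', c', hh | hh | hh | hh | hh | hh⟩ := hh <;> replace hh := hg.mul hh <;>
    norm_num at hh <;> exact ⟨_, _, _, by tauto⟩

theorem isForm₁_of_mem {g : I 3} (hg : g ∈ Γ₁) : IsForm₁ g := by
  induction hg using Subgroup.closure_induction_left with
  | one => exact ⟨0, 0, 0, Or.inl acts_one⟩
  | mul_left x hx y _ ih =>
    rcases hx with hx | rfl
    · obtain ⟨a, b, c, hx⟩ := exists_acts_of_mem_translationGroup hx
      exact ih.translation_mul hx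
    · exact ih.rotation_mul acts_isoH
  | inv_mul_cancel x hx y _ ih =>
    rcases hx with hx | rfl
    · obtain ⟨a, b, c, hx⟩ := exists_acts_of_mem_translationGroup (inv_mem hx)
      exact ih.translation_mul hx
    · exact ih.rotation_inv_mul acts_isoH_inv

theorem isForm₂_of_mem {g : I 3} (hg : g ∈ Γ₂) : IsForm₂ g := by
  induction hg using Subgroup.closure_induction_left with
  | one => exact ⟨0, 0, 0, Or.inl acts_one⟩
  | mul_left x hx y _ ih =>
    rcases hx with hx | rfl | rfl
    · obtain ⟨a, b, c, hx⟩ := exists_acts_of_mem_translationGroup hx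
      exact ih.translation_mul hx
    · exact ih.rotation_mul acts_isoH_sq
    · exact ih.halfturn_mul acts_isoR
  | inv_mul_cancel x hx y _ ih =>
    rcases hx with hx | rfl | rfl
    · obtain ⟨a, b, c, hx⟩ := exists_acts_of_mem_translationGroup (inv_mem hx)
      exact ih.translation_mul hx
    · exact ih.rotation_inv_mul acts_isoH_sq_inv
    · exact ih.halfturn_mul acts_isoR_inv

/-- The translation stands to the right of the rotation: Ax + w = A(x + A⁻¹w). The lattice vector is
therefore A⁻¹w, integral because A is invertible over the integers. -/
theorem IsForm₁.exists_eq {g : I 3} (hg : IsForm₁ g) :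
    ∃ j < 6, ∃ v ∈ hexLattice, g = isoH ^ j * trans v := by
  obtain ⟨a, b, c, hg | hg | hg | hg | hg | hg⟩ := hg
  · exact ⟨0, by norm_num, _, mem_hexLattice.2 ⟨a, b, c, rfl⟩,
      hg.ext (by simpa using acts_trans a b c)⟩
  · exact ⟨1, by norm_num, _, mem_hexLattice.2 ⟨a + b, -a, c, rfl⟩,
      hg.ext (by simpa using acts_isoH.mul (acts_trans (a + b) (-a) c))⟩
  · exact ⟨2, by norm_num, _, mem_hexLattice.2 ⟨b, -a - b, c, rfl⟩,
      hg.ext (by simpa using acts_isoH_sq.mul (acts_trans b (-a - b) c))⟩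
  · exact ⟨3, by norm_num, _, mem_hexLattice.2 ⟨-a, -b, c, rfl⟩,
      hg.ext (by simpa using acts_isoH_pow_three.mul (acts_trans (-a) (-b) c))⟩
  · exact ⟨4, by norm_num, _, mem_hexLattice.2 ⟨-a - b, a, c, rfl⟩,
      hg.ext (by simpa using acts_isoH_pow_four.mul (acts_trans (-a - b) a c))⟩
  · exact ⟨5, by norm_num, _, mem_hexLattice.2 ⟨-b, a + b, c, rfl⟩,
      hg.ext (by simpa using acts_isoH_pow_five.mul (acts_trans (-b) (a + b) c))⟩

theorem IsForm₂.exists_eq {g : I 3} (hg : IsForm₂ g) :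
    ∃ j < 3, ∃ k < 2, ∃ v ∈ hexLattice, g = isoH ^ (2 * j) * isoR ^ k * trans v := by
  obtain ⟨a, b, c, hg | hg | hg | hg | hg | hg⟩ := hg
  · exact ⟨0, by norm_num, 0, by norm_num, _, mem_hexLattice.2 ⟨a, b, c, rfl⟩,
      hg.ext (by simpa using acts_trans a b c)⟩
  · exact ⟨1, by norm_num, 0, by norm_num, _, mem_hexLattice.2 ⟨b, -a - b, c, rfl⟩,
      hg.ext (by simpa using acts_isoH_sq.mul (acts_trans b (-a - b) c))⟩
  · exact ⟨2, by norm_num, 0, by norm_num, _, mem_hexLattice.2 ⟨-a - b, a, c, rfl⟩,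
      hg.ext (by simpa using acts_isoH_pow_four.mul (acts_trans (-a - b) a c))⟩
  · exact ⟨0, by norm_num, 1, by norm_num, _, mem_hexLattice.2 ⟨a + b, -b, -c, rfl⟩,
      hg.ext (by simpa using acts_isoR.mul (acts_trans (a + b) (-b) (-c)))⟩
  · exact ⟨1, by norm_num, 1, by norm_num, _, mem_hexLattice.2 ⟨-a, a + b, -c, rfl⟩,
      hg.ext (by simpa using (acts_isoH_sq.mul acts_isoR).mul (acts_trans (-a) (a + b) (-c)))⟩
  · exact ⟨2, by norm_num, 1, by norm_num, _, mem_hexLattice.2 ⟨-b, -a, -c, rfl⟩,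
      hg.ext (by simpa using (acts_isoH_pow_four.mul acts_isoR).mul (acts_trans (-b) (-a) (-c)))⟩

theorem mem_Γ₁_iff (g : I 3) : g ∈ Γ₁ ↔ ∃ j < 6, ∃ v ∈ hexLattice, g = isoH ^ j * trans v := by
  refine ⟨fun h => (isForm₁_of_mem h).exists_eq, ?_⟩
  rintro ⟨j, -, v, hv, rfl⟩
  exact mul_mem (pow_mem isoH_mem j) (translationGroup_le_Γ₁ (trans_mem hv))

theorem mem_Γ₂_iff (g : I 3) : g ∈ Γ₂ ↔
    ∃ j < 3, ∃ k < 2, ∃ v ∈ hexLattice, g = isoH ^ (2 * j) * isoR ^ k * trans v := by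
  refine ⟨fun h => (isForm₂_of_mem h).exists_eq, ?_⟩
  rintro ⟨j, -, k, -, v, hv, rfl⟩
  rw [pow_mul]
  exact mul_mem (mul_mem (pow_mem isoH_sq_mem j) (pow_mem isoR_mem k))
    (translationGroup_le_Γ₂ (trans_mem hv))

theorem mem_Γ₁ {g : I 3} : g ∈ Γ₁ ↔ IsForm₁ g :=
  ⟨isForm₁_of_mem, fun h => (mem_Γ₁_iff g).2 h.exists_eq⟩

theorem mem_Γ₂ {g : I 3} : g ∈ Γ₂ ↔ IsForm₂ g :=
  ⟨isForm₂_of_mem, fun h => (mem_Γ₂_iff g).2 h.exists_eq⟩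

/-- The translation by `(a, b, c)` followed by a power of the rotation `H`. -/
theorem exists_acts_translation_mul {g : I 3} {m n p q e : ℤ} (hg : Acts g m n p q e 0 0 0)
    (a b c : ℤ) : Acts (trans (pt a b c) * g) m n p q e a b c := by
  simpa using (acts_trans a b c).mul hg

theorem exists_translation (a b c : ℤ) : ∃ g : I 3, Acts g 1 0 0 1 1 a b c :=
  ⟨_, acts_trans a b c⟩

theorem exists_rotation₂ (a b c : ℤ) : ∃ g : I 3, Acts g (-1) (-1) 1 0 1 a b c :=
  ⟨_, exists_acts_translation_mul acts_isoH_sq a b c⟩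

theorem exists_rotation₃ (a b c : ℤ) : ∃ g : I 3, Acts g (-1) 0 0 (-1) 1 a b c :=
  ⟨_, exists_acts_translation_mul acts_isoH_pow_three a b c⟩

theorem exists_rotation₄ (a b c : ℤ) : ∃ g : I 3, Acts g 0 1 (-1) (-1) 1 a b c :=
  ⟨_, exists_acts_translation_mul acts_isoH_pow_four a b c⟩

theorem exists_halfturn (a b c : ℤ) : ∃ g : I 3, Acts g 1 1 0 (-1) (-1) a b c :=
  ⟨_, exists_acts_translation_mul acts_isoR a b c⟩

theorem exists_halfturn₄ (a b c : ℤ) : ∃ g : I 3, Acts g 0 (-1) (-1) 0 (-1) a b c :=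
  ⟨_, exists_acts_translation_mul
    (by simpa using acts_isoH_pow_four.mul acts_isoR) a b c⟩

/-! ### Proper discontinuity and compactness -/

/-- A group of isometries all of which are integral affine maps with linear part bounded by one. -/
def IsIntegral (Γ : Subgroup (I 3)) : Prop :=
  ∀ g ∈ Γ, ∃ m n p q e a b c : ℤ, (|m| ≤ 1 ∧ |n| ≤ 1 ∧ |p| ≤ 1 ∧ |q| ≤ 1 ∧ |e| ≤ 1) ∧
    Acts g m n p q e a b c

theorem isIntegral_Γ₁ : IsIntegral Γ₁ := by
  intro g hg
  obtain ⟨a, b, c, h | h | h | h | h | h⟩ := isForm₁_of_mem hg <;>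
    exact ⟨_, _, _, _, _, a, b, c, by simp, h⟩

theorem isIntegral_Γ₂ : IsIntegral Γ₂ := by
  intro g hg
  obtain ⟨a, b, c, h | h | h | h | h | h⟩ := isForm₂_of_mem hg <;>
    exact ⟨_, _, _, _, _, a, b, c, by simp, h⟩

theorem abs_coord_le_norm (s t u : ℝ) :
    |s| ≤ ‖pt s t u‖ ∧ |t| ≤ ‖pt s t u‖ ∧ |u| ≤ ‖pt s t u‖ := by
  have h := norm_pt_sq s t u
  refine ⟨abs_le_of_sq_le_sq ?_ (norm_nonneg _), abs_le_of_sq_le_sq ?_ (norm_nonneg _),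
    abs_le_of_sq_le_sq ?_ (norm_nonneg _)⟩ <;> rw [h] <;>
  nlinarith [sq_nonneg (2 * s + t), sq_nonneg (s + 2 * t), sq_nonneg u, sq_nonneg s, sq_nonneg t]

/-- The translation part is a = s' - ms - nt, a sum of three terms of absolute value at most C. -/
theorem abs_translation_le {m n a : ℤ} {s t s' C : ℝ} (hm : |m| ≤ 1) (hn : |n| ≤ 1) (hs : |s| ≤ C)
    (ht : |t| ≤ C) (hs' : |s'| ≤ C) (h : m * s + n * t + a = s') : |a| ≤ ⌈3 * C⌉ := by
  have hm' : |(m : ℝ)| ≤ 1 := by exact_mod_cast hm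
  have hn' : |(n : ℝ)| ≤ 1 := by exact_mod_cast hn
  have h1 : |(m : ℝ) * s| ≤ C := by
    rw [abs_mul]; nlinarith [abs_nonneg s, abs_nonneg (m : ℝ)]
  have h2 : |(n : ℝ) * t| ≤ C := by
    rw [abs_mul]; nlinarith [abs_nonneg t, abs_nonneg (n : ℝ)]
  have h3 : |(a : ℝ)| ≤ 3 * C := by
    rw [abs_le] at *
    constructor <;> linarith
  have h4 : |(a : ℝ)| ≤ (⌈3 * C⌉ : ℤ) := h3.trans (Int.le_ceil _)
  exact_mod_cast h4

/-- If `g` moves a point of K into K, its translation part is bounded in terms of K, and its linear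
part is bounded anyway. So its eight integers lie in a finite box, and they determine `g`. -/
theorem IsIntegral.finite {Γ : Subgroup (I 3)} (hΓ : IsIntegral Γ) {K : Set (E 3)}
    (hK : IsCompact K) : {g : I 3 | g ∈ Γ ∧ (g '' K ∩ K).Nonempty}.Finite := by
  obtain ⟨C, hC⟩ := hK.isBounded.exists_norm_le
  set N : ℤ := ⌈3 * C⌉
  let S : Set (ℤ × ℤ × ℤ × ℤ × ℤ × ℤ × ℤ × ℤ) :=
    Set.Icc (-1, -1, -1, -1, -1, -N, -N, -N) (1, 1, 1, 1, 1, N, N, N)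
  have hS : S.Finite := Set.finite_Icc _ _
  refine (hS.biUnion (t := fun d => {g : I 3 |
    Acts g d.1 d.2.1 d.2.2.1 d.2.2.2.1 d.2.2.2.2.1 d.2.2.2.2.2.1 d.2.2.2.2.2.2.1
      d.2.2.2.2.2.2.2}) fun d _ =>
    Set.Subsingleton.finite fun g hg h hh => Acts.ext hg hh).subset ?_
  rintro g ⟨hg, y, ⟨x, hx, hxy⟩, hy⟩
  obtain ⟨m, n, p, q, e, a, b, c, ⟨hm, hn, hp, hq, he⟩, hact⟩ := hΓ g hg
  obtain ⟨s, t, u, rfl⟩ := exists_pt x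
  obtain ⟨s', t', u', rfl⟩ := exists_pt y
  rw [hact, pt_inj] at hxy
  obtain ⟨h1, h2, h3⟩ := hxy
  obtain ⟨hs, ht, hu⟩ := abs_coord_le_norm s t u
  obtain ⟨hs', ht', hu'⟩ := abs_coord_le_norm s' t' u'
  have hx' := hC _ hx
  have hy' := hC _ hy
  have ha := abs_translation_le hm hn (hs.trans hx') (ht.trans hx') (hs'.trans hy') h1
  have hb := abs_translation_le hp hq (hs.trans hx') (ht.trans hx') (ht'.trans hy') h2
  -- The third coordinate has no mixed term, so the bound is used with second coefficient zero.
  have hc := abs_translation_le (n := 0) he (by simp) (hu.trans hx') (ht.trans hx')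
    (hu'.trans hy') (by simpa using h3)
  rw [abs_le] at hm hn hp hq he ha hb hc
  simp only [Set.mem_iUnion]
  exact ⟨(m, n, p, q, e, a, b, c), by simp [S, Prod.le_def, N, *], hact⟩

theorem continuous_proj {V : Type*} [NormedAddCommGroup V] [InnerProductSpace ℝ V]
    (Γ : Subgroup (V ≃ᵃⁱ[ℝ] V)) : Continuous (proj Γ) :=
  continuous_quotient_mk'

theorem proj_eq_iff {V : Type*} [NormedAddCommGroup V] [InnerProductSpace ℝ V]
    {Γ : Subgroup (V ≃ᵃⁱ[ℝ] V)} {x y : V} : proj Γ x = proj Γ y ↔ ∃ g ∈ Γ, g x = y :=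
  Quotient.eq (r := orbitSetoid Γ)

theorem exists_proj_eq {V : Type*} [NormedAddCommGroup V] [InnerProductSpace ℝ V]
    {Γ : Subgroup (V ≃ᵃⁱ[ℝ] V)} (a : Orbifold Γ) : ∃ x : V, proj Γ x = a :=
  Quotient.exists_rep a

theorem proj_apply_eq {V : Type*} [NormedAddCommGroup V] [InnerProductSpace ℝ V]
    {Γ : Subgroup (V ≃ᵃⁱ[ℝ] V)} {g : V ≃ᵃⁱ[ℝ] V} (hg : g ∈ Γ) (x : V) :
    proj Γ (g x) = proj Γ x :=
  (proj_eq_iff.2 ⟨g, hg, rfl⟩).symm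

theorem exists_translation_to_cell {Γ : Subgroup (I 3)} (h : translationGroup hexLattice ≤ Γ)
    (s t u : ℝ) : ∃ g ∈ Γ, g (pt s t u) = pt (Int.fract s) (Int.fract t) (Int.fract u) := by
  refine ⟨_, h (trans_mem (mem_hexLattice.2 ⟨-⌊s⌋, -⌊t⌋, -⌊u⌋, rfl⟩)), ?_⟩
  rw [acts_trans, pt_inj]
  simp only [Int.fract]
  push_cast
  refine ⟨?_, ?_, ?_⟩ <;> ring

theorem compactSpace_of_translations {Γ : Subgroup (I 3)}
    (h : translationGroup hexLattice ≤ Γ) : CompactSpace (Orbifold Γ) := by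
  have hc : IsCompact (proj Γ '' ((fun p : ℝ × ℝ × ℝ => pt p.1 p.2.1 p.2.2) ''
      (Set.Icc (0, 0, 0) (1, 1, 1)))) :=
    (isCompact_Icc.image continuous_pt).image (continuous_proj Γ)
  refine ⟨?_⟩
  convert hc
  refine (Set.eq_univ_of_forall fun a => ?_).symm
  obtain ⟨x, rfl⟩ := exists_proj_eq a
  obtain ⟨s, t, u, rfl⟩ := exists_pt x
  refine ⟨_, ⟨(Int.fract s, Int.fract t, Int.fract u), ?_, rfl⟩, ?_⟩
  · simp [Prod.le_def, Int.fract_nonneg, (Int.fract_lt_one _).le]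
  · obtain ⟨g, hg, h1⟩ := exists_translation_to_cell h s t u
    exact (congrArg (proj Γ) h1).symm.trans (proj_apply_eq hg _)

theorem isCrystallographic_Γ₁ : IsCrystallographic Γ₁ :=
  ⟨fun _ hK => isIntegral_Γ₁.finite hK, compactSpace_of_translations translationGroup_le_Γ₁⟩

theorem isCrystallographic_Γ₂ : IsCrystallographic Γ₂ :=
  ⟨fun _ hK => isIntegral_Γ₂.finite hK, compactSpace_of_translations translationGroup_le_Γ₂⟩

/-! ### The fundamental domain -/

theorem mem_prism {s t u : ℝ} :
    pt s t u ∈ prism ↔ 0 ≤ t ∧ t ≤ s ∧ s + 2 * t ≤ 1 ∧ 0 ≤ u ∧ u ≤ 1 := by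
  have h0 : (!₂[0, 0, 0] : E 3) = pt 0 0 0 := by simp [pt]
  have h1 : (!₂[2, 0, 0] : E 3) = pt 1 0 0 := by simp [pt]
  have h2 : (!₂[1, 1 / √3, 0] : E 3) = pt (1 / 3) (1 / 3) 0 := by
    have := sqrt_three_mul_self
    have h3 := sqrt_three_pos.ne'
    ext i
    fin_cases i
    · simp [pt]; norm_num
    · simp [pt]
      field_simp
      linarith
    · simp [pt]
  have h3 : (!₂[0, 0, 1] : E 3) = pt 0 0 1 := by simp [pt]
  rw [prism, h0, h1, h2, h3, Set.mem_add]
  constructor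
  · rintro ⟨x, hx, y, ⟨p, q, hp, hq, hpq, rfl⟩, hxy⟩
    rw [convexHull_insert (by simp), convexHull_pair] at hx
    simp only [convexJoin_singleton_left, Set.mem_iUnion] at hx
    obtain ⟨z, ⟨a, b, ha, hb, hab, rfl⟩, ⟨c, d, hc, hd, hcd, rfl⟩⟩ := hx
    simp only [pt_smul, pt_add, pt_inj] at hxy
    obtain ⟨rfl, rfl, rfl⟩ := hxy
    have hda := mul_nonneg hd ha
    have hdb := mul_nonneg hd hb
    have : d * a + d * b = d := by rw [← mul_add, hab, mul_one]
    refine ⟨?_, ?_, ?_, ?_, ?_⟩ <;> nlinarith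
  · rintro ⟨h4, h5, h6, h7, h8⟩
    refine ⟨pt s t 0, ?_, pt 0 0 u, ⟨1 - u, u, by linarith, h7, by ring, ?_⟩, ?_⟩
    · have hc := convex_convexHull ℝ ({pt 0 0 0, pt 1 0 0, pt (1 / 3) (1 / 3) 0} : Set (E 3))
      have hsub := subset_convexHull ℝ ({pt 0 0 0, pt 1 0 0, pt (1 / 3) (1 / 3) 0} : Set (E 3))
      -- The weights are the barycentric coordinates of (s, t) in the triangle with vertices (0,0),
      -- (1,0), (1/3,1/3); the first three inequalities state that they are nonnegative.
      have := hc.sum_mem (t := Finset.univ) (w := ![1 - s - 2 * t, s - t, 3 * t])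
        (z := ![pt 0 0 0, pt 1 0 0, pt (1 / 3) (1 / 3) 0])
        (by intro i _; fin_cases i <;> simp <;> linarith)
        (by simp [Fin.sum_univ_three]; ring)
        (by intro i _; fin_cases i <;> apply hsub <;> simp)
      convert this using 1
      simp [Fin.sum_univ_three, pt_smul, pt_add, pt_inj]
      constructor <;> ring
    · simp [pt_smul, pt_add]
    · simp [pt_add]

theorem isCompact_prism : IsCompact prism := by
  refine IsCompact.add ?_ ?_
  · exact (Set.toFinite _).isCompact_convexHull (𝕜 := ℝ)
  · rw [← convexHull_pair]
    exact (Set.toFinite _).isCompact_convexHull (𝕜 := ℝ)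

theorem exists_sub_mem_of_mem_interior {D : Set (E 3)} {x : E 3} (hx : x ∈ interior D) (w : E 3) :
    ∃ ε > (0 : ℝ), x - ε • w ∈ D := by
  have hc : Filter.Tendsto (fun ε : ℝ => x - ε • w) (nhdsWithin 0 (Set.Ioi 0)) (nhds x) := by
    have : Continuous fun ε : ℝ => x - ε • w := by fun_prop
    simpa using (this.tendsto 0).mono_left nhdsWithin_le_nhds
  have h1 := hc.eventually (mem_interior_iff_mem_nhds.1 hx)
  obtain ⟨ε, h2, h3⟩ := (h1.and self_mem_nhdsWithin).exists
  exact ⟨ε, h3, h2⟩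

/-- Each of the five faces is tested by a small displacement across it: the displaced point still
satisfies the weak inequality, so the original one satisfies the strict one. -/
theorem of_mem_interior_prism {s t u : ℝ} (h : pt s t u ∈ interior prism) :
    0 < t ∧ t < s ∧ s + 2 * t < 1 ∧ 0 < u ∧ u < 1 := by
  obtain ⟨ε₁, h1, k1⟩ := exists_sub_mem_of_mem_interior h (pt 0 1 0)
  obtain ⟨ε₂, h2, k2⟩ := exists_sub_mem_of_mem_interior h (pt 1 0 0)
  obtain ⟨ε₃, h3, k3⟩ := exists_sub_mem_of_mem_interior h (pt (-1) 0 0)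
  obtain ⟨ε₄, h4, k4⟩ := exists_sub_mem_of_mem_interior h (pt 0 0 1)
  obtain ⟨ε₅, h5, k5⟩ := exists_sub_mem_of_mem_interior h (pt 0 0 (-1))
  rw [pt_smul, pt_sub, mem_prism] at k1 k2 k3 k4 k5
  refine ⟨?_, ?_, ?_, ?_, ?_⟩ <;> linarith

/-- Half of the unit cell is an equilateral triangle with centre (1/3, 1/3), and the base of the
prism is one third of it. The three maps are the rotations of order dividing three about the centre;
they belong to both groups and keep the height. -/
theorem exists_rotation_to_triangle {s t : ℝ} (hs : 0 ≤ s) (ht : 0 ≤ t) (hst : s + t ≤ 1) :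
    ∃ g : I 3, (Acts g 1 0 0 1 1 0 0 0 ∨ Acts g (-1) (-1) 1 0 1 1 0 0 ∨
      Acts g 0 1 (-1) (-1) 1 0 1 0) ∧ ∃ s' t' : ℝ, (∀ u, g (pt s t u) = pt s' t' u) ∧
      0 ≤ t' ∧ t' ≤ s' ∧ s' + 2 * t' ≤ 1 := by
  by_cases h1 : t ≤ s ∧ s + 2 * t ≤ 1
  · exact ⟨1, Or.inl acts_one, s, t, fun u => rfl, ht, h1.1, h1.2⟩
  by_cases h2 : s ≤ t ∧ 2 * s + t ≤ 1
  · obtain ⟨g, hg⟩ := exists_rotation₂ 1 0 0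
    refine ⟨g, by tauto, 1 - s - t, s, fun u => ?_, hs, by linarith, by linarith⟩
    rw [hg, pt_inj]
    push_cast
    refine ⟨?_, ?_, ?_⟩ <;> ring
  · obtain ⟨g, hg⟩ := exists_rotation₄ 0 1 0
    refine ⟨g, by tauto, t, 1 - s - t, fun u => ?_, by linarith, ?_, ?_⟩
    · rw [hg, pt_inj]
      push_cast
      refine ⟨?_, ?_, ?_⟩ <;> ring
    · by_contra h3
      grind
    · by_contra h3
      grind

theorem exists_mem_prism_Γ₁ (x : E 3) : ∃ g ∈ Γ₁, g x ∈ prism := by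
  obtain ⟨s, t, u, rfl⟩ := exists_pt x
  obtain ⟨g, hg, h1⟩ := exists_translation_to_cell translationGroup_le_Γ₁ s t u
  have hs := Int.fract_nonneg s
  have ht := Int.fract_nonneg t
  have hu := Int.fract_nonneg u
  have hs' := Int.fract_lt_one s
  have ht' := Int.fract_lt_one t
  have hu' := Int.fract_lt_one u
  by_cases hst : Int.fract s + Int.fract t ≤ 1
  · obtain ⟨k, hk, s', t', h2, h3, h4, h5⟩ := exists_rotation_to_triangle hs ht hst
    refine ⟨k * g, mul_mem (mem_Γ₁.2 ?_) hg, ?_⟩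
    · rcases hk with hk | hk | hk <;> exact ⟨_, _, _, by tauto⟩
    · rw [AffineIsometryEquiv.coe_mul, Function.comp_apply, h1, h2, mem_prism]
      exact ⟨h3, h4, h5, hu, hu'.le⟩
  -- The other half of the cell is exchanged with the first by the half-turn about the vertical axis
  -- through (1/2, 1/2).
  · obtain ⟨l, hl⟩ := exists_rotation₃ 1 1 0
    obtain ⟨k, hk, s', t', h2, h3, h4, h5⟩ := exists_rotation_to_triangle
      (s := 1 - Int.fract s) (t := 1 - Int.fract t) (by linarith) (by linarith) (by linarith)
    have hl' : l (pt (Int.fract s) (Int.fract t) (Int.fract u)) =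
        pt (1 - Int.fract s) (1 - Int.fract t) (Int.fract u) := by
      rw [hl, pt_inj]
      push_cast
      refine ⟨?_, ?_, ?_⟩ <;> ring
    refine ⟨k * (l * g), mul_mem (mem_Γ₁.2 ?_) (mul_mem (mem_Γ₁.2 ⟨1, 1, 0, by tauto⟩) hg), ?_⟩
    · rcases hk with hk | hk | hk <;> exact ⟨_, _, _, by tauto⟩
    · rw [AffineIsometryEquiv.coe_mul, Function.comp_apply, AffineIsometryEquiv.coe_mul,
        Function.comp_apply, h1, hl', h2, mem_prism]
      exact ⟨h3, h4, h5, hu, hu'.le⟩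

theorem exists_mem_prism_Γ₂ (x : E 3) : ∃ g ∈ Γ₂, g x ∈ prism := by
  obtain ⟨s, t, u, rfl⟩ := exists_pt x
  obtain ⟨g, hg, h1⟩ := exists_translation_to_cell translationGroup_le_Γ₂ s t u
  have hs := Int.fract_nonneg s
  have ht := Int.fract_nonneg t
  have hu := Int.fract_nonneg u
  have hs' := Int.fract_lt_one s
  have ht' := Int.fract_lt_one t
  have hu' := Int.fract_lt_one u
  by_cases hst : Int.fract s + Int.fract t ≤ 1
  · obtain ⟨k, hk, s', t', h2, h3, h4, h5⟩ := exists_rotation_to_triangle hs ht hst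
    refine ⟨k * g, mul_mem (mem_Γ₂.2 ?_) hg, ?_⟩
    · rcases hk with hk | hk | hk <;> exact ⟨_, _, _, by tauto⟩
    · rw [AffineIsometryEquiv.coe_mul, Function.comp_apply, h1, h2, mem_prism]
      exact ⟨h3, h4, h5, hu, hu'.le⟩
  -- Here the two halves are exchanged by a half-turn about a horizontal axis, which also replaces
  -- the height u by 1 - u; the prism is symmetric under this.
  · obtain ⟨l, hl⟩ := exists_halfturn₄ 1 1 1
    obtain ⟨k, hk, s', t', h2, h3, h4, h5⟩ := exists_rotation_to_triangle
      (s := 1 - Int.fract t) (t := 1 - Int.fract s) (by linarith) (by linarith) (by linarith)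
    have hl' : l (pt (Int.fract s) (Int.fract t) (Int.fract u)) =
        pt (1 - Int.fract t) (1 - Int.fract s) (1 - Int.fract u) := by
      rw [hl, pt_inj]
      push_cast
      refine ⟨?_, ?_, ?_⟩ <;> ring
    refine ⟨k * (l * g), mul_mem (mem_Γ₂.2 ?_) (mul_mem (mem_Γ₂.2 ⟨1, 1, 1, by tauto⟩) hg), ?_⟩
    · rcases hk with hk | hk | hk <;> exact ⟨_, _, _, by tauto⟩
    · rw [AffineIsometryEquiv.coe_mul, Function.comp_apply, AffineIsometryEquiv.coe_mul,
        Function.comp_apply, h1, hl', h2, mem_prism]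
      exact ⟨h3, h4, h5, by linarith, by linarith⟩

theorem bounds_of_triangle {s t s' t' : ℝ} (h : 0 < t ∧ t < s ∧ s + 2 * t < 1)
    (h' : 0 < t' ∧ t' < s' ∧ s' + 2 * t' < 1) {a b : ℤ} {x y : ℝ}
    (hx : -1 ≤ x ∧ x ≤ 1) (hy : -1 ≤ y ∧ y ≤ 1) (ha : s' = x + a) (hb : t' = y + b) :
    (a = -1 ∨ a = 0 ∨ a = 1) ∧ (b = -1 ∨ b = 0 ∨ b = 1) := by
  have h1 : (a : ℝ) < 2 := by linarith
  have h2 : (-2 : ℝ) < a := by linarith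
  have h3 : (b : ℝ) < 2 := by linarith
  have h4 : (-2 : ℝ) < b := by linarith
  have h1 : a < 2 := by exact_mod_cast h1
  have h2 : -2 < a := by exact_mod_cast h2
  have h3 : b < 2 := by exact_mod_cast h3
  have h4 : -2 < b := by exact_mod_cast h4
  omega

/-- The open prism has width at most one in every lattice coordinate, so two of its points cannot
differ by a nonzero integral vector. -/
theorem Acts.eq_one_of_mem_interior_prism {g : I 3} {a b c : ℤ} (h : Acts g 1 0 0 1 1 a b c)
    {s t u : ℝ} (hy : pt s t u ∈ interior prism) (hx : g (pt s t u) ∈ interior prism) :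
    g = 1 := by
  obtain ⟨h1, h2, h3, h4, h5⟩ := of_mem_interior_prism hy
  rw [h] at hx
  obtain ⟨k1, k2, k3, k4, k5⟩ := of_mem_interior_prism hx
  push_cast at k1 k2 k3 k4 k5
  have h6 : (a : ℝ) < 1 := by linarith
  have h7 : (-1 : ℝ) < a := by linarith
  have h8 : (b : ℝ) < 1 := by linarith
  have h9 : (-1 : ℝ) < b := by linarith
  have l1 : (c : ℝ) < 1 := by linarith
  have l2 : (-1 : ℝ) < c := by linarith
  norm_cast at h6 h7 h8 h9 l1 l2
  obtain rfl : a = 0 := by omega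
  obtain rfl : b = 0 := by omega
  obtain rfl : c = 0 := by omega
  exact h.ext acts_one

theorem isFundamentalDomain_Γ₁ : IsFundamentalDomain Γ₁ prism := by
  refine ⟨isCompact_prism.isClosed, exists_mem_prism_Γ₁, fun g hg hg1 => ?_⟩
  rw [Set.disjoint_left]
  rintro _ hx ⟨y, hy, rfl⟩
  obtain ⟨s, t, u, rfl⟩ := exists_pt y
  have hy' := of_mem_interior_prism hy
  obtain ⟨h1, h2, h3, h4, h5⟩ := hy'
  obtain ⟨a, b, c, h | h | h | h | h | h⟩ := isForm₁_of_mem hg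
  · exact hg1 (h.eq_one_of_mem_interior_prism hy hx)
  all_goals
    rw [h] at hx
    obtain ⟨k1, k2, k3, k4, k5⟩ := of_mem_interior_prism hx
    push_cast at k1 k2 k3 k4 k5
    -- Only nine horizontal translation parts are possible for each nontrivial linear part, and none
    -- of them maps a point of the open triangle into it.
    obtain ⟨rfl | rfl | rfl, rfl | rfl | rfl⟩ := bounds_of_triangle ⟨h1, h2, h3⟩ ⟨k1, k2, k3⟩
      (by constructor <;> linarith) (by constructor <;> linarith) rfl rfl <;>
    push_cast at k1 k2 k3 <;> linarith

theorem isFundamentalDomain_Γ₂ : IsFundamentalDomain Γ₂ prism := by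
  refine ⟨isCompact_prism.isClosed, exists_mem_prism_Γ₂, fun g hg hg1 => ?_⟩
  rw [Set.disjoint_left]
  rintro _ hx ⟨y, hy, rfl⟩
  obtain ⟨s, t, u, rfl⟩ := exists_pt y
  have hy' := of_mem_interior_prism hy
  obtain ⟨h1, h2, h3, h4, h5⟩ := hy'
  obtain ⟨a, b, c, h | h | h | h | h | h⟩ := isForm₂_of_mem hg
  · exact hg1 (h.eq_one_of_mem_interior_prism hy hx)
  all_goals
    rw [h] at hx
    obtain ⟨k1, k2, k3, k4, k5⟩ := of_mem_interior_prism hx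
    push_cast at k1 k2 k3 k4 k5
    obtain ⟨rfl | rfl | rfl, rfl | rfl | rfl⟩ := bounds_of_triangle ⟨h1, h2, h3⟩ ⟨k1, k2, k3⟩
      (by constructor <;> linarith) (by constructor <;> linarith) rfl rfl <;>
    push_cast at k1 k2 k3 <;> linarith

/-! ### Isotropy groups -/

section Isotropy

variable {V : Type*} [NormedAddCommGroup V] [InnerProductSpace ℝ V]
variable {Γ : Subgroup (V ≃ᵃⁱ[ℝ] V)}

/-- Points of the same orbit have conjugate stabilizers. -/
def stabilizerConj {g : V ≃ᵃⁱ[ℝ] V} (hg : g ∈ Γ) (x : V) :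
    stabilizer Γ x ≃* stabilizer Γ (g x) where
  toFun k := ⟨g * k * g⁻¹, mul_mem (mul_mem hg k.2.1) (inv_mem hg), by
    have h1 : g⁻¹ (g x) = x := g.symm_apply_apply x
    simp only [AffineIsometryEquiv.coe_mul, Function.comp_apply, h1, k.2.2]⟩
  invFun k := ⟨g⁻¹ * k * g, mul_mem (mul_mem (inv_mem hg) k.2.1) hg, by
    simp only [AffineIsometryEquiv.coe_mul, Function.comp_apply, k.2.2]
    exact g.symm_apply_apply x⟩
  left_inv k := by ext1; simp [mul_assoc]
  right_inv k := by ext1; simp [mul_assoc]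
  map_mul' k l := by ext1; simp [mul_assoc]

/-- Stabilizers along an orbit are conjugate, so the isotropy group can be tested at any
representative. -/
theorem hasIsotropy_proj_iff {x : V} {G : Type} [Group G] :
    HasIsotropy Γ (proj Γ x) G ↔ Nonempty (stabilizer Γ x ≃* G) := by
  refine ⟨?_, fun h => ⟨x, rfl, h⟩⟩
  rintro ⟨y, hy, ⟨e⟩⟩
  obtain ⟨g, hg, rfl⟩ := proj_eq_iff.1 hy
  exact ⟨(stabilizerConj hg y).symm.trans e⟩

/-- The order of the isotropy group of a point. -/
def isotropyOrder (Γ : Subgroup (V ≃ᵃⁱ[ℝ] V)) (a : Orbifold Γ) : ℕ :=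
  Nat.card (stabilizer Γ (Quotient.out a : V))

theorem isotropyOrder_proj (x : V) : isotropyOrder Γ (proj Γ x) = Nat.card (stabilizer Γ x) := by
  have h : proj Γ (Quotient.out (proj Γ x) : V) = proj Γ x := Quotient.out_eq _
  obtain ⟨g, hg, hx⟩ := proj_eq_iff.1 h
  unfold isotropyOrder
  rw [Nat.card_congr (stabilizerConj hg _).toEquiv, hx]

theorem HasIsotropy.isotropyOrder_eq {a : Orbifold Γ} {G : Type} [Group G]
    (h : HasIsotropy Γ a G) : isotropyOrder Γ a = Nat.card G := by
  obtain ⟨x, rfl, ⟨e⟩⟩ := h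
  rw [isotropyOrder_proj, Nat.card_congr e.toEquiv]

theorem mem_maximalIsotropySet {a : Orbifold Γ} :
    a ∈ maximalIsotropySet Γ ↔ ∀ b, isotropyOrder Γ b ≤ isotropyOrder Γ a := by
  constructor
  · rintro ⟨x, rfl, hx⟩ b
    obtain ⟨y, rfl⟩ := exists_proj_eq b
    simpa only [isotropyOrder_proj] using hx y
  · intro h
    obtain ⟨x, rfl⟩ := exists_proj_eq a
    exact ⟨x, rfl, fun y => by simpa only [isotropyOrder_proj] using h (proj Γ y)⟩

theorem hasIsotropy_zmod {x : V} {g : V ≃ᵃⁱ[ℝ] V} {n : ℕ}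
    (h : stabilizer Γ x = Subgroup.zpowers g) (hg : orderOf g = n) :
    HasIsotropy Γ (proj Γ x) (Multiplicative (ZMod n)) := by
  rw [hasIsotropy_proj_iff, h]
  refine ⟨mulEquivOfCyclicCardEq ?_⟩
  rw [Nat.card_zpowers, hg]
  exact (Nat.card_zmod n).symm

theorem hasIsotropy_unit {x : V} (h : ∀ g ∈ Γ, g x = x → g = 1) :
    HasIsotropy Γ (proj Γ x) Unit := by
  rw [hasIsotropy_proj_iff]
  have h1 : stabilizer Γ x = ⊥ := (Subgroup.eq_bot_iff_forall _).2 fun g hg => h g hg.1 hg.2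
  rw [h1]
  exact ⟨MulEquiv.ofUnique⟩

end Isotropy

/-- The homomorphism from a dihedral group given by elements satisfying its relations. -/
def dihedralHom {G : Type*} [Group G] {n : ℕ} [NeZero n] {ρ σ : G} (hρ : ρ ^ n = 1)
    (hσ : σ * σ = 1) (hρσ : ρ * σ = σ * ρ⁻¹) : DihedralGroup n →* G :=
  -- σ conjugates ρ to its inverse, hence it passes a power of ρ at the cost of the sign of the
  -- exponent.
  have hpow : ∀ k : ℤ, ρ ^ k * σ = σ * ρ ^ (-k) := fun k => by
    have h1 : SemiconjBy σ ρ⁻¹ ρ := hρσ.symm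
    have h2 := h1.zpow_right k
    rw [inv_zpow'] at h2
    exact h2.eq.symm
  -- The exponents below are representatives of residues modulo n, and the powers of ρ depend only
  -- on the residue.
  have hcongr : ∀ x y : ℤ, (x : ZMod n) = (y : ZMod n) → ρ ^ x = ρ ^ y := fun x y h => by
    rw [ZMod.intCast_eq_intCast_iff] at h
    exact zpow_eq_zpow_iff_modEq.2 (h.of_dvd (by exact_mod_cast orderOf_dvd_of_pow_eq_one hρ))
  MonoidHom.mk' (fun d => match d with
    | .r i => ρ ^ (i.val : ℤ)
    | .sr i => σ * ρ ^ (i.val : ℤ)) (by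
    rintro (i | i) (j | j)
    · simp only [DihedralGroup.r_mul_r]
      rw [← zpow_add]
      exact hcongr _ _ (by simp)
    · simp only [DihedralGroup.r_mul_sr]
      rw [← mul_assoc, hpow, mul_assoc, ← zpow_add]
      exact congrArg _ (hcongr _ _ (by simp; ring))
    · simp only [DihedralGroup.sr_mul_r]
      rw [mul_assoc, ← zpow_add]
      exact congrArg _ (hcongr _ _ (by simp))
    · simp only [DihedralGroup.sr_mul_sr]
      rw [mul_assoc, ← mul_assoc _ σ, hpow, mul_assoc, ← mul_assoc σ, hσ, one_mul, ← zpow_add]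
      exact hcongr _ _ (by simp; ring))

theorem dihedralHom_r {G : Type*} [Group G] {n : ℕ} [NeZero n] {ρ σ : G} (hρ : ρ ^ n = 1)
    (hσ : σ * σ = 1) (hρσ : ρ * σ = σ * ρ⁻¹) (i : ZMod n) :
    dihedralHom hρ hσ hρσ (.r i) = ρ ^ i.val := zpow_natCast ρ i.val

theorem dihedralHom_sr {G : Type*} [Group G] {n : ℕ} [NeZero n] {ρ σ : G} (hρ : ρ ^ n = 1)
    (hσ : σ * σ = 1) (hρσ : ρ * σ = σ * ρ⁻¹) (i : ZMod n) :
    dihedralHom hρ hσ hρσ (.sr i) = σ * ρ ^ i.val := by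
  rw [← zpow_natCast]; rfl

theorem Acts.proj_eq {Γ : Subgroup (I 3)} {g : I 3} {m n p q e a b c : ℤ}
    (h : Acts g m n p q e a b c) (hg : g ∈ Γ) {s t u s' t' u' : ℝ} (h1 : m * s + n * t + a = s')
    (h2 : p * s + q * t + b = t') (h3 : e * u + c = u') :
    proj Γ (pt s t u) = proj Γ (pt s' t' u') := by
  rw [← proj_apply_eq hg, h, h1, h2, h3]

theorem Acts.eq_one_of_fixed {g : I 3} {a b c : ℤ} (h : Acts g 1 0 0 1 1 a b c) {x : E 3}
    (hx : g x = x) : g = 1 := by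
  obtain ⟨s, t, u, rfl⟩ := exists_pt x
  rw [h, pt_inj] at hx
  push_cast at hx
  obtain ⟨h1, h2, h3⟩ := hx
  have ha : (a : ℝ) = 0 := by linarith
  have hb : (b : ℝ) = 0 := by linarith
  have hc : (c : ℝ) = 0 := by linarith
  norm_cast at ha hb hc
  subst ha hb hc
  exact h.ext acts_one

/-! ### Isotropy groups of the first orbifold -/

theorem orderOf_isoH : orderOf isoH = 6 := by
  have h2 : isoH ^ 2 ≠ 1 := fun h => by
    have := acts_isoH_sq 1 0 0
    rw [h, AffineIsometryEquiv.coe_one, id_eq, pt_inj] at this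
    norm_num at this
  have h3 : isoH ^ 3 ≠ 1 := fun h => by
    have := acts_isoH_pow_three 1 0 0
    rw [h, AffineIsometryEquiv.coe_one, id_eq, pt_inj] at this
    norm_num at this
  have h6 : isoH ^ 6 = 1 := by
    refine Acts.ext (?_ : Acts _ 1 0 0 1 1 0 0 0) acts_one
    simpa [← pow_add] using acts_isoH_pow_three.mul acts_isoH_pow_three
  -- The exponents to exclude are 6/2 and 6/3.
  refine orderOf_eq_of_pow_and_pow_div_prime (by norm_num) h6 fun p hp hd => ?_
  have hp6 : p ≤ 6 := Nat.le_of_dvd (by norm_num) hd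
  interval_cases p <;> first | (exfalso; revert hp; norm_num; done) | (exfalso; omega) | simpa

theorem stabilizer_Γ₁_axis₆ (u : ℝ) : stabilizer Γ₁ (pt 0 0 u) = Subgroup.zpowers isoH := by
  apply le_antisymm
  · rintro g ⟨hg, hx⟩
    obtain ⟨a, b, c, h⟩ := isForm₁_of_mem hg
    have h0 : a = 0 ∧ b = 0 ∧ c = 0 := by
      rcases h with h | h | h | h | h | h <;>
      · rw [h, pt_inj] at hx
        push_cast at hx
        obtain ⟨h1, h2, h3⟩ := hx
        have ha : (a : ℝ) = 0 := by linarith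
        have hb : (b : ℝ) = 0 := by linarith
        have hc : (c : ℝ) = 0 := by linarith
        exact ⟨by exact_mod_cast ha, by exact_mod_cast hb, by exact_mod_cast hc⟩
    obtain ⟨rfl, rfl, rfl⟩ := h0
    rcases h with h | h | h | h | h | h
    · rw [h.ext acts_one]; exact one_mem _
    · rw [h.ext acts_isoH]; exact Subgroup.mem_zpowers _
    · rw [h.ext acts_isoH_sq]; exact Subgroup.npow_mem_zpowers _ _
    · rw [h.ext acts_isoH_pow_three]; exact Subgroup.npow_mem_zpowers _ _
    · rw [h.ext acts_isoH_pow_four]; exact Subgroup.npow_mem_zpowers _ _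
    · rw [h.ext acts_isoH_pow_five]; exact Subgroup.npow_mem_zpowers _ _
  · rw [Subgroup.zpowers_le]
    refine ⟨isoH_mem, ?_⟩
    rw [acts_isoH, pt_inj]
    simp

theorem hasIsotropy_Γ₁_axis₆ (u : ℝ) :
    HasIsotropy Γ₁ (proj Γ₁ (pt 0 0 u)) (Multiplicative (ZMod 6)) :=
  hasIsotropy_zmod (stabilizer_Γ₁_axis₆ u) orderOf_isoH

theorem no_third {a : ℤ} {x : ℝ} (hx : x = 1 / 3 ∨ x = 2 / 3 ∨ x = 1 / 2) : (a : ℝ) ≠ x := by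
  rintro rfl
  have : (a : ℝ) * 3 = 1 ∨ (a : ℝ) * 3 = 2 ∨ (a : ℝ) * 2 = 1 := by
    rcases hx with h | h | h <;> rw [h] <;> norm_num
  norm_cast at this
  omega

/-- The rotation of order three about the axis through `(1, 1/√3, 0)`. -/
def rot₃ : I 3 := (exists_rotation₂ 1 0 0).choose

theorem acts_rot₃ : Acts rot₃ (-1) (-1) 1 0 1 1 0 0 := (exists_rotation₂ 1 0 0).choose_spec

theorem acts_rot₃_sq : Acts (rot₃ ^ 2) 0 1 (-1) (-1) 1 0 1 0 := by
  simpa [pow_two] using acts_rot₃.mul acts_rot₃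

theorem orderOf_eq_three {g : I 3} (h3 : Acts (g ^ 3) 1 0 0 1 1 0 0 0)
    {a b c : ℤ} (h1 : Acts g (-1) (-1) 1 0 1 a b c) : orderOf g = 3 := by
  refine orderOf_eq_prime (h3.ext acts_one) fun h => ?_
  -- The difference of the two images is the first column of the linear part, which is not that of
  -- the identity.
  have h4 := h1 0 0 0
  have h5 := h1 1 0 0
  rw [h, AffineIsometryEquiv.coe_one, id_eq, pt_inj] at h4 h5
  norm_num at h4 h5
  rw [← h4.1] at h5
  norm_num at h5

theorem orderOf_rot₃ : orderOf rot₃ = 3 :=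
  orderOf_eq_three (by simpa [pow_succ] using acts_rot₃_sq.mul acts_rot₃) acts_rot₃

/-- Among the maps fixing (1/3, 1/3) horizontally, the linear parts of order 2 and 6 would need a
translation part 2/3. Stated for the normal form rather than for `Γ₁`, because the height preserving
elements of `Γ₂` have this form too. -/
theorem mem_zpowers_rot₃ {g : I 3} {u : ℝ} (h : IsForm₁ g) (hx : g (pt (1 / 3) (1 / 3) u) =
    pt (1 / 3) (1 / 3) u) : g ∈ Subgroup.zpowers rot₃ := by
  obtain ⟨a, b, c, h | h | h | h | h | h⟩ := h
  · rw [h.eq_one_of_fixed hx]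
    exact one_mem _
  all_goals
    rw [h, pt_inj] at hx
    push_cast at hx
    obtain ⟨h1, h2, h3⟩ := hx
    have hc : (c : ℝ) = 0 := by linarith
    norm_cast at hc
    subst hc
  · exact absurd (show (a : ℝ) = 2 / 3 by linarith) (no_third (by simp))
  · have ha : (a : ℝ) = 1 := by linarith
    have hb : (b : ℝ) = 0 := by linarith
    norm_cast at ha hb
    subst ha hb
    rw [h.ext acts_rot₃]
    exact Subgroup.mem_zpowers _
  · exact absurd (show (a : ℝ) = 2 / 3 by linarith) (no_third (by simp))
  · have ha : (a : ℝ) = 0 := by linarith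
    have hb : (b : ℝ) = 1 := by linarith
    norm_cast at ha hb
    subst ha hb
    rw [h.ext acts_rot₃_sq]
    exact Subgroup.npow_mem_zpowers _ _
  · exact absurd (show (b : ℝ) = 2 / 3 by linarith) (no_third (by simp))

theorem rot₃_fixed (u : ℝ) : rot₃ (pt (1 / 3) (1 / 3) u) = pt (1 / 3) (1 / 3) u := by
  rw [acts_rot₃, pt_inj]
  norm_num

theorem hasIsotropy_Γ₁_axis₃ (u : ℝ) :
    HasIsotropy Γ₁ (proj Γ₁ (pt (1 / 3) (1 / 3) u)) (Multiplicative (ZMod 3)) := by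
  refine hasIsotropy_zmod (g := rot₃) (le_antisymm ?_ ?_) orderOf_rot₃
  · rintro g ⟨hg, hx⟩
    exact mem_zpowers_rot₃ (isForm₁_of_mem hg) hx
  · rw [Subgroup.zpowers_le]
    exact ⟨mem_Γ₁.2 ⟨1, 0, 0, by have := acts_rot₃; tauto⟩, rot₃_fixed u⟩

theorem hasIsotropy_Γ₁_axis₂ (u : ℝ) :
    HasIsotropy Γ₁ (proj Γ₁ (pt (1 / 2) 0 u)) (Multiplicative (ZMod 2)) := by
  obtain ⟨k, hk⟩ := exists_rotation₃ 1 0 0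
  have hk1 : k ≠ 1 := fun h => by
    have := hk 0 0 0
    rw [h, AffineIsometryEquiv.coe_one, id_eq, pt_inj] at this
    norm_num at this
  have hk2 : k ^ 2 = 1 := by
    refine Acts.ext (?_ : Acts _ 1 0 0 1 1 0 0 0) acts_one
    simpa [pow_two] using hk.mul hk
  refine hasIsotropy_zmod (g := k) (le_antisymm ?_ ?_) (orderOf_eq_prime hk2 hk1)
  · rintro g ⟨hg, hx⟩
    obtain ⟨a, b, c, h | h | h | h | h | h⟩ := isForm₁_of_mem hg
    · rw [h.eq_one_of_fixed hx]
      exact one_mem _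
    all_goals
      rw [h, pt_inj] at hx
      push_cast at hx
      obtain ⟨h1, h2, h3⟩ := hx
      have hc : (c : ℝ) = 0 := by linarith
      norm_cast at hc
      subst hc
    · exact absurd (show (a : ℝ) = 1 / 2 by linarith) (no_third (by simp))
    · exact absurd (show ((-b : ℤ) : ℝ) = 1 / 2 by push_cast; linarith) (no_third (by simp))
    · have ha : (a : ℝ) = 1 := by linarith
      have hb : (b : ℝ) = 0 := by linarith
      norm_cast at ha hb
      subst ha hb
      rw [h.ext hk]
      exact Subgroup.mem_zpowers _
    · exact absurd (show (a : ℝ) = 1 / 2 by linarith) (no_third (by simp))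
    · exact absurd (show (b : ℝ) = 1 / 2 by linarith) (no_third (by simp))
  · rw [Subgroup.zpowers_le]
    refine ⟨mem_Γ₁.2 ⟨1, 0, 0, by tauto⟩, ?_⟩
    rw [hk, pt_inj]
    norm_num

theorem proj_Γ₁_int (a b : ℤ) (u : ℝ) : proj Γ₁ (pt a b u) = proj Γ₁ (pt 0 0 u) :=
  (acts_trans (-a) (-b) 0).proj_eq (mem_Γ₁.2 ⟨_, _, _, Or.inl (acts_trans _ _ _)⟩)
    (by push_cast; ring) (by push_cast; ring) (by push_cast; ring)

/-- Modulo the lattice there are three nonzero half lattice points in the plane, and the rotation of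
order three permutes them cyclically. -/
theorem proj_Γ₁_half (a b : ℤ) (u : ℝ) : proj Γ₁ (pt (a / 2) (b / 2) u) = proj Γ₁ (pt 0 0 u) ∨
    proj Γ₁ (pt (a / 2) (b / 2) u) = proj Γ₁ (pt (1 / 2) 0 u) := by
  obtain ⟨a, rfl | rfl⟩ := Int.even_or_odd' a <;> obtain ⟨b, rfl | rfl⟩ := Int.even_or_odd' b
  · left
    rw [← proj_Γ₁_int a b]
    push_cast
    congr 2 <;> ring
  · right
    obtain ⟨g, hg⟩ := exists_rotation₂ (a + b + 1) (-a) 0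
    exact hg.proj_eq (mem_Γ₁.2 ⟨_, _, _, by tauto⟩) (by push_cast; ring) (by push_cast; ring)
      (by push_cast; ring)
  · right
    obtain ⟨g, hg⟩ := exists_translation (-a) (-b) 0
    exact hg.proj_eq (mem_Γ₁.2 ⟨_, _, _, by tauto⟩) (by push_cast; ring) (by push_cast; ring)
      (by push_cast; ring)
  · right
    obtain ⟨g, hg⟩ := exists_rotation₄ (-b) (a + b + 1) 0
    exact hg.proj_eq (mem_Γ₁.2 ⟨_, _, _, by tauto⟩) (by push_cast; ring) (by push_cast; ring)
      (by push_cast; ring)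

/-- Modulo the lattice these points are multiples of (1/3, 1/3); the half-turn about a vertical axis
exchanges the two nonzero classes. -/
theorem proj_Γ₁_third (a b : ℤ) (u : ℝ) :
    proj Γ₁ (pt (a / 3) (a / 3 + b) u) = proj Γ₁ (pt 0 0 u) ∨
      proj Γ₁ (pt (a / 3) (a / 3 + b) u) = proj Γ₁ (pt (1 / 3) (1 / 3) u) := by
  obtain ⟨k, rfl | rfl | rfl⟩ : ∃ k, a = 3 * k ∨ a = 3 * k + 1 ∨ a = 3 * k + 2 :=
    ⟨a / 3, by omega⟩
  · left
    rw [← proj_Γ₁_int k (k + b)]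
    push_cast
    congr 2 <;> ring
  · right
    obtain ⟨g, hg⟩ := exists_translation (-k) (-k - b) 0
    exact hg.proj_eq (mem_Γ₁.2 ⟨_, _, _, by tauto⟩) (by push_cast; ring) (by push_cast; ring)
      (by push_cast; ring)
  · right
    obtain ⟨g, hg⟩ := exists_rotation₃ (k + 1) (k + b + 1) 0
    exact hg.proj_eq (mem_Γ₁.2 ⟨_, _, _, by tauto⟩) (by push_cast; ring) (by push_cast; ring)
      (by push_cast; ring)

/-- The orbits of `Γ₁`, according to their isotropy. -/
theorem classification_Γ₁ (x : Orbifold Γ₁) : (∃ u, x = proj Γ₁ (pt 0 0 u)) ∨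
    (∃ u, x = proj Γ₁ (pt (1 / 2) 0 u)) ∨ (∃ u, x = proj Γ₁ (pt (1 / 3) (1 / 3) u)) ∨
      HasIsotropy Γ₁ x Unit := by
  obtain ⟨x, rfl⟩ := exists_proj_eq x
  by_cases htriv : ∀ g ∈ Γ₁, g x = x → g = 1
  · exact Or.inr (Or.inr (Or.inr (hasIsotropy_unit htriv)))
  push Not at htriv
  obtain ⟨g, hg, hx, h1⟩ := htriv
  obtain ⟨s, t, u, rfl⟩ := exists_pt x
  have third : ∀ a b : ℤ, s = a / 3 → t = a / 3 + b → (∃ u', proj Γ₁ (pt s t u) =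
      proj Γ₁ (pt 0 0 u')) ∨ (∃ u', proj Γ₁ (pt s t u) = proj Γ₁ (pt (1 / 2) 0 u')) ∨
      (∃ u', proj Γ₁ (pt s t u) = proj Γ₁ (pt (1 / 3) (1 / 3) u')) ∨
      HasIsotropy Γ₁ (proj Γ₁ (pt s t u)) Unit := by
    rintro a b rfl rfl
    rcases proj_Γ₁_third a b u with h | h
    · exact Or.inl ⟨u, h⟩
    · exact Or.inr (Or.inr (Or.inl ⟨u, h⟩))
  -- On the plane 1 - A has determinant 1, 3, 4, 3, 1 for the five nontrivial powers A of `H`. Fixed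
  -- points are lattice points for order six, of the form (a/3, a/3 + b) for order three, and half
  -- lattice points for order two.
  obtain ⟨a, b, c, h | h | h | h | h | h⟩ := isForm₁_of_mem hg
  · exact absurd (h.eq_one_of_fixed hx) h1
  all_goals
    rw [h, pt_inj] at hx
    push_cast at hx
    obtain ⟨h1, h2, h3⟩ := hx
  · left
    refine ⟨u, ?_⟩
    rw [← proj_Γ₁_int (-b) (a + b)]
    push_cast
    congr 2 <;> linarith
  · exact third (a - b) b (by push_cast; linarith) (by push_cast; linarith)
  · obtain rfl : s = a / 2 := by linarith
    obtain rfl : t = b / 2 := by linarith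
    rcases proj_Γ₁_half a b u with h | h
    · exact Or.inl ⟨u, h⟩
    · exact Or.inr (Or.inl ⟨u, h⟩)
  · exact third (2 * a + b) (-a) (by push_cast; linarith) (by push_cast; linarith)
  · left
    refine ⟨u, ?_⟩
    rw [← proj_Γ₁_int (a + b) (-a)]
    push_cast
    congr 2 <;> linarith

theorem isotropyOrder_Γ₁_le (x : Orbifold Γ₁) : isotropyOrder Γ₁ x ≤ 6 := by
  obtain ⟨u, rfl⟩ | ⟨u, rfl⟩ | ⟨u, rfl⟩ | h := classification_Γ₁ x
  · rw [(hasIsotropy_Γ₁_axis₆ u).isotropyOrder_eq]; simp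
  · rw [(hasIsotropy_Γ₁_axis₂ u).isotropyOrder_eq]; simp
  · rw [(hasIsotropy_Γ₁_axis₃ u).isotropyOrder_eq]; simp
  · rw [h.isotropyOrder_eq]; simp

theorem mem_maximalIsotropySet_Γ₁ (x : Orbifold Γ₁) :
    x ∈ maximalIsotropySet Γ₁ ↔ isotropyOrder Γ₁ x = 6 := by
  rw [mem_maximalIsotropySet]
  constructor
  · intro h
    have h1 := h (proj Γ₁ (pt 0 0 0))
    rw [(hasIsotropy_Γ₁_axis₆ 0).isotropyOrder_eq] at h1
    have := isotropyOrder_Γ₁_le x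
    simp at h1
    omega
  · intro h b
    rw [h]
    exact isotropyOrder_Γ₁_le b

theorem maximalIsotropySet_Γ₁ :
    maximalIsotropySet Γ₁ = Set.range fun u : ℝ => proj Γ₁ (pt 0 0 u) := by
  ext x
  rw [mem_maximalIsotropySet_Γ₁]
  constructor
  · intro hx
    obtain ⟨u, rfl⟩ | ⟨u, rfl⟩ | ⟨u, rfl⟩ | h := classification_Γ₁ x
    · exact ⟨u, rfl⟩
    · rw [(hasIsotropy_Γ₁_axis₂ u).isotropyOrder_eq] at hx; simp at hx
    · rw [(hasIsotropy_Γ₁_axis₃ u).isotropyOrder_eq] at hx; simp at hx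
    · simp [h.isotropyOrder_eq] at hx
  · rintro ⟨u, rfl⟩
    simp [(hasIsotropy_Γ₁_axis₆ u).isotropyOrder_eq]

theorem isotropy_two_Γ₁ : {x | HasIsotropy Γ₁ x (Multiplicative (ZMod 2))} =
    Set.range fun u : ℝ => proj Γ₁ (pt (1 / 2) 0 u) := by
  ext x
  constructor
  · intro hx
    replace hx := HasIsotropy.isotropyOrder_eq hx
    obtain ⟨u, rfl⟩ | ⟨u, rfl⟩ | ⟨u, rfl⟩ | h := classification_Γ₁ x
    · rw [(hasIsotropy_Γ₁_axis₆ u).isotropyOrder_eq] at hx; simp at hx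
    · exact ⟨u, rfl⟩
    · rw [(hasIsotropy_Γ₁_axis₃ u).isotropyOrder_eq] at hx; simp at hx
    · simp [h.isotropyOrder_eq] at hx
  · rintro ⟨u, rfl⟩
    exact hasIsotropy_Γ₁_axis₂ u

theorem isotropy_three_Γ₁ : {x | HasIsotropy Γ₁ x (Multiplicative (ZMod 3))} =
    Set.range fun u : ℝ => proj Γ₁ (pt (1 / 3) (1 / 3) u) := by
  ext x
  constructor
  · intro hx
    replace hx := HasIsotropy.isotropyOrder_eq hx
    obtain ⟨u, rfl⟩ | ⟨u, rfl⟩ | ⟨u, rfl⟩ | h := classification_Γ₁ x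
    · rw [(hasIsotropy_Γ₁_axis₆ u).isotropyOrder_eq] at hx; simp at hx
    · rw [(hasIsotropy_Γ₁_axis₂ u).isotropyOrder_eq] at hx; simp at hx
    · exact ⟨u, rfl⟩
    · simp [h.isotropyOrder_eq] at hx
  · rintro ⟨u, rfl⟩
    exact hasIsotropy_Γ₁_axis₃ u

theorem isotropy_not_maximal_Γ₁ {x : Orbifold Γ₁} (hx : x ∉ maximalIsotropySet Γ₁) :
    HasIsotropy Γ₁ x Unit ∨ HasIsotropy Γ₁ x (Multiplicative (ZMod 2)) ∨
      HasIsotropy Γ₁ x (Multiplicative (ZMod 3)) := by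
  obtain ⟨u, rfl⟩ | ⟨u, rfl⟩ | ⟨u, rfl⟩ | h := classification_Γ₁ x
  · rw [maximalIsotropySet_Γ₁] at hx
    exact absurd ⟨u, rfl⟩ hx
  · exact Or.inr (Or.inl (hasIsotropy_Γ₁_axis₂ u))
  · exact Or.inr (Or.inr (hasIsotropy_Γ₁_axis₃ u))
  · exact Or.inl h

/-! ### Isotropy groups of the second orbifold -/

theorem orderOf_isoH_sq : orderOf (isoH ^ 2) = 3 :=
  orderOf_eq_three
    (by simpa [← pow_mul, ← pow_add] using acts_isoH_pow_three.mul acts_isoH_pow_three)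
    acts_isoH_sq

theorem no_half {c : ℤ} {x : ℝ} (h0 : 0 < x) (h1 : x < 1) : (c : ℝ) ≠ x := by
  rintro rfl
  norm_cast at h0 h1
  omega

/-- A height reversing element sends u to c - u with c integral. It fixes no point here because 0 <
2u < 1. -/
theorem hasIsotropy_Γ₂_axis₃ {u : ℝ} (h0 : 0 < u) (h1 : u < 1 / 2) :
    HasIsotropy Γ₂ (proj Γ₂ (pt 0 0 u)) (Multiplicative (ZMod 3)) := by
  refine hasIsotropy_zmod (g := isoH ^ 2) (le_antisymm ?_ ?_) orderOf_isoH_sq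
  · rintro g ⟨hg, hx⟩
    obtain ⟨a, b, c, h⟩ := isForm₂_of_mem hg
    rcases h with h | h | h | h | h | h
    · rw [h.eq_one_of_fixed hx]; exact one_mem _
    all_goals
      rw [h, pt_inj] at hx
      push_cast at hx
      obtain ⟨h2, h3, h4⟩ := hx
      have ha : (a : ℝ) = 0 := by linarith
      have hb : (b : ℝ) = 0 := by linarith
      norm_cast at ha hb
      subst ha hb
    · have hc : (c : ℝ) = 0 := by linarith
      norm_cast at hc
      subst hc
      rw [h.ext acts_isoH_sq]; exact Subgroup.mem_zpowers _
    · have hc : (c : ℝ) = 0 := by linarith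
      norm_cast at hc
      subst hc
      rw [h.ext acts_isoH_pow_four, show isoH ^ 4 = (isoH ^ 2) ^ 2 from pow_mul isoH 2 2]
      exact Subgroup.npow_mem_zpowers _ _
    · exact absurd (show (c : ℝ) = 2 * u by linarith) (no_half (by linarith) (by linarith))
    · exact absurd (show (c : ℝ) = 2 * u by linarith) (no_half (by linarith) (by linarith))
    · exact absurd (show (c : ℝ) = 2 * u by linarith) (no_half (by linarith) (by linarith))
  · rw [Subgroup.zpowers_le]
    refine ⟨isoH_sq_mem, ?_⟩
    rw [acts_isoH_sq, pt_inj]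
    simp

/-- No height condition is needed: the horizontal half-turns never fix (1/3, 1/3) modulo the
lattice. -/
theorem hasIsotropy_Γ₂_axis₃' (u : ℝ) :
    HasIsotropy Γ₂ (proj Γ₂ (pt (1 / 3) (1 / 3) u)) (Multiplicative (ZMod 3)) := by
  refine hasIsotropy_zmod (g := rot₃) (le_antisymm ?_ ?_) orderOf_rot₃
  · rintro g ⟨hg, hx⟩
    obtain ⟨a, b, c, h | h | h | h | h | h⟩ := isForm₂_of_mem hg
    iterate 3 exact mem_zpowers_rot₃ ⟨a, b, c, by tauto⟩ hx
    all_goals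
      rw [h, pt_inj] at hx
      push_cast at hx
      obtain ⟨h1, h2, h3⟩ := hx
    · exact absurd (show (b : ℝ) = 2 / 3 by linarith) (no_third (by simp))
    · exact absurd (show (a : ℝ) = 2 / 3 by linarith) (no_third (by simp))
    · exact absurd (show (a : ℝ) = 2 / 3 by linarith) (no_third (by simp))
  · rw [Subgroup.zpowers_le]
    exact ⟨mem_Γ₂.2 ⟨1, 0, 0, by have := acts_rot₃; tauto⟩, rot₃_fixed u⟩

/-- The half-turn about this line has vertical translation part d. Any other nontrivial element
fixing the point would force s to be an integer. -/
theorem hasIsotropy_Γ₂_axis₂ {s : ℝ} (h0 : 0 < s) (h1 : s < 1) (d : ℤ) :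
    HasIsotropy Γ₂ (proj Γ₂ (pt s 0 (d / 2))) (Multiplicative (ZMod 2)) := by
  obtain ⟨k, hk⟩ := exists_halfturn 0 0 d
  have hk1 : k ≠ 1 := fun h => by
    have := hk 0 1 0
    rw [h, AffineIsometryEquiv.coe_one, id_eq, pt_inj] at this
    norm_num at this
  have hk2 : k ^ 2 = 1 := by
    refine Acts.ext (?_ : Acts _ 1 0 0 1 1 0 0 0) acts_one
    simpa [pow_two] using hk.mul hk
  refine hasIsotropy_zmod (g := k) (le_antisymm ?_ ?_) (orderOf_eq_prime hk2 hk1)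
  · rintro g ⟨hg, hx⟩
    obtain ⟨a, b, c, h | h | h | h | h | h⟩ := isForm₂_of_mem hg
    · rw [h.eq_one_of_fixed hx]
      exact one_mem _
    all_goals
      rw [h, pt_inj] at hx
      push_cast at hx
      obtain ⟨h2, h3, h4⟩ := hx
    · exact absurd (show ((-b : ℤ) : ℝ) = s by push_cast; linarith) (no_half h0 h1)
    · exact absurd (show (a : ℝ) = s by linarith) (no_half h0 h1)
    · have ha : (a : ℝ) = 0 := by linarith
      have hb : (b : ℝ) = 0 := by linarith
      have hc : (c : ℝ) = d := by linarith
      norm_cast at ha hb hc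
      subst ha hb hc
      rw [h.ext hk]
      exact Subgroup.mem_zpowers _
    · exact absurd (show ((-b : ℤ) : ℝ) = s by push_cast; linarith) (no_half h0 h1)
    · exact absurd (show (a : ℝ) = s by linarith) (no_half h0 h1)
  · rw [Subgroup.zpowers_le]
    refine ⟨mem_Γ₂.2 ⟨0, 0, d, by tauto⟩, ?_⟩
    rw [hk, pt_inj]
    push_cast
    refine ⟨?_, ?_, ?_⟩ <;> ring

theorem hasIsotropy_Γ₂_dihedral (d : ℤ) :
    HasIsotropy Γ₂ (proj Γ₂ (pt 0 0 (d / 2))) (DihedralGroup 3) := by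
  obtain ⟨k, hk⟩ := exists_halfturn 0 0 d
  have hkk : k * k = 1 := Acts.ext (by simpa using hk.mul hk) acts_one
  have hρ : (isoH ^ 2) ^ 3 = 1 := orderOf_dvd_iff_pow_eq_one.1 (by rw [orderOf_isoH_sq])
  have hkρ : Acts (k * isoH ^ 2) 0 (-1) (-1) 0 (-1) 0 0 d := by simpa using hk.mul acts_isoH_sq
  have hkρ2 : Acts (k * isoH ^ 4) (-1) 0 1 1 (-1) 0 0 d := by simpa using hk.mul acts_isoH_pow_four
  have hρk : isoH ^ 2 * k = k * (isoH ^ 2)⁻¹ :=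
    Acts.ext (by simpa using acts_isoH_sq.mul hk) (by simpa using hk.mul acts_isoH_sq_inv)
  let φ := dihedralHom hρ hkk hρk
  have h0 : φ (.r 0) = 1 := by
    rw [dihedralHom_r]; rfl
  have h1 : φ (.r 1) = isoH ^ 2 := by
    rw [dihedralHom_r]; exact pow_one _
  have h2 : φ (.r 2) = isoH ^ 4 := by
    rw [dihedralHom_r]; exact (pow_mul isoH 2 2).symm
  have h3 : φ (.sr 0) = k := by
    rw [dihedralHom_sr]; exact mul_one _
  have h4 : φ (.sr 1) = k * isoH ^ 2 := by
    rw [dihedralHom_sr]; exact congrArg _ (pow_one _)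
  have h5 : φ (.sr 2) = k * isoH ^ 4 := by
    rw [dihedralHom_sr]; exact congrArg _ (pow_mul isoH 2 2).symm
  have hinj : Function.Injective φ := by
    rw [injective_iff_map_eq_one]
    -- The entries m and e suffice to recognise the identity: the five other elements have m
    -- different from 1 or e = -1.
    have key : ∀ {g : I 3} {m n p q e a b c : ℤ}, Acts g m n p q e a b c → g = 1 →
        m = 1 ∧ e = 1 := fun {g m n p q e a b c} hg h => by
      have e0 := hg 0 0 0
      have e1 := hg 1 0 0
      have e2 := hg 0 0 1
      rw [h, AffineIsometryEquiv.coe_one, id_eq, pt_inj] at e0 e1 e2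
      simp at e0 e1 e2
      rw [← e0.1] at e1
      rw [← e0.2.2] at e2
      simp at e1 e2
      exact ⟨by exact_mod_cast e1.1.symm, by exact_mod_cast e2.2.2.symm⟩
    rintro (i | i) hi <;> fin_cases i
    · rfl
    · have := key acts_isoH_sq (h1.symm.trans hi)
      omega
    · have := key acts_isoH_pow_four (h2.symm.trans hi)
      omega
    · have := key hk (h3.symm.trans hi)
      omega
    · have := key hkρ (h4.symm.trans hi)
      omega
    · have := key hkρ2 (h5.symm.trans hi)
      omega
  have hrange : φ.range = stabilizer Γ₂ (pt 0 0 (d / 2)) := by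
    have hmem : ∀ {g : I 3} {m n p q e : ℤ} {c : ℤ}, Acts g m n p q e 0 0 c →
        (e * (d / 2) + c : ℝ) = d / 2 → g ∈ Γ₂ → g ∈ stabilizer Γ₂ (pt 0 0 (d / 2)) :=
      fun {g m n p q e c} hg hc hgm => ⟨hgm, by rw [hg, pt_inj]; simpa using hc⟩
    have hkΓ : k ∈ Γ₂ := mem_Γ₂.2 ⟨0, 0, d, by tauto⟩
    have hρΓ : isoH ^ 4 ∈ Γ₂ := by
      have := mul_mem isoH_sq_mem isoH_sq_mem
      rwa [← pow_add] at this
    apply le_antisymm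
    · rintro _ ⟨i | i, rfl⟩ <;> fin_cases i
      · exact h0 ▸ one_mem _
      · exact h1 ▸ hmem acts_isoH_sq (by push_cast; ring) isoH_sq_mem
      · exact h2 ▸ hmem acts_isoH_pow_four (by push_cast; ring) hρΓ
      · exact h3 ▸ hmem hk (by push_cast; ring) hkΓ
      · exact h4 ▸ hmem hkρ (by push_cast; ring) (mul_mem hkΓ isoH_sq_mem)
      · exact h5 ▸ hmem hkρ2 (by push_cast; ring) (mul_mem hkΓ hρΓ)
    · rintro g ⟨hg, hx⟩
      obtain ⟨a, b, c, h⟩ := isForm₂_of_mem hg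
      -- A point of the axis has vanishing horizontal coordinates, so the horizontal translation
      -- part vanishes; the height then forces c = 0 for rotations and c = d for half-turns.
      have h0' : a = 0 ∧ b = 0 := by
        rcases h with h | h | h | h | h | h <;>
        · rw [h, pt_inj] at hx
          push_cast at hx
          obtain ⟨h1, h2, h3⟩ := hx
          have ha : (a : ℝ) = 0 := by linarith
          have hb : (b : ℝ) = 0 := by linarith
          exact ⟨by exact_mod_cast ha, by exact_mod_cast hb⟩
      obtain ⟨rfl, rfl⟩ := h0'
      rcases h with h | h | h | h | h | h
      · exact ⟨_, h0.trans (h.eq_one_of_fixed hx).symm⟩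
      all_goals
        rw [h, pt_inj] at hx
        push_cast at hx
        obtain ⟨-, -, hc⟩ := hx
      iterate 2
        have hc : (c : ℝ) = 0 := by linarith
        norm_cast at hc
        subst hc
        first
          | exact ⟨_, h1.trans (acts_isoH_sq.ext h)⟩
          | exact ⟨_, h2.trans (acts_isoH_pow_four.ext h)⟩
      iterate 3
        have hc : (c : ℝ) = d := by linarith
        norm_cast at hc
        subst hc
        first
          | exact ⟨_, h3.trans (hk.ext h)⟩
          | exact ⟨_, h4.trans (hkρ.ext h)⟩
          | exact ⟨_, h5.trans (hkρ2.ext h)⟩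
  rw [hasIsotropy_proj_iff]
  exact ⟨((MonoidHom.ofInjective hinj).trans (MulEquiv.subgroupCongr hrange)).symm⟩

theorem proj_Γ₂_int (a b c : ℤ) (s t u : ℝ) :
    proj Γ₂ (pt (s + a) (t + b) (u + c)) = proj Γ₂ (pt s t u) :=
  (acts_trans (-a) (-b) (-c)).proj_eq (mem_Γ₂.2 ⟨_, _, _, Or.inl (acts_trans _ _ _)⟩)
    (by push_cast; ring) (by push_cast; ring) (by push_cast; ring)

/-- The points of `Γ₂ \ ℝ³` with nontrivial isotropy. -/
def IsSingular₂ (x : Orbifold Γ₂) : Prop :=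
  (x = proj Γ₂ (pt 0 0 0) ∨ x = proj Γ₂ (pt 0 0 (1 / 2))) ∨
    (∃ s : ℝ, 0 < s ∧ s < 1 ∧ (x = proj Γ₂ (pt s 0 0) ∨ x = proj Γ₂ (pt s 0 (1 / 2)))) ∨
    (∃ u : ℝ, 0 < u ∧ u < 1 / 2 ∧ x = proj Γ₂ (pt 0 0 u)) ∨
    (∃ u : ℝ, x = proj Γ₂ (pt (1 / 3) (1 / 3) u))

theorem isSingular₂_axis₃ (a b : ℤ) (u : ℝ) : IsSingular₂ (proj Γ₂ (pt a b u)) := by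
  have h1 : proj Γ₂ (pt a b u) = proj Γ₂ (pt 0 0 (Int.fract u)) := by
    rw [← proj_Γ₂_int a b ⌊u⌋ 0 0 (Int.fract u), zero_add, zero_add, Int.fract_add_floor]
  rw [h1]
  have h0 := Int.fract_nonneg u
  have h2 := Int.fract_lt_one u
  rcases h0.eq_or_lt with h | h
  · rw [← h]; exact Or.inl (Or.inl rfl)
  rcases lt_trichotomy (Int.fract u) (1 / 2) with h3 | h3 | h3
  · exact Or.inr (Or.inr (Or.inl ⟨_, h, h3, rfl⟩))
  · rw [h3]; exact Or.inl (Or.inr rfl)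
  -- The half-turn at height 1/2 folds the upper half of the unit interval onto the lower one.
  · refine Or.inr (Or.inr (Or.inl ⟨1 - Int.fract u, by linarith, by linarith, ?_⟩))
    obtain ⟨g, hg⟩ := exists_halfturn 0 0 1
    exact hg.proj_eq (mem_Γ₂.2 ⟨_, _, _, by tauto⟩) (by push_cast; ring) (by push_cast; ring)
      (by push_cast; ring)

theorem isSingular₂_axis₂ (s : ℝ) (b c : ℤ) : IsSingular₂ (proj Γ₂ (pt s b (c / 2))) := by
  obtain ⟨d, hd, h1⟩ : ∃ d : ℝ, (d = 0 ∨ d = 1 / 2) ∧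
      proj Γ₂ (pt s b (c / 2)) = proj Γ₂ (pt (Int.fract s) 0 d) := by
    obtain ⟨k, rfl | rfl⟩ := Int.even_or_odd' c
    · refine ⟨0, Or.inl rfl, ?_⟩
      rw [← proj_Γ₂_int ⌊s⌋ b k (Int.fract s) 0 0, zero_add, zero_add, Int.fract_add_floor]
      push_cast
      congr 2
      ring
    · refine ⟨1 / 2, Or.inr rfl, ?_⟩
      rw [← proj_Γ₂_int ⌊s⌋ b k (Int.fract s) 0 (1 / 2), zero_add, Int.fract_add_floor]
      push_cast
      congr 2
      ring
  rw [h1]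
  have h2 := Int.fract_nonneg s
  have h3 := Int.fract_lt_one s
  rcases h2.eq_or_lt with h | h
  · rw [← h]
    rcases hd with rfl | rfl
    · exact Or.inl (Or.inl rfl)
    · exact Or.inl (Or.inr rfl)
  · rcases hd with rfl | rfl
    · exact Or.inr (Or.inl ⟨_, h, h3, Or.inl rfl⟩)
    · exact Or.inr (Or.inl ⟨_, h, h3, Or.inr rfl⟩)

/-- As for `Γ₁`, except that the classes of (1/3, 1/3) and (2/3, 2/3) are now exchanged by a
horizontal half-turn, which reverses the height. -/
theorem isSingular₂_third (a b : ℤ) (u : ℝ) :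
    IsSingular₂ (proj Γ₂ (pt (a / 3) (a / 3 + b) u)) := by
  obtain ⟨k, rfl | rfl | rfl⟩ : ∃ k, a = 3 * k ∨ a = 3 * k + 1 ∨ a = 3 * k + 2 :=
    ⟨a / 3, by omega⟩
  · convert isSingular₂_axis₃ k (k + b) u using 3 <;> push_cast <;> ring
  · refine Or.inr (Or.inr (Or.inr ⟨u, ?_⟩))
    rw [← proj_Γ₂_int k (k + b) 0 (1 / 3) (1 / 3) u]
    push_cast
    congr 2 <;> ring
  · refine Or.inr (Or.inr (Or.inr ⟨-u, ?_⟩))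
    obtain ⟨g, hg⟩ := exists_halfturn (-2 * k - b - 1) (k + b + 1) 0
    exact hg.proj_eq (mem_Γ₂.2 ⟨_, _, _, by tauto⟩) (by push_cast; ring) (by push_cast; ring)
      (by push_cast; ring)

/-- The orbits of `Γ₂`, according to their isotropy. -/
theorem classification_Γ₂ (x : Orbifold Γ₂) : IsSingular₂ x ∨ HasIsotropy Γ₂ x Unit := by
  obtain ⟨x, rfl⟩ := exists_proj_eq x
  by_cases htriv : ∀ g ∈ Γ₂, g x = x → g = 1
  · exact Or.inr (hasIsotropy_unit htriv)
  left
  push Not at htriv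
  obtain ⟨g, hg, hx, h1⟩ := htriv
  obtain ⟨s, t, u, rfl⟩ := exists_pt x
  obtain ⟨a, b, c, h | h | h | h | h | h⟩ := isForm₂_of_mem hg
  · exact absurd (h.eq_one_of_fixed hx) h1
  all_goals
    rw [h, pt_inj] at hx
    push_cast at hx
    obtain ⟨h1, h2, h3⟩ := hx
  · convert isSingular₂_third (a - b) b u using 3 <;> push_cast <;> linarith
  · convert isSingular₂_third (2 * a + b) (-a) u using 3 <;> push_cast <;> linarith
  · convert isSingular₂_axis₂ s (-a) c using 3 <;> push_cast <;> linarith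
  -- The axes of the remaining two kinds of half-turns become parallel to the first coordinate axis
  -- after a rotation by `H²`, respectively `H⁴`.
  · obtain ⟨k, hk⟩ := exists_rotation₂ 0 0 0
    rw [hk.proj_eq (s' := -s - t) (t' := (-b : ℤ)) (u' := c / 2) (mem_Γ₂.2 ⟨_, _, _, by tauto⟩)
      (by push_cast; linarith) (by push_cast; linarith) (by push_cast; linarith)]
    exact isSingular₂_axis₂ _ _ _
  · obtain ⟨k, hk⟩ := exists_rotation₄ 0 0 0
    rw [hk.proj_eq (s' := t) (t' := (-a : ℤ)) (u' := c / 2) (mem_Γ₂.2 ⟨_, _, _, by tauto⟩)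
      (by push_cast; linarith) (by push_cast; linarith) (by push_cast; linarith)]
    exact isSingular₂_axis₂ _ _ _

theorem isotropyOrder_Γ₂_zero : isotropyOrder Γ₂ (proj Γ₂ (pt 0 0 0)) = 6 := by
  have h := (hasIsotropy_Γ₂_dihedral 0).isotropyOrder_eq
  rw [DihedralGroup.nat_card] at h
  simpa using h

theorem isotropyOrder_Γ₂_half : isotropyOrder Γ₂ (proj Γ₂ (pt 0 0 (1 / 2))) = 6 := by
  have h := (hasIsotropy_Γ₂_dihedral 1).isotropyOrder_eq
  rw [DihedralGroup.nat_card] at h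
  simpa using h

theorem hasIsotropy_Γ₂_segment {s : ℝ} (h0 : 0 < s) (h1 : s < 1) :
    HasIsotropy Γ₂ (proj Γ₂ (pt s 0 0)) (Multiplicative (ZMod 2)) := by
  simpa using hasIsotropy_Γ₂_axis₂ h0 h1 0

theorem hasIsotropy_Γ₂_segment_half {s : ℝ} (h0 : 0 < s) (h1 : s < 1) :
    HasIsotropy Γ₂ (proj Γ₂ (pt s 0 (1 / 2))) (Multiplicative (ZMod 2)) := by
  simpa using hasIsotropy_Γ₂_axis₂ h0 h1 1

/-- The possible isotropy orders, with the corresponding sets of points. -/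
theorem isotropyOrder_Γ₂_cases (x : Orbifold Γ₂) :
    (isotropyOrder Γ₂ x = 6 ∧ (x = proj Γ₂ (pt 0 0 0) ∨ x = proj Γ₂ (pt 0 0 (1 / 2)))) ∨
    (isotropyOrder Γ₂ x = 2 ∧ HasIsotropy Γ₂ x (Multiplicative (ZMod 2)) ∧
      ∃ s : ℝ, 0 < s ∧ s < 1 ∧ (x = proj Γ₂ (pt s 0 0) ∨ x = proj Γ₂ (pt s 0 (1 / 2)))) ∨
    (isotropyOrder Γ₂ x = 3 ∧ HasIsotropy Γ₂ x (Multiplicative (ZMod 3)) ∧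
      ((∃ u : ℝ, 0 < u ∧ u < 1 / 2 ∧ x = proj Γ₂ (pt 0 0 u)) ∨
      (∃ u : ℝ, x = proj Γ₂ (pt (1 / 3) (1 / 3) u)))) ∨
    (isotropyOrder Γ₂ x = 1 ∧ HasIsotropy Γ₂ x Unit) := by
  have two : ∀ {y : Orbifold Γ₂}, HasIsotropy Γ₂ y (Multiplicative (ZMod 2)) →
      isotropyOrder Γ₂ y = 2 := fun h => h.isotropyOrder_eq.trans (Nat.card_zmod 2)
  have three : ∀ {y : Orbifold Γ₂}, HasIsotropy Γ₂ y (Multiplicative (ZMod 3)) →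
      isotropyOrder Γ₂ y = 3 := fun h => h.isotropyOrder_eq.trans (Nat.card_zmod 3)
  rcases classification_Γ₂ x with (h | ⟨s, h0, h1, h⟩ | ⟨u, h0, h1, rfl⟩ | ⟨u, rfl⟩) | h
  · refine Or.inl ⟨?_, h⟩
    rcases h with rfl | rfl
    · exact isotropyOrder_Γ₂_zero
    · exact isotropyOrder_Γ₂_half
  · have h2 : HasIsotropy Γ₂ x (Multiplicative (ZMod 2)) := by
      rcases h with rfl | rfl
      · exact hasIsotropy_Γ₂_segment h0 h1
      · exact hasIsotropy_Γ₂_segment_half h0 h1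
    exact Or.inr (Or.inl ⟨two h2, h2, s, h0, h1, h⟩)
  · have h3 := hasIsotropy_Γ₂_axis₃ h0 h1
    exact Or.inr (Or.inr (Or.inl ⟨three h3, h3, Or.inl ⟨u, h0, h1, rfl⟩⟩))
  · have h3 := hasIsotropy_Γ₂_axis₃' u
    exact Or.inr (Or.inr (Or.inl ⟨three h3, h3, Or.inr ⟨u, rfl⟩⟩))
  · exact Or.inr (Or.inr (Or.inr ⟨h.isotropyOrder_eq.trans (by simp), h⟩))

theorem mem_maximalIsotropySet_Γ₂ (x : Orbifold Γ₂) :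
    x ∈ maximalIsotropySet Γ₂ ↔ isotropyOrder Γ₂ x = 6 := by
  rw [mem_maximalIsotropySet]
  constructor
  · intro h
    have h1 := h (proj Γ₂ (pt 0 0 0))
    rw [isotropyOrder_Γ₂_zero] at h1
    rcases isotropyOrder_Γ₂_cases x with h | h | h | h <;> omega
  · intro h b
    rw [h]
    rcases isotropyOrder_Γ₂_cases b with h | h | h | h <;> omega

theorem maximalIsotropySet_Γ₂ :
    maximalIsotropySet Γ₂ = {proj Γ₂ (pt 0 0 0), proj Γ₂ (pt 0 0 (1 / 2))} := by
  ext x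
  rw [mem_maximalIsotropySet_Γ₂]
  constructor
  · intro h
    rcases isotropyOrder_Γ₂_cases x with h1 | h1 | h1 | h1
    · exact h1.2
    all_goals omega
  · rintro (rfl | rfl)
    · exact isotropyOrder_Γ₂_zero
    · exact isotropyOrder_Γ₂_half

theorem hasIsotropy_of_mem_maximalIsotropySet_Γ₂ {x : Orbifold Γ₂}
    (hx : x ∈ maximalIsotropySet Γ₂) : HasIsotropy Γ₂ x (DihedralGroup 3) := by
  rw [maximalIsotropySet_Γ₂] at hx
  rcases hx with rfl | rfl
  · simpa using hasIsotropy_Γ₂_dihedral 0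
  · simpa using hasIsotropy_Γ₂_dihedral 1

theorem isotropy_not_maximal_Γ₂ {x : Orbifold Γ₂} (hx : x ∉ maximalIsotropySet Γ₂) :
    HasIsotropy Γ₂ x Unit ∨ HasIsotropy Γ₂ x (Multiplicative (ZMod 2)) ∨
      HasIsotropy Γ₂ x (Multiplicative (ZMod 3)) := by
  rw [mem_maximalIsotropySet_Γ₂] at hx
  rcases isotropyOrder_Γ₂_cases x with h | h | h | h
  · exact absurd h.1 hx
  · exact Or.inr (Or.inl h.2.1)
  · exact Or.inr (Or.inr h.2.1)
  · exact Or.inl h.2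

theorem isotropy_two_Γ₂ : {x | HasIsotropy Γ₂ x (Multiplicative (ZMod 2))} =
    (fun s : ℝ => proj Γ₂ (pt s 0 0)) '' Set.Ioo 0 1 ∪
      (fun s : ℝ => proj Γ₂ (pt s 0 (1 / 2))) '' Set.Ioo 0 1 := by
  ext x
  constructor
  · intro hx
    have h2 : isotropyOrder Γ₂ x = 2 := (HasIsotropy.isotropyOrder_eq hx).trans (Nat.card_zmod 2)
    rcases isotropyOrder_Γ₂_cases x with h | ⟨-, -, s, h0, h1, rfl | rfl⟩ | h | h
    · omega
    · exact Or.inl ⟨s, ⟨h0, h1⟩, rfl⟩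
    · exact Or.inr ⟨s, ⟨h0, h1⟩, rfl⟩
    · omega
    · omega
  · rintro (⟨s, ⟨h0, h1⟩, rfl⟩ | ⟨s, ⟨h0, h1⟩, rfl⟩)
    · exact hasIsotropy_Γ₂_segment h0 h1
    · exact hasIsotropy_Γ₂_segment_half h0 h1

theorem isotropy_three_Γ₂ : {x | HasIsotropy Γ₂ x (Multiplicative (ZMod 3))} =
    (fun u : ℝ => proj Γ₂ (pt 0 0 u)) '' Set.Ioo 0 (1 / 2) ∪
      Set.range fun u : ℝ => proj Γ₂ (pt (1 / 3) (1 / 3) u) := by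
  ext x
  constructor
  · intro hx
    have h2 : isotropyOrder Γ₂ x = 3 := (HasIsotropy.isotropyOrder_eq hx).trans (Nat.card_zmod 3)
    rcases isotropyOrder_Γ₂_cases x with h | h | ⟨-, -, ⟨u, h0, h1, rfl⟩ | ⟨u, rfl⟩⟩ | h
    · omega
    · omega
    · exact Or.inl ⟨u, ⟨h0, h1⟩, rfl⟩
    · exact Or.inr ⟨u, rfl⟩
    · omega
  · rintro (⟨u, ⟨h0, h1⟩, rfl⟩ | ⟨u, rfl⟩)
    · exact hasIsotropy_Γ₂_axis₃ h0 h1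
    · exact hasIsotropy_Γ₂_axis₃' u

/-! ### The orbit distance and isometric copies of segments and circles -/

section OrbitDist

variable {V : Type*} [NormedAddCommGroup V] [InnerProductSpace ℝ V]
variable {Γ : Subgroup (V ≃ᵃⁱ[ℝ] V)}

theorem orbitDist_le_dist (x y : V) : orbitDist Γ (proj Γ x) (proj Γ y) ≤ dist x y :=
  csInf_le ⟨0, by rintro _ ⟨_, _, _, _, rfl⟩; exact dist_nonneg⟩ ⟨x, y, rfl, rfl, rfl⟩

theorem le_orbitDist {x y : V} {r : ℝ} (h : ∀ g ∈ Γ, r ≤ dist (g x) y) :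
    r ≤ orbitDist Γ (proj Γ x) (proj Γ y) := by
  refine le_csInf ⟨_, x, y, rfl, rfl, rfl⟩ ?_
  rintro _ ⟨x', y', hx, hy, rfl⟩
  obtain ⟨g, hg, rfl⟩ := proj_eq_iff.1 hx
  obtain ⟨k, hk, rfl⟩ := proj_eq_iff.1 hy
  -- One group element applied to both points leaves their distance unchanged, so the second
  -- representative may be moved to y.
  have h1 := h _ (mul_mem hk (inv_mem hg))
  have h2 : g⁻¹ (g x') = x' := g.symm_apply_apply x'
  rwa [AffineIsometryEquiv.coe_mul, Function.comp_apply, h2, k.dist_map] at h1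

theorem orbitDist_lt_iff {x y : V} {r : ℝ} :
    orbitDist Γ (proj Γ x) (proj Γ y) < r ↔ ∃ g ∈ Γ, dist (g x) y < r := by
  constructor
  · intro h
    by_contra! h1
    exact absurd (le_orbitDist h1) (not_le.2 h)
  · rintro ⟨g, hg, h⟩
    rw [← proj_apply_eq hg]
    exact (orbitDist_le_dist _ _).trans_lt h

theorem orbitDist_nonneg (a b : Orbifold Γ) : 0 ≤ orbitDist Γ a b := by
  refine Real.sInf_nonneg ?_
  rintro _ ⟨_, _, _, _, rfl⟩
  exact dist_nonneg

theorem orbitDist_self (a : Orbifold Γ) : orbitDist Γ a a = 0 := by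
  obtain ⟨x, rfl⟩ := exists_proj_eq a
  exact le_antisymm (by simpa using orbitDist_le_dist (Γ := Γ) x x) (orbitDist_nonneg _ _)

/-- The preimage of a ball for the orbit distance is the union of the balls around the points of the
orbit, so the orbit distance induces the quotient topology. Discreteness of the group plays no role.
-/
theorem nhds_basis_orbitDist (a : Orbifold Γ) :
    (nhds a).HasBasis (fun ε : ℝ => 0 < ε) fun ε => {b | orbitDist Γ a b < ε} := by
  obtain ⟨x, rfl⟩ := exists_proj_eq a
  refine ⟨fun U => ⟨fun hU => ?_, ?_⟩⟩
  · have h1 : proj Γ ⁻¹' U ∈ nhds x := (continuous_proj Γ).continuousAt hU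
    obtain ⟨ε, hε, h2⟩ := Metric.mem_nhds_iff.1 h1
    refine ⟨ε, hε, fun b hb => ?_⟩
    obtain ⟨y, rfl⟩ := exists_proj_eq b
    obtain ⟨g, hg, h3⟩ := orbitDist_lt_iff.1 hb
    have h4 : g⁻¹ y ∈ Metric.ball x ε := by
      rw [Metric.mem_ball, ← g.dist_map, dist_comm]
      convert h3 using 2
      exact g.apply_symm_apply y
    have h5 := h2 h4
    rwa [Set.mem_preimage, proj_apply_eq (inv_mem hg)] at h5
  · rintro ⟨ε, hε, h⟩
    refine Filter.mem_of_superset (IsOpen.mem_nhds ?_ ?_) h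
    · refine isOpen_coinduced.2 ?_
      have h1 : proj Γ ⁻¹' {b | orbitDist Γ (proj Γ x) b < ε} =
          ⋃ g ∈ Γ, Metric.ball (g x) ε := by
        ext y
        simp only [Set.mem_preimage, Set.mem_iUnion, Metric.mem_ball, exists_prop]
        refine (orbitDist_lt_iff (Γ := Γ) (x := x) (y := y)).trans ?_
        simp only [dist_comm]
      change IsOpen (proj Γ ⁻¹' {b | orbitDist Γ (proj Γ x) b < ε})
      rw [h1]
      exact isOpen_biUnion fun _ _ => Metric.isOpen_ball
    · simpa [orbitDist_self] using hε

/-- A criterion for the image of a map to be an isometric copy of its domain. -/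
theorem isLocallyIsometricCopy {Y : Type} [MetricSpace Y] {f : Y → Orbifold Γ} {δ : Y → ℝ}
    (hδ : Continuous δ) (hpos : ∀ y, 0 < δ y)
    (hle : ∀ p q, orbitDist Γ (f p) (f q) ≤ dist p q)
    (hge : ∀ p q, orbitDist Γ (f p) (f q) < δ p → dist p q ≤ orbitDist Γ (f p) (f q)) :
    IsLocallyIsometricCopy Γ Y (Set.range f) := by
  refine ⟨f, ⟨Topology.isInducing_iff_nhds.2 ?_, ?_⟩, fun y => ?_, rfl⟩
  · intro y
    refine Metric.nhds_basis_ball.ext ((nhds_basis_orbitDist (f y)).comap f) (fun ε hε => ?_)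
      fun ε hε => ⟨ε, hε, fun q hq => ?_⟩
    · refine ⟨min ε (δ y), lt_min hε (hpos y), fun q hq => ?_⟩
      have h1 : orbitDist Γ (f y) (f q) < min ε (δ y) := hq
      rw [Metric.mem_ball, dist_comm]
      exact (hge y q (h1.trans_le (min_le_right _ _))).trans_lt (h1.trans_le (min_le_left _ _))
    · rw [Metric.mem_ball, dist_comm] at hq
      exact (hle y q).trans_lt hq
  · intro p q hpq
    have h1 : orbitDist Γ (f p) (f q) = 0 := by rw [hpq, orbitDist_self]
    have h2 := hge p q (h1 ▸ hpos p)
    rw [h1] at h2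
    exact dist_le_zero.1 h2
  -- Near y the radius stays above δ(y)/2, and two points within δ(y)/4 of y are less than δ(y)/2
  -- apart.
  · have h1 : {q | δ y / 2 < δ q} ∈ nhds y :=
      hδ.continuousAt.eventually_const_lt (half_lt_self (hpos y))
    refine ⟨_, Filter.inter_mem h1 (Metric.ball_mem_nhds y (by linarith [hpos y] : 0 < δ y / 4)),
      fun p hp q hq => le_antisymm (hle p q) (hge p q ?_)⟩
    refine (hle p q).trans_lt ?_
    have h2 := dist_triangle_right p q y
    have h3 : dist p y < δ y / 4 := hp.2
    have h4 : dist q y < δ y / 4 := hq.2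
    have h5 : δ y / 2 < δ p := hp.1
    linarith

/-- A criterion for a curve to project to an isometric copy of its parameter space. -/
theorem isLocallyIsometricCopy_of_curve {Y : Type} [MetricSpace Y] {γ : Y → V} {δ : Y → ℝ}
    (hδ : Continuous δ) (hpos : ∀ y, 0 < δ y) (hγ : ∀ p q, dist (γ p) (γ q) = dist p q)
    (hge : ∀ p q, ∀ g ∈ Γ, δ p ≤ dist (g (γ p)) (γ q) ∨ dist p q ≤ dist (g (γ p)) (γ q)) :
    IsLocallyIsometricCopy Γ Y (Set.range fun y => proj Γ (γ y)) := by
  refine isLocallyIsometricCopy hδ hpos (fun p q => ?_) fun p q h => ?_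
  · rw [← hγ]
    exact orbitDist_le_dist _ _
  · by_contra! h1
    obtain ⟨g, hg, h2⟩ := orbitDist_lt_iff.1 (lt_min h h1)
    rcases hge p q g hg with h3 | h3
    · exact absurd (h2.trans_le (min_le_left _ _)) (not_lt.2 h3)
    · exact absurd (h2.trans_le (min_le_right _ _)) (not_lt.2 h3)

end OrbitDist

/-! ### Circles and segments in the two quotients -/

theorem dist_vertical (s t u u' : ℝ) : dist (pt s t u) (pt s t u') = |u - u'| := by
  rw [← sq_eq_sq₀ dist_nonneg (abs_nonneg _), dist_pt_sq, sq_abs]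
  ring

theorem abs_height_le_dist (s t u s' t' u' : ℝ) : |u - u'| ≤ dist (pt s t u) (pt s' t' u') := by
  rw [← sq_le_sq₀ (abs_nonneg _) dist_nonneg, dist_pt_sq, sq_abs]
  nlinarith [sq_nonneg (2 * (s - s') + (t - t')), sq_nonneg (t - t')]

/-- From 4(x² + xy + y²) = 3x² + (x + 2y)². The constant √3 is the distance of neighbouring lattice
lines. -/
theorem abs_coord_le_dist (s t u s' t' u' : ℝ) :
    √3 * |s - s'| ≤ dist (pt s t u) (pt s' t' u') ∧
      √3 * |t - t'| ≤ dist (pt s t u) (pt s' t' u') := by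
  have h3 : √3 ^ 2 = 3 := Real.sq_sqrt (by norm_num)
  constructor <;>
  · rw [← sq_le_sq₀ (by positivity) dist_nonneg, dist_pt_sq, mul_pow, sq_abs, h3]
    nlinarith [sq_nonneg (2 * (s - s') + (t - t')), sq_nonneg ((s - s') + 2 * (t - t')),
      sq_nonneg (u - u')]

theorem norm_addCircle_le (x : ℝ) (n : ℤ) : ‖(x : AddCircle (1 : ℝ))‖ ≤ |x + n| := by
  rw [AddCircle.norm_eq]
  simpa using round_le x (-n)

/-- The unit vertical translation closes up the line. The hypothesis says that no group element
brings two of its points closer together than they are on the circle. -/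
theorem isCircleOfLength_vertical {Γ : Subgroup (I 3)} (hΓ : translationGroup hexLattice ≤ Γ)
    {s t : ℝ} (h : ∀ g ∈ Γ, ∀ u u' : ℝ,
      ‖((u - u' : ℝ) : AddCircle (1 : ℝ))‖ ≤ dist (g (pt s t u)) (pt s t u')) :
    IsCircleOfLength Γ 1 (Set.range fun u : ℝ => proj Γ (pt s t u)) := by
  have hper : ∀ (n : ℤ) (u : ℝ), proj Γ (pt s t (u + n)) = proj Γ (pt s t u) := fun n u =>
    ((acts_trans 0 0 n).proj_eq (hΓ (trans_mem (mem_hexLattice.2 ⟨0, 0, n, rfl⟩)))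
      (by push_cast; ring) (by push_cast; ring) (by push_cast; ring)).symm
  have hper1 : Function.Periodic (fun u : ℝ => proj Γ (pt s t u)) 1 := fun u => by
    simpa using hper 1 u
  have hrange : Set.range hper1.lift = Set.range fun u : ℝ => proj Γ (pt s t u) := by
    ext x
    constructor
    · rintro ⟨y, rfl⟩
      obtain ⟨u, rfl⟩ := QuotientAddGroup.mk_surjective y
      exact ⟨u, rfl⟩
    · rintro ⟨u, rfl⟩
      exact ⟨(u : AddCircle (1 : ℝ)), rfl⟩
  rw [← hrange]
  have hdist : ∀ u u' : ℝ, dist (u : AddCircle (1 : ℝ)) (u' : AddCircle (1 : ℝ)) =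
      ‖((u - u' : ℝ) : AddCircle (1 : ℝ))‖ := fun u u' => by
    rw [dist_eq_norm, AddCircle.coe_sub]
  -- The comparison of distances holds globally, so any positive radius would do.
  refine isLocallyIsometricCopy (δ := fun _ => 1) continuous_const (fun _ => one_pos) ?_ ?_
  · intro p q
    obtain ⟨u, rfl⟩ := QuotientAddGroup.mk_surjective p
    obtain ⟨u', rfl⟩ := QuotientAddGroup.mk_surjective q
    change orbitDist Γ (proj Γ (pt s t u)) (proj Γ (pt s t u')) ≤
      dist (u : AddCircle (1 : ℝ)) (u' : AddCircle (1 : ℝ))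
    rw [hdist, AddCircle.norm_eq, ← hper (round (u - u')) u']
    refine (orbitDist_le_dist _ _).trans ?_
    rw [dist_vertical]
    simp [sub_sub]
  · intro p q _
    obtain ⟨u, rfl⟩ := QuotientAddGroup.mk_surjective p
    obtain ⟨u', rfl⟩ := QuotientAddGroup.mk_surjective q
    change dist (u : AddCircle (1 : ℝ)) (u' : AddCircle (1 : ℝ)) ≤
      orbitDist Γ (proj Γ (pt s t u)) (proj Γ (pt s t u'))
    rw [hdist]
    exact le_orbitDist fun g hg => h g hg u u'

theorem norm_addCircle_le_dist {s t s' t' u u' w : ℝ} (c : ℤ) (hw : w = u + c) :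
    ‖((u - u' : ℝ) : AddCircle (1 : ℝ))‖ ≤ dist (pt s t w) (pt s' t' u') := by
  refine (norm_addCircle_le _ c).trans ?_
  rw [show u - u' + c = w - u' by rw [hw]; ring]
  exact abs_height_le_dist _ _ _ _ _ _

/-- Every element of `Γ₁` changes heights by an integer, and the distance in space is at least the
difference of heights. -/
theorem isCircleOfLength_Γ₁ (s t : ℝ) :
    IsCircleOfLength Γ₁ 1 (Set.range fun u : ℝ => proj Γ₁ (pt s t u)) := by
  refine isCircleOfLength_vertical translationGroup_le_Γ₁ fun g hg u u' => ?_
  obtain ⟨a, b, c, h | h | h | h | h | h⟩ := isForm₁_of_mem hg <;>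
  · rw [h]
    exact norm_addCircle_le_dist c (by push_cast; ring)

theorem isCircleOfLength_Γ₂ :
    IsCircleOfLength Γ₂ 1 (Set.range fun u : ℝ => proj Γ₂ (pt (1 / 3) (1 / 3) u)) := by
  refine isCircleOfLength_vertical translationGroup_le_Γ₂ fun g hg u u' => ?_
  -- A height reversing element moves the axis sideways: its first lattice coordinate changes by at
  -- least 1/3. That is a distance of at least √3/3 > 1/2, and 1/2 bounds all distances on the
  -- circle.
  have far : ∀ {s t w : ℝ} {m : ℤ}, s - 1 / 3 = (3 * m + 1) / 3 →
      ‖((u - u' : ℝ) : AddCircle (1 : ℝ))‖ ≤ dist (pt s t w) (pt (1 / 3) (1 / 3) u') := by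
    intro s t w m hm
    refine (AddCircle.norm_le_half_period 1 one_ne_zero).trans ?_
    refine le_trans ?_ (abs_coord_le_dist _ _ _ _ _ _).1
    have h1 : (1 : ℝ) ≤ |((3 * m + 1 : ℤ) : ℝ)| := by
      have : (1 : ℤ) ≤ |3 * m + 1| := Int.one_le_abs (by omega)
      exact_mod_cast this
    have h2 : (3 / 2 : ℝ) ≤ √3 := Real.le_sqrt_of_sq_le (by norm_num)
    rw [hm, abs_div]
    push_cast at h1
    simp only [abs_one, Nat.abs_ofNat]
    nlinarith
  obtain ⟨a, b, c, h | h | h | h | h | h⟩ := isForm₂_of_mem hg <;> rw [h]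
  iterate 3 exact norm_addCircle_le_dist c (by push_cast; ring)
  · exact far (m := a) (by push_cast; ring)
  · exact far (m := a - 1) (by push_cast; ring)
  · exact far (m := a - 1) (by push_cast; ring)

theorem min_le_abs_add_int (s : ℝ) (b : ℤ) :
    min s (1 - s) ≤ |s + b| := by
  rcases le_or_gt 0 b with hb | hb
  · have hb : (0 : ℝ) ≤ b := by exact_mod_cast hb
    exact (min_le_left _ _).trans (le_trans (by linarith) (le_abs_self _))
  · have hb : (b : ℝ) ≤ -1 := by exact_mod_cast (by omega : b ≤ -1)
    exact (min_le_right _ _).trans (le_trans (by linarith) (neg_le_abs _))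

/-- Covers elements whose linear part preserves the direction of the segment. Either the horizontal
shift is trivial and distances along the segment persist, or the image of the point is at least as
far away as the nearer end of the segment, measured by the parameter s. -/
theorem horizontal_alternative {s s' : ℝ} (h1 : s < 1) (h0' : 0 < s') (h1' : s' < 1)
    (a b : ℤ) (w u : ℝ) : min s (1 - s) ≤ dist (pt (s + a) b w) (pt s' 0 u) ∨
      2 * |s - s'| ≤ dist (pt (s + a) b w) (pt s' 0 u) := by
  have h3 : (1 : ℝ) ≤ √3 := Real.le_sqrt_of_sq_le (by norm_num)
  have hmin : min s (1 - s) ≤ 1 := (min_le_left _ _).trans h1.le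
  obtain ⟨k1, k2⟩ := abs_coord_le_dist (s + a) b w s' 0 u
  by_cases hb : b = 0
  · by_cases ha : a = 0
    · right
      subst ha hb
      rw [← sq_le_sq₀ (by positivity) dist_nonneg, dist_pt_sq, mul_pow, sq_abs]
      push_cast
      nlinarith [sq_nonneg (w - u)]
    · left
      have h4 : min s (1 - s) ≤ |s + a - s'| := by
        rcases lt_or_gt_of_ne ha with ha | ha
        · have ha : (a : ℝ) ≤ -1 := by exact_mod_cast (by omega : a ≤ -1)
          exact (min_le_right _ _).trans (le_trans (by linarith) (neg_le_abs _))
        · have ha : (1 : ℝ) ≤ a := by exact_mod_cast (by omega : 1 ≤ a)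
          exact (min_le_left _ _).trans (le_trans (by linarith) (le_abs_self _))
      nlinarith [abs_nonneg (s + a - s')]
  · left
    have h4 : (1 : ℝ) ≤ |(b : ℝ) - 0| := by
      rw [sub_zero]
      exact_mod_cast Int.one_le_abs hb
    nlinarith

/-- Covers elements which turn the segment. The image of the point is then off the line t = 0 by the
distance of s from an integer. -/
theorem oblique_alternative {s : ℝ} (h0 : 0 < s) (h1 : s < 1) (b : ℤ) {x t w s' u : ℝ}
    (ht : t = s + b ∨ t = -s + b) : min s (1 - s) ≤ dist (pt x t w) (pt s' 0 u) := by
  have h3 : (1 : ℝ) ≤ √3 := Real.le_sqrt_of_sq_le (by norm_num)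
  have k2 := (abs_coord_le_dist x t w s' 0 u).2
  have h4 : min s (1 - s) ≤ |t - 0| := by
    rw [sub_zero]
    rcases ht with rfl | rfl
    · exact min_le_abs_add_int s b
    · rw [← abs_neg]
      simpa [add_comm] using min_le_abs_add_int s (-b)
  nlinarith [abs_nonneg (t - 0)]

theorem isOpenSegmentOfLength_horizontal (u : ℝ) : IsOpenSegmentOfLength Γ₂ 2
    ((fun s : ℝ => proj Γ₂ (pt s 0 u)) '' Set.Ioo 0 1) := by
  have hrange : ((fun s : ℝ => proj Γ₂ (pt s 0 u)) '' Set.Ioo 0 1) =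
      Set.range fun y : Set.Ioo (0 : ℝ) 2 => proj Γ₂ (pt (y / 2) 0 u) := by
    ext x
    constructor
    · rintro ⟨s, ⟨h0, h1⟩, rfl⟩
      refine ⟨⟨2 * s, by linarith, by linarith⟩, ?_⟩
      simp
    · rintro ⟨⟨y, h0, h1⟩, rfl⟩
      exact ⟨y / 2, ⟨by linarith, by linarith⟩, rfl⟩
  rw [hrange]
  -- The radius has to shrink towards the ends, where the segment meets its rotated copies.
  refine isLocallyIsometricCopy_of_curve (γ := fun y : Set.Ioo (0 : ℝ) 2 => pt (y / 2) 0 u)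
    (δ := fun y => min ((y : ℝ) / 2) (1 - y / 2)) (by fun_prop) ?_ ?_ ?_
  · rintro ⟨y, h0, h1⟩
    exact lt_min (by simpa using h0) (by simp only; linarith)
  · rintro ⟨y, h0, h1⟩ ⟨z, h2, h3⟩
    rw [Subtype.dist_eq, Real.dist_eq, ← sq_eq_sq₀ dist_nonneg (abs_nonneg _), dist_pt_sq, sq_abs]
    ring
  · rintro ⟨y, h0, h1⟩ ⟨z, h2, h3⟩ g hg
    have e0 : 0 < y / 2 := by linarith
    have e1 : y / 2 < 1 := by linarith
    have hd : dist (⟨y, h0, h1⟩ : Set.Ioo (0 : ℝ) 2) ⟨z, h2, h3⟩ = 2 * |y / 2 - z / 2| := by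
      rw [Subtype.dist_eq, Real.dist_eq, ← sub_div, abs_div, abs_two]
      ring
    rw [hd]
    simp only
    obtain ⟨a, b, c, h | h | h | h | h | h⟩ := isForm₂_of_mem hg <;> rw [h] <;> push_cast
    · simpa using horizontal_alternative e1 (by linarith : 0 < z / 2) (by linarith) a b (u + c) u
    · exact Or.inl (oblique_alternative e0 e1 b (Or.inl (by ring)))
    · exact Or.inl (oblique_alternative e0 e1 b (Or.inr (by ring)))
    · simpa using
        horizontal_alternative e1 (by linarith : 0 < z / 2) (by linarith) a b (-u + c) u
    · exact Or.inl (oblique_alternative e0 e1 b (Or.inl (by ring)))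
    · exact Or.inl (oblique_alternative e0 e1 b (Or.inr (by ring)))

theorem isOpenSegmentOfLength_vertical : IsOpenSegmentOfLength Γ₂ (1 / 2)
    ((fun u : ℝ => proj Γ₂ (pt 0 0 u)) '' Set.Ioo 0 (1 / 2)) := by
  rw [Set.image_eq_range]
  refine isLocallyIsometricCopy_of_curve (γ := fun y : Set.Ioo (0 : ℝ) (1 / 2) => pt 0 0 y)
    (δ := fun _ => 1) continuous_const (fun _ => one_pos) (fun p q => dist_vertical _ _ _ _) ?_
  rintro ⟨y, h0, h1⟩ ⟨z, h2, h3⟩ g hg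
  right
  rw [Subtype.dist_eq, Real.dist_eq]
  simp only
  -- The interval (0, 1/2) lies in a fundamental domain of the maps u ↦ ±u + c on the line, so the
  -- identity realises the smallest distance.
  have key : ∀ c : ℤ, |y - z| ≤ |y + c - z| ∧ |y - z| ≤ |-y + c - z| := by
    intro c
    have hc : c ≤ -1 ∨ c = 0 ∨ c = 1 ∨ 2 ≤ c := by omega
    rcases hc with hc | rfl | rfl | hc
    · have hc : (c : ℝ) ≤ -1 := by exact_mod_cast hc
      rw [abs_le, abs_of_neg (by linarith : y + c - z < 0),
        abs_of_neg (by linarith : -y + c - z < 0), abs_le]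
      refine ⟨⟨?_, ?_⟩, ?_, ?_⟩ <;> linarith
    · rw [abs_le, abs_of_neg (by push_cast; linarith : -y + ((0 : ℤ) : ℝ) - z < 0), abs_le]
      simp only [Int.cast_zero, add_zero]
      refine ⟨⟨neg_abs_le _, le_abs_self _⟩, ?_, ?_⟩ <;> linarith
    · rw [abs_le, abs_of_pos (by push_cast; linarith : 0 < y + ((1 : ℤ) : ℝ) - z),
        abs_of_pos (by push_cast; linarith : 0 < -y + ((1 : ℤ) : ℝ) - z), abs_le]
      push_cast
      refine ⟨⟨?_, ?_⟩, ?_, ?_⟩ <;> linarith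
    · have hc : (2 : ℝ) ≤ c := by exact_mod_cast hc
      rw [abs_le, abs_of_pos (by linarith : 0 < y + c - z),
        abs_of_pos (by linarith : 0 < -y + c - z), abs_le]
      refine ⟨⟨?_, ?_⟩, ?_, ?_⟩ <;> linarith
  obtain ⟨a, b, c, h | h | h | h | h | h⟩ := isForm₂_of_mem hg <;> rw [h] <;>
    refine le_trans ?_ (abs_height_le_dist _ _ _ _ _ _) <;> push_cast <;>
    first
    | simpa only [one_mul] using (key c).1
    | simpa only [neg_mul, one_mul] using (key c).2

/-- Heights change by u ↦ ±u + c, which never takes 0 to 1/2. -/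
theorem proj_Γ₂_height_ne (s t s' t' : ℝ) : proj Γ₂ (pt s t 0) ≠ proj Γ₂ (pt s' t' (1 / 2)) := by
  rw [Ne, proj_eq_iff]
  rintro ⟨g, hg, hx⟩
  obtain ⟨a, b, c, h | h | h | h | h | h⟩ := isForm₂_of_mem hg <;>
  · rw [h, pt_inj] at hx
    exact no_half (c := c) (x := 1 / 2) (by norm_num) (by norm_num) (by linarith [hx.2.2])

theorem proj_Γ₂_axis_ne (u u' : ℝ) : proj Γ₂ (pt 0 0 u) ≠ proj Γ₂ (pt (1 / 3) (1 / 3) u') := by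
  rw [Ne, proj_eq_iff]
  rintro ⟨g, hg, hx⟩
  obtain ⟨a, b, c, h | h | h | h | h | h⟩ := isForm₂_of_mem hg <;>
  · rw [h, pt_inj] at hx
    exact no_third (a := a) (x := 1 / 3) (by simp) (by linarith [hx.1])

/-! ### The planar factor of the first orbifold -/

/-- The projection of space onto the first two coordinates. -/
def planar (x : E 3) : E 2 := !₂[x 0, x 1]

theorem planar_add (x y : E 3) : planar (x + y) = planar x + planar y := by
  ext i
  fin_cases i <;> simp [planar]

theorem continuous_planar : Continuous planar := by
  unfold planar
  refine (PiLp.continuous_toLp 2 _).comp (continuous_pi fun i => ?_)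
  fin_cases i <;> simp <;> fun_prop

/-- The inclusion of the plane at height `w`. -/
def atHeight (p : E 2) (w : ℝ) : E 3 := !₂[p 0, p 1, w]

theorem planar_atHeight (p : E 2) (w : ℝ) : planar (atHeight p w) = p := by
  ext i
  fin_cases i <;> simp [planar, atHeight]

theorem atHeight_two (p : E 2) (w : ℝ) : atHeight p w 2 = w := by
  simp [atHeight]

theorem continuous_atHeight_zero : Continuous fun p => atHeight p 0 := by
  unfold atHeight
  refine (PiLp.continuous_toLp 2 _).comp (continuous_pi fun i => ?_)
  fin_cases i <;> simp <;> fun_prop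

theorem planar_ext {x y : E 3} (h : planar x = planar y) (h2 : x 2 = y 2) : x = y := by
  have h0 := congrArg (fun p : E 2 => p 0) h
  have h1 := congrArg (fun p : E 2 => p 1) h
  simp [planar] at h0 h1
  ext i
  fin_cases i
  exacts [h0, h1, h2]

theorem planar_pt (s t u u' : ℝ) : planar (pt s t u) = planar (pt s t u') := by
  ext i
  fin_cases i <;> simp [planar, pt]

/-- The isometry `h` of the plane is the planar part of the isometry `g` of space. -/
def IsPlanarPart (h : I 2) (g : I 3) : Prop := ∀ x, h (planar x) = planar (g x)

/-- Every point of the plane is the projection of a point of space, so `g` determines its planar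
part. -/
theorem IsPlanarPart.ext {h h' : I 2} {g : I 3} (H : IsPlanarPart h g) (H' : IsPlanarPart h' g) :
    h = h' := by
  ext1 p
  rw [← planar_atHeight p 0, H, H']

theorem isPlanarPart_one : IsPlanarPart 1 1 := fun _ => rfl

theorem IsPlanarPart.mul {h h' : I 2} {g g' : I 3} (H : IsPlanarPart h g)
    (H' : IsPlanarPart h' g') : IsPlanarPart (h * h') (g * g') := fun x => by
  rw [AffineIsometryEquiv.coe_mul, Function.comp_apply, H', H]
  rfl

theorem IsPlanarPart.inv {h : I 2} {g : I 3} (H : IsPlanarPart h g) : IsPlanarPart h⁻¹ g⁻¹ :=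
  fun x => by
    refine (AffineIsometryEquiv.symm_apply_eq h).2 ?_
    rw [H]
    exact congrArg planar (g.apply_symm_apply x).symm

/-- The plane group of planar parts of the elements of `Γ₁`. -/
def planeGroup : Subgroup (I 2) where
  carrier := {h | ∃ g ∈ Γ₁, IsPlanarPart h g}
  one_mem' := ⟨1, one_mem _, isPlanarPart_one⟩
  mul_mem' := by
    rintro _ _ ⟨g, hg, H⟩ ⟨g', hg', H'⟩
    exact ⟨_, mul_mem hg hg', H.mul H'⟩
  inv_mem' := by
    rintro _ ⟨g, hg, H⟩
    exact ⟨_, inv_mem hg, H.inv⟩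

/-- The rotation of the plane by `π/3`. -/
def matH₂ : Matrix (Fin 2) (Fin 2) ℝ := !![1 / 2, -(√3) / 2; √3 / 2, 1 / 2]

theorem matH₂_mem : matH₂ ∈ Matrix.orthogonalGroup (Fin 2) ℝ := by
  have h3 : √3 * √3 = (3 : ℝ) := sqrt_three_mul_self
  rw [Matrix.mem_orthogonalGroup_iff]
  ext i j
  fin_cases i <;> fin_cases j <;>
    simp [matH₂, Matrix.mul_apply, Fin.sum_univ_two] <;> nlinarith

/-- The determinant of the linear part of an isometry. -/
def linearDet {n : ℕ} (g : I n) : ℝ :=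
  LinearMap.det (g.linearIsometryEquiv.toLinearEquiv : E n →ₗ[ℝ] E n)

theorem linearDet_mul {n : ℕ} (g h : I n) : linearDet (g * h) = linearDet g * linearDet h := by
  unfold linearDet
  rw [← LinearMap.det_comp]
  rfl

theorem linearDet_one {n : ℕ} : linearDet (1 : I n) = 1 := LinearMap.det_id

theorem linearDet_matH₂ : linearDet (ofOrthogonal matH₂ matH₂_mem) = 1 := by
  have h : ((ofOrthogonal matH₂ matH₂_mem).linearIsometryEquiv.toLinearEquiv : E 2 →ₗ[ℝ] E 2) =
      Matrix.toLin (EuclideanSpace.basisFun (Fin 2) ℝ).toBasis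
        (EuclideanSpace.basisFun (Fin 2) ℝ).toBasis matH₂ := by
    rfl
  have h3 : √3 * √3 = (3 : ℝ) := sqrt_three_mul_self
  rw [linearDet, h, LinearMap.det_toLin, matH₂, Matrix.det_fin_two_of]
  linarith

theorem linearDet_translation {n : ℕ} (v : E n) :
    linearDet (AffineIsometryEquiv.constVAdd ℝ (E n) v) = 1 := LinearMap.det_id

theorem isPlanarPart_isoH : IsPlanarPart (ofOrthogonal matH₂ matH₂_mem) isoH := by
  intro x
  rw [isoH, ofOrthogonal_apply, ofOrthogonal_apply]
  ext i
  fin_cases i <;> simp [planar, matH, matH₂, Matrix.mulVec, dotProduct, Fin.sum_univ_succ]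

/-- By induction over words in the generators. The determinant is carried along because cone points
require rotations. -/
theorem exists_isPlanarPart {g : I 3} (hg : g ∈ Γ₁) :
    ∃ h ∈ planeGroup, IsPlanarPart h g ∧ linearDet h = 1 := by
  suffices H : ∃ h, IsPlanarPart h g ∧ linearDet h = 1 by
    obtain ⟨h, h1, h2⟩ := H
    exact ⟨h, ⟨g, hg, h1⟩, h1, h2⟩
  refine Subgroup.closure_induction (p := fun g _ => ∃ h, IsPlanarPart h g ∧ linearDet h = 1)
    ?_ ?_ ?_ ?_ hg
  · rintro g (⟨v, hv, rfl⟩ | rfl)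
    · refine ⟨AffineIsometryEquiv.constVAdd ℝ (E 2) (planar v), fun x => ?_,
        linearDet_translation _⟩
      simp [planar_add]
    · exact ⟨_, isPlanarPart_isoH, linearDet_matH₂⟩
  · exact ⟨1, isPlanarPart_one, linearDet_one⟩
  · rintro g g' - - ⟨h, H, d⟩ ⟨h', H', d'⟩
    exact ⟨_, H.mul H', by rw [linearDet_mul, d, d', one_mul]⟩
  · rintro g - ⟨h, H, d⟩
    refine ⟨_, H.inv, ?_⟩
    have h1 := linearDet_mul h⁻¹ h
    rw [inv_mul_cancel, linearDet_one, d, mul_one] at h1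
    exact h1.symm

theorem linearDet_planeGroup {h : I 2} (hh : h ∈ planeGroup) : linearDet h = 1 := by
  obtain ⟨g, hg, H⟩ := hh
  obtain ⟨h', -, H', d⟩ := exists_isPlanarPart hg
  rw [H.ext H', d]

theorem pt_two (s t u : ℝ) : pt s t u 2 = u := by simp [pt]

theorem exists_height {g : I 3} (hg : g ∈ Γ₁) : ∃ c : ℤ, ∀ x : E 3, g x 2 = x 2 + c := by
  obtain ⟨a, b, c, h | h | h | h | h | h⟩ := isForm₁_of_mem hg <;>
  · refine ⟨c, fun x => ?_⟩
    obtain ⟨s, t, u, rfl⟩ := exists_pt x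
    rw [h, pt_two, pt_two]
    push_cast
    ring

theorem vertical_mem (c : ℤ) : trans (pt 0 0 c) ∈ Γ₁ :=
  translationGroup_le_Γ₁ (trans_mem (mem_hexLattice.2 ⟨0, 0, c, by simp⟩))

theorem isPlanarPart_vertical (c : ℤ) : IsPlanarPart 1 (trans (pt 0 0 c)) := by
  intro x
  obtain ⟨s, t, u, rfl⟩ := exists_pt x
  have h := acts_trans 0 0 c s t u
  simp only [Int.cast_zero] at h
  rw [h]
  push_cast
  simp only [one_mul, zero_mul, add_zero, zero_add]
  exact planar_pt _ _ _ _

theorem trans_vertical_two (c : ℤ) (x : E 3) : trans (pt 0 0 c) x 2 = x 2 + c := by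
  obtain ⟨s, t, u, rfl⟩ := exists_pt x
  have h := acts_trans 0 0 c s t u
  simp only [Int.cast_zero] at h
  rw [h, pt_two, pt_two]
  push_cast
  ring

/-- Every planar part can be lifted to an element of `Γ₁` with prescribed integral shift. -/
theorem exists_lift {h : I 2} (hh : h ∈ planeGroup) (c : ℤ) :
    ∃ g ∈ Γ₁, IsPlanarPart h g ∧ ∀ x : E 3, g x 2 = x 2 + c := by
  obtain ⟨g, hg, H⟩ := hh
  obtain ⟨d, hd⟩ := exists_height hg
  refine ⟨trans (pt 0 0 (c - d : ℤ)) * g, mul_mem (vertical_mem _) hg, ?_, fun x => ?_⟩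
  · simpa using (isPlanarPart_vertical (c - d)).mul H
  · rw [AffineIsometryEquiv.coe_mul, Function.comp_apply, trans_vertical_two, hd]
    push_cast
    ring

theorem proj_planar_eq {x y : E 3} (h : proj Γ₁ x = proj Γ₁ y) :
    proj planeGroup (planar x) = proj planeGroup (planar y) := by
  obtain ⟨g, hg, rfl⟩ := proj_eq_iff.1 h
  obtain ⟨h, hh, H, -⟩ := exists_isPlanarPart hg
  rw [← H, proj_apply_eq hh]

/-- The stabilizers in `Γ₁` are isomorphic to those in the plane group. -/
theorem stabilizer_planar_equiv (x : E 3) :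
    Nonempty (stabilizer Γ₁ x ≃* stabilizer planeGroup (planar x)) := by
  choose F hF hFp _ using fun g : stabilizer Γ₁ x => exists_isPlanarPart g.2.1
  let φ : stabilizer Γ₁ x →* stabilizer planeGroup (planar x) :=
    MonoidHom.mk' (fun g => ⟨F g, hF g, by rw [hFp g, g.2.2]⟩) fun g g' =>
      Subtype.ext ((hFp (g * g')).ext ((hFp g).mul (hFp g')))
  refine ⟨MulEquiv.ofBijective φ ⟨?_, ?_⟩⟩
  · rw [injective_iff_map_eq_one]
    intro g hg
    have h1 : F g = 1 := congrArg Subtype.val hg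
    -- An element with trivial planar part is a vertical translation; fixing a point makes it
    -- trivial.
    obtain ⟨c, hc⟩ := exists_height g.2.1
    have hc0 : (c : ℝ) = 0 := by
      have := hc x
      rw [g.2.2] at this
      linarith
    ext1
    ext1 y
    refine planar_ext ?_ ?_
    · rw [← hFp g, h1]
      rfl
    · rw [hc, hc0, add_zero]
      rfl
  · rintro ⟨h, hh, hx⟩
    -- The lift with shift zero fixes x, since it fixes both the planar part and the height.
    obtain ⟨g, hg, H, h2⟩ := exists_lift hh 0
    have hgx : g x = x := planar_ext (by rw [← H, hx]) (by simpa using h2 x)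
    exact ⟨⟨g, hg, hgx⟩, Subtype.ext ((hFp ⟨g, hg, hgx⟩).ext H)⟩

theorem hasIsotropy_planar {x : E 3} {G : Type} [Group G] (h : HasIsotropy Γ₁ (proj Γ₁ x) G) :
    HasIsotropy planeGroup (proj planeGroup (planar x)) G := by
  rw [hasIsotropy_proj_iff] at *
  obtain ⟨e⟩ := h
  obtain ⟨f⟩ := stabilizer_planar_equiv x
  exact ⟨f.symm.trans e⟩

theorem isConePoint_planar {x : E 3} {m : ℕ}
    (h : HasIsotropy Γ₁ (proj Γ₁ x) (Multiplicative (ZMod m))) :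
    IsConePoint planeGroup m (proj planeGroup (planar x)) :=
  ⟨hasIsotropy_planar h, _, rfl, fun _ hg => linearDet_planeGroup hg.1⟩

/-- Both properties descend from `Γ₁`: lifts without vertical shift act on the plane at height zero,
and the shadow of the prism meets every orbit. -/
theorem isCrystallographic_planeGroup : IsCrystallographic planeGroup := by
  refine ⟨fun K hK => ?_, ⟨?_⟩⟩
  · refine ((isCrystallographic_Γ₁.1 _ (hK.image continuous_atHeight_zero)).biUnion
      (t := fun g => {h | IsPlanarPart h g})
      fun g _ => Set.Subsingleton.finite fun h H h' H' => IsPlanarPart.ext H H').subset ?_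
    rintro h ⟨hh, _, ⟨p, hp, rfl⟩, hq⟩
    obtain ⟨g, hg, H, h2⟩ := exists_lift hh 0
    simp only [Set.mem_iUnion]
    refine ⟨g, ⟨hg, atHeight (h p) 0, ⟨atHeight p 0, ⟨p, hp, rfl⟩, ?_⟩, h p, hq, rfl⟩, H⟩
    refine planar_ext ?_ ?_
    · rw [← H, planar_atHeight, planar_atHeight]
    · rw [h2, atHeight_two, atHeight_two]
      simp
  · have hc : IsCompact (proj planeGroup '' (planar '' prism)) :=
      (isCompact_prism.image continuous_planar).image (continuous_proj _)
    convert hc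
    refine (Set.eq_univ_of_forall fun a => ?_).symm
    obtain ⟨p, rfl⟩ := exists_proj_eq a
    obtain ⟨g, hg, hx⟩ := exists_mem_prism_Γ₁ (atHeight p 0)
    refine ⟨_, ⟨_, hx, rfl⟩, ?_⟩
    rw [← proj_planar_eq (proj_apply_eq hg _).symm, planar_atHeight]

theorem is236Orbifold_planeGroup : Is236Orbifold planeGroup := by
  refine ⟨isCrystallographic_planeGroup, _, _, _, isConePoint_planar (hasIsotropy_Γ₁_axis₂ 0),
    isConePoint_planar (hasIsotropy_Γ₁_axis₃ 0), isConePoint_planar (hasIsotropy_Γ₁_axis₆ 0),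
    fun d h2 h3 h6 => ?_⟩
  obtain ⟨p, rfl⟩ := exists_proj_eq d
  rw [← planar_atHeight p 0] at *
  obtain ⟨u, h⟩ | ⟨u, h⟩ | ⟨u, h⟩ | h := classification_Γ₁ (proj Γ₁ (atHeight p 0))
  · exact absurd ((proj_planar_eq h).trans (congrArg _ (planar_pt _ _ _ _))) h6
  · exact absurd ((proj_planar_eq h).trans (congrArg _ (planar_pt _ _ _ _))) h2
  · exact absurd ((proj_planar_eq h).trans (congrArg _ (planar_pt _ _ _ _))) h3
  · exact hasIsotropy_planar h

/-- The decomposition of space into a plane and a line. -/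
def splitLine : E 3 ≃ₗᵢ[ℝ] WithLp 2 (E 2 × ℝ) where
  toFun x := WithLp.toLp 2 (planar x, x 2)
  invFun y := atHeight y.fst y.snd
  map_add' x y := by
    rw [planar_add]
    rfl
  map_smul' c x := by
    have h : planar (c • x) = c • planar x := by
      ext i
      fin_cases i <;> simp [planar]
    rw [h]
    rfl
  left_inv x := by
    exact planar_ext (planar_atHeight _ _) (atHeight_two _ _)
  right_inv y := by
    simp only [planar_atHeight, atHeight_two]
    rfl
  norm_map' x := by
    rw [← sq_eq_sq₀ (norm_nonneg _) (norm_nonneg _)]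
    change ‖WithLp.toLp 2 (planar x, x 2)‖ ^ 2 = _
    rw [WithLp.prod_norm_sq_eq_of_L2, EuclideanSpace.norm_sq_eq x]
    change ‖planar x‖ ^ 2 + ‖x 2‖ ^ 2 = _
    rw [EuclideanSpace.norm_sq_eq]
    simp [planar, Fin.sum_univ_three]

/-- An element of `Γ₁` is a pair of a planar part and an integral shift; by `exists_lift` every such
pair occurs, so the group is the full product. -/
theorem areIsometric_Γ₁ :
    AreIsometric Γ₁ (prodGroup planeGroup (translationGroup (AddSubgroup.zmultiples (1 : ℝ)))) := by
  refine ⟨splitLine.toAffineIsometryEquiv, fun g => ?_⟩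
  have key : ∀ x, (splitLine.toAffineIsometryEquiv.symm.trans g).trans
      splitLine.toAffineIsometryEquiv (WithLp.toLp 2 (planar x, x 2)) =
      WithLp.toLp 2 (planar (g x), g x 2) := fun x => by
    have h : splitLine.symm (WithLp.toLp 2 (planar x, x 2)) = x := splitLine.symm_apply_apply x
    change splitLine (g (splitLine.symm (WithLp.toLp 2 (planar x, x 2)))) = _
    rw [h]
    rfl
  constructor
  · intro hg
    obtain ⟨h, hh, H, -⟩ := exists_isPlanarPart hg
    obtain ⟨c, hc⟩ := exists_height hg
    refine ⟨h, hh, _, ⟨c, ⟨c, by simp⟩, rfl⟩, fun v w => ?_⟩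
    have h1 := key (atHeight v w)
    rw [planar_atHeight, atHeight_two, ← H, hc, planar_atHeight, atHeight_two] at h1
    rw [h1, add_comm]
    rfl
  · rintro ⟨h, hh, _, ⟨v, ⟨c, rfl⟩, rfl⟩, H⟩
    obtain ⟨g', hg', H', h2⟩ := exists_lift hh c
    convert hg'
    ext1 x
    have h1 := key x
    rw [H] at h1
    have h3 := congrArg WithLp.fst h1
    have h4 := congrArg WithLp.snd h1
    refine planar_ext ?_ ?_
    · rw [← H']
      exact h3.symm
    · rw [h2]
      refine h4.symm.trans ?_
      simp [add_comm]

/-! ### Fourier series of lattice periodic functions -/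

section Fourier

open MeasureTheory UnitAddTorus

local instance : MeasureSpace UnitAddCircle := ⟨AddCircle.haarAddCircle⟩

local instance : Measure.IsAddHaarMeasure (volume : Measure UnitAddCircle) :=
  inferInstanceAs (Measure.IsAddHaarMeasure AddCircle.haarAddCircle)

local instance : IsProbabilityMeasure (volume : Measure UnitAddCircle) :=
  inferInstanceAs (IsProbabilityMeasure AddCircle.haarAddCircle)

/-- The coordinates with respect to the lattice basis. -/
def latticeCoords (x : E 3) : Fin 3 → ℝ := ![(x 0 - x 1 / √3) / 2, x 1 / √3, x 2]

theorem latticeCoords_pt (s t u : ℝ) : latticeCoords (pt s t u) = ![s, t, u] := by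
  have := sqrt_three_pos.ne'
  ext i
  fin_cases i
  · simp [latticeCoords, pt, this]
  · simp [latticeCoords, pt, this]
  · simp [latticeCoords, pt]

theorem pt_latticeCoords (x : E 3) :
    pt (latticeCoords x 0) (latticeCoords x 1) (latticeCoords x 2) = x := by
  obtain ⟨s, t, u, rfl⟩ := exists_pt x
  rw [latticeCoords_pt]
  rfl

theorem latticeCoords_add (x y : E 3) :
    latticeCoords (x + y) = latticeCoords x + latticeCoords y := by
  obtain ⟨s, t, u, rfl⟩ := exists_pt x
  obtain ⟨s', t', u', rfl⟩ := exists_pt y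
  rw [pt_add, latticeCoords_pt, latticeCoords_pt, latticeCoords_pt]
  ext i
  fin_cases i <;> rfl

theorem latticeCoords_smul (c : ℝ) (x : E 3) : latticeCoords (c • x) = c • latticeCoords x := by
  obtain ⟨s, t, u, rfl⟩ := exists_pt x
  rw [pt_smul, latticeCoords_pt, latticeCoords_pt]
  ext i
  fin_cases i <;> rfl

/-- The linear form on space which takes integral values `k` on the lattice basis. -/
def freq (k : Fin 3 → ℤ) : E 3 →L[ℝ] ℝ :=
  LinearMap.toContinuousLinearMap
    { toFun := fun x => ∑ i, k i * latticeCoords x i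
      map_add' := fun x y => by
        simp only [latticeCoords_add, Pi.add_apply, mul_add, Finset.sum_add_distrib]
      map_smul' := fun c x => by
        simp only [latticeCoords_smul, Pi.smul_apply, smul_eq_mul, Finset.mul_sum, RingHom.id_apply]
        exact Finset.sum_congr rfl fun i _ => by ring }

theorem freq_apply (k : Fin 3 → ℤ) (x : E 3) : freq k x = ∑ i, k i * latticeCoords x i := rfl

theorem freq_pt (k : Fin 3 → ℤ) (s t u : ℝ) : freq k (pt s t u) = k 0 * s + k 1 * t + k 2 * u := by
  rw [freq_apply, latticeCoords_pt, Fin.sum_univ_three]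
  rfl

/-- The projection of space onto the torus. -/
def toTorus (x : E 3) : UnitAddTorus (Fin 3) := fun i => (latticeCoords x i : UnitAddCircle)

theorem toTorus_add (x y : E 3) : toTorus (x + y) = toTorus x + toTorus y := by
  ext i
  simp only [toTorus, latticeCoords_add, Pi.add_apply, AddCircle.coe_add]

theorem toTorus_zero : toTorus 0 = 0 := by
  simpa using toTorus_add 0 0

theorem toTorus_surjective (θ : UnitAddTorus (Fin 3)) : ∃ x, toTorus x = θ := by
  choose v hv using fun i => QuotientAddGroup.mk_surjective (θ i)
  refine ⟨pt (v 0) (v 1) (v 2), ?_⟩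
  ext i
  rw [toTorus, latticeCoords_pt, ← hv i]
  fin_cases i <;> rfl

/-- The character of the torus, as a function on space. -/
def wave (k : Fin 3 → ℤ) (x : E 3) : ℂ := Complex.exp (2 * Real.pi * Complex.I * freq k x)

theorem mFourier_toTorus (k : Fin 3 → ℤ) (x : E 3) : mFourier k (toTorus x) = wave k x := by
  change ∏ i, fourier (k i) (latticeCoords x i : UnitAddCircle) = _
  simp only [fourier_coe_apply, ← Complex.exp_sum, wave, freq_apply]
  congr 1
  push_cast
  rw [Finset.mul_sum]
  exact Finset.sum_congr rfl fun i _ => by ring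

theorem wave_add (k : Fin 3 → ℤ) (x y : E 3) : wave k (x + y) = wave k x * wave k y := by
  simp only [wave, map_add, Complex.ofReal_add, mul_add, Complex.exp_add]

/-- Functions which are invariant under the lattice translations. -/
def IsPeriodic (f : E 3 → ℝ) : Prop := ∀ v ∈ hexLattice, ∀ x, f (x + v) = f x

/-- The function on the torus defined by a periodic function. -/
def descend (f : E 3 → ℝ) (θ : UnitAddTorus (Fin 3)) : ℂ := f (toTorus_surjective θ).choose

/-- Two preimages of a point of the torus differ by a lattice vector, so the choice made in
`descend` is immaterial for periodic functions. -/
theorem descend_toTorus {f : E 3 → ℝ} (hf : IsPeriodic f) (x : E 3) :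
    descend f (toTorus x) = f x := by
  unfold descend
  set y := (toTorus_surjective (toTorus x)).choose
  have hy : toTorus y = toTorus x := (toTorus_surjective (toTorus x)).choose_spec
  have h : ∀ i, ∃ n : ℤ, latticeCoords y i = latticeCoords x i + n := fun i => by
    have h1 : (latticeCoords y i : UnitAddCircle) = (latticeCoords x i : UnitAddCircle) :=
      congrFun hy i
    rw [QuotientAddGroup.eq_iff_sub_mem, AddSubgroup.mem_zmultiples_iff] at h1
    obtain ⟨n, hn⟩ := h1
    exact ⟨n, by simp at hn; linarith⟩
  choose n hn using h
  have h2 : y = x + pt (n 0) (n 1) (n 2) := by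
    rw [← pt_latticeCoords x, ← pt_latticeCoords y, pt_add, hn, hn, hn]
  rw [h2, hf _ (mem_hexLattice.2 ⟨_, _, _, rfl⟩)]

theorem continuous_descend {f : E 3 → ℝ} (hf : IsPeriodic f) (hc : Continuous f) :
    Continuous (descend f) := by
  have hq : IsOpenQuotientMap (Pi.map fun (_ : Fin 3) (r : ℝ) => (r : UnitAddCircle)) :=
    IsOpenQuotientMap.piMap fun _ => QuotientAddGroup.isOpenQuotientMap_mk
  rw [hq.isQuotientMap.continuous_iff]
  have h : descend f ∘ (Pi.map fun (_ : Fin 3) (r : ℝ) => (r : UnitAddCircle)) =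
      fun v => ((f (pt (v 0) (v 1) (v 2)) : ℝ) : ℂ) := by
    ext v
    rw [← descend_toTorus hf, Function.comp_apply]
    congr 1
    ext i
    rw [toTorus, latticeCoords_pt]
    fin_cases i <;> rfl
  rw [h]
  have h1 := continuous_pt.comp
    (by fun_prop : Continuous fun v : Fin 3 → ℝ => (v 0, v 1, v 2))
  exact Complex.continuous_ofReal.comp (hc.comp h1)

/-- The Fourier coefficients of a periodic function. -/
def coeff (f : E 3 → ℝ) (k : Fin 3 → ℤ) : ℂ := mFourierCoeff (descend f) k

theorem coeff_eq (f : E 3 → ℝ) (k : Fin 3 → ℤ) :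
    coeff f k = ∫ θ, mFourier (-k) θ * descend f θ := rfl

theorem integrable_of_continuous {F : UnitAddTorus (Fin 3) → ℂ} (hF : Continuous F) :
    Integrable F :=
  hF.integrable_of_hasCompactSupport (HasCompactSupport.of_compactSpace F)

/-- The chosen preimage does not depend on the function, so `descend` is linear without periodicity.
-/
theorem descend_add {f g : E 3 → ℝ} : descend (f + g) = descend f + descend g := by
  ext θ
  simp [descend]

theorem descend_smul {f : E 3 → ℝ} (c : ℝ) : descend (c • f) = (c : ℂ) • descend f := by
  ext θ
  simp [descend]

theorem coeff_add {f g : E 3 → ℝ} (hf : IsPeriodic f) (hfc : Continuous f) (hg : IsPeriodic g)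
    (hgc : Continuous g) (k : Fin 3 → ℤ) : coeff (f + g) k = coeff f k + coeff g k := by
  have h1 := continuous_descend hf hfc
  have h2 := continuous_descend hg hgc
  simp only [coeff_eq, descend_add, Pi.add_apply, mul_add]
  exact integral_add (integrable_of_continuous (by fun_prop))
    (integrable_of_continuous (by fun_prop))

theorem coeff_smul (c : ℝ) (f : E 3 → ℝ) (k : Fin 3 → ℤ) : coeff (c • f) k = c * coeff f k := by
  simp only [coeff_eq, descend_smul, Pi.smul_apply, smul_eq_mul]
  rw [← integral_const_mul]
  congr 1
  ext θ
  ring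

theorem coeff_neg (f : E 3 → ℝ) (k : Fin 3 → ℤ) :
    coeff f (-k) = (starRingEnd ℂ) (coeff f k) := by
  rw [coeff_eq, coeff_eq, ← integral_conj]
  congr 1
  ext θ
  rw [map_mul, ← mFourier_neg]
  simp [descend]

theorem isPeriodic_fderiv {f : E 3 → ℝ} (hf : IsPeriodic f) (w : E 3) :
    IsPeriodic fun x => fderiv ℝ f x w := by
  intro v hv x
  have h : (fun x => f (x + v)) = f := funext fun x => hf v hv x
  have h1 := fderiv_comp_add_right (𝕜 := ℝ) (f := f) (x := x) v
  rw [h] at h1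
  simp only [h1]

theorem hasDerivAt_wave (k : Fin 3 → ℤ) (w : E 3) : HasDerivAt (fun h : ℝ => wave k (h • w))
    (2 * Real.pi * Complex.I * freq k w) 0 := by
  have h1 : HasDerivAt (fun h : ℝ => 2 * Real.pi * Complex.I * ((h * freq k w : ℝ) : ℂ))
      (2 * Real.pi * Complex.I * freq k w) 0 := by
    have h2 : HasDerivAt (fun h : ℝ => h * freq k w) (1 * freq k w) 0 :=
      (hasDerivAt_id (0 : ℝ)).mul_const _
    rw [one_mul] at h2
    exact h2.ofReal_comp.const_mul _
  have h3 := h1.cexp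
  simpa [wave] using h3

/-- The Fourier coefficients of a directional derivative. -/
theorem coeff_fderiv {f : E 3 → ℝ} (hf : IsPeriodic f) (hc : ContDiff ℝ 1 f) (w : E 3)
    (k : Fin 3 → ℤ) :
    coeff (fun x => fderiv ℝ f x w) k = 2 * Real.pi * Complex.I * freq k w * coeff f k := by
  have hD := continuous_descend hf hc.continuous
  have hf' := isPeriodic_fderiv hf w
  have hc' : Continuous fun x => fderiv ℝ f x w :=
    (hc.continuous_fderiv (by simp)).clm_apply continuous_const
  have hD' := continuous_descend hf' hc'
  -- The coefficient of a translate of f is differentiated in two ways: translation invariance of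
  -- the measure turns the translate into a factor `wave k (h • w)`, and differentiation under the
  -- integral produces the directional derivative.
  have h1 : ∀ h : ℝ, ∫ θ, mFourier (-k) θ * descend f (θ + toTorus (h • w)) =
      wave k (h • w) * coeff f k := fun h => by
    rw [coeff_eq, ← integral_add_right_eq_self (fun θ => mFourier (-k) θ * descend f θ)
      (toTorus (h • w)), ← integral_const_mul]
    congr 1
    ext θ
    have h2 : mFourier (-k) (θ + toTorus (h • w)) =
        mFourier (-k) θ * mFourier (-k) (toTorus (h • w)) := by
      obtain ⟨x, rfl⟩ := toTorus_surjective θ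
      rw [← toTorus_add, mFourier_toTorus, mFourier_toTorus, mFourier_toTorus, wave_add]
    have h3 : wave k (h • w) * mFourier (-k) (toTorus (h • w)) = 1 := by
      rw [← mFourier_toTorus, ← mFourier_add, add_neg_cancel, mFourier_zero]
      rfl
    rw [h2]
    linear_combination -(mFourier (-k) θ * descend f (θ + toTorus (h • w))) * h3
  have h4 : HasDerivAt (fun h : ℝ => ∫ θ, mFourier (-k) θ * descend f (θ + toTorus (h • w)))
      (2 * Real.pi * Complex.I * freq k w * coeff f k) 0 := by
    simp only [h1]
    exact (hasDerivAt_wave k w).mul_const _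
  -- The derivative descends to a continuous function on the compact torus, which gives the
  -- dominating constant.
  obtain ⟨C, hC⟩ : ∃ C, ∀ θ, ‖descend (fun x => fderiv ℝ f x w) θ‖ ≤ C := by
    obtain ⟨C, hC⟩ := (isCompact_univ.image hD').isBounded.exists_norm_le
    exact ⟨C, fun θ => hC _ ⟨θ, trivial, rfl⟩⟩
  have h5 : HasDerivAt (fun h : ℝ => ∫ θ, mFourier (-k) θ * descend f (θ + toTorus (h • w)))
      (∫ θ, mFourier (-k) θ * descend (fun x => fderiv ℝ f x w) (θ + toTorus ((0 : ℝ) • w))) 0 := by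
    refine (hasDerivAt_integral_of_dominated_loc_of_deriv_le (s := Set.univ)
      (bound := fun _ => C)
      (F' := fun h θ => mFourier (-k) θ *
        descend (fun x => fderiv ℝ f x w) (θ + toTorus (h • w)))
      Filter.univ_mem ?_ ?_ ?_ ?_ (integrable_const C) ?_).2
    · exact Filter.Eventually.of_forall fun h => Continuous.aestronglyMeasurable (by fun_prop)
    · exact integrable_of_continuous (by fun_prop)
    · exact Continuous.aestronglyMeasurable (by fun_prop)
    · refine Filter.Eventually.of_forall fun θ h _ => ?_
      rw [norm_mul]
      have h6 : ‖mFourier (-k) θ‖ ≤ 1 :=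
        ((mFourier (-k)).norm_coe_le_norm θ).trans mFourier_norm.le
      exact (mul_le_of_le_one_left (norm_nonneg _) h6).trans (hC _)
    · refine Filter.Eventually.of_forall fun θ h _ => HasDerivAt.const_mul _ ?_
      obtain ⟨x, rfl⟩ := toTorus_surjective θ
      simp only [← toTorus_add, descend_toTorus hf, descend_toTorus hf']
      have h7 : HasDerivAt (fun h : ℝ => x + h • w) w h := by
        simpa using ((hasDerivAt_id h).smul_const w).const_add x
      have h8 := (((hc.differentiable (by simp)) (x + h • w)).hasFDerivAt).comp_hasDerivAt h h7
      exact h8.ofReal_comp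
  have h9 := h5.unique h4
  rw [← h9, zero_smul, toTorus_zero]
  simp only [add_zero]
  rfl

end Fourier

/-! ### Finite Fourier sums -/

open UnitAddTorus in
theorem mFourierCoeff_mFourier (k m : Fin 3 → ℤ) :
    mFourierCoeff (mFourier k) m = if m = k then 1 else 0 := by
  classical
  have h1 := mFourierBasis_repr (mFourierBasis (d := Fin 3) k) m
  rw [HilbertBasis.repr_self, coe_mFourierBasis, mFourierLp, mFourierCoeff_toLp] at h1
  rw [← h1, lp.single_apply]
  by_cases h : m = k
  · subst h; simp
  · simp [h]

theorem wave_neg (k : Fin 3 → ℤ) (x : E 3) : wave (-k) x = (starRingEnd ℂ) (wave k x) := by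
  rw [← mFourier_toTorus, ← mFourier_toTorus, UnitAddTorus.mFourier_neg]

theorem contDiff_wave (k : Fin 3 → ℤ) : ContDiff ℝ ∞ (wave k) := by
  unfold wave
  exact (contDiff_const.mul (Complex.ofRealCLM.contDiff.comp (freq k).contDiff)).cexp

theorem wave_add_lattice (k : Fin 3 → ℤ) {v : E 3} (hv : v ∈ hexLattice) (x : E 3) :
    wave k (x + v) = wave k x := by
  obtain ⟨a, b, c, rfl⟩ := mem_hexLattice.1 hv
  rw [wave_add]
  have h : wave k (pt a b c) = 1 := by
    rw [wave, freq_pt, Complex.exp_eq_one_iff]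
    refine ⟨k 0 * a + k 1 * b + k 2 * c, ?_⟩
    push_cast
    ring
  rw [h, mul_one]

/-- Finite Fourier expansions. -/
theorem eq_sum_coeff {f : E 3 → ℝ} (hf : IsPeriodic f) (hc : Continuous f)
    (S : Finset (Fin 3 → ℤ)) (hS : ∀ k ∉ S, coeff f k = 0) (x : E 3) :
    (f x : ℂ) = ∑ k ∈ S, coeff f k * wave k x := by
  let F : C(UnitAddTorus (Fin 3), ℂ) := ⟨descend f, continuous_descend hf hc⟩
  -- With only finitely many nonzero coefficients, the Fourier series of a continuous function is
  -- summable and hence converges to it pointwise.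
  have hsum : Summable (UnitAddTorus.mFourierCoeff F) :=
    summable_of_ne_finset_zero (s := S) fun k hk => hS k hk
  have h1 := UnitAddTorus.hasSum_mFourier_series_apply_of_summable hsum (toTorus x)
  have h2 := h1.unique (hasSum_sum_of_ne_finset_zero (s := S) fun k hk => by
    have : UnitAddTorus.mFourierCoeff F k = 0 := hS k hk
    rw [this, zero_smul])
  have h3 : F (toTorus x) = f x := descend_toTorus hf x
  rw [← h3, h2]
  refine Finset.sum_congr rfl fun k _ => ?_
  rw [mFourier_toTorus, smul_eq_mul]
  rfl

open UnitAddTorus in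
/-- The Fourier coefficients of a finite sum of waves. -/
theorem coeff_of_eq_sum {ι : Type*} {f : E 3 → ℝ} (hf : IsPeriodic f) (S : Finset ι) (a : ι → ℂ)
    (σ : ι → Fin 3 → ℤ) (h : ∀ x, (f x : ℂ) = ∑ k ∈ S, a k * wave (σ k) x) (m : Fin 3 → ℤ) :
    coeff f m = ∑ k ∈ S, if m = σ k then a k else 0 := by
  have h1 : descend f = fun θ => ∑ k ∈ S, a k * mFourier (σ k) θ := by
    ext θ
    obtain ⟨x, rfl⟩ := toTorus_surjective θ
    rw [descend_toTorus hf, h]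
    simp only [mFourier_toTorus]
  have h2 : coeff f m = ∑ k ∈ S, a k * mFourierCoeff (mFourier (σ k)) m := by
    simp only [coeff, mFourierCoeff, h1, smul_eq_mul, Finset.mul_sum]
    rw [MeasureTheory.integral_finsetSum _ fun k _ => integrable_of_continuous (by fun_prop)]
    refine Finset.sum_congr rfl fun k _ => ?_
    rw [← MeasureTheory.integral_const_mul]
    congr 1
    ext θ
    ring
  rw [h2]
  refine Finset.sum_congr rfl fun k _ => ?_
  rw [mFourierCoeff_mFourier]
  split_ifs <;> simp

/-! ### Eigenfunctions -/

/-- Three times the squared length of a frequency. -/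
def quad (k : Fin 3 → ℤ) : ℤ := k 0 ^ 2 - k 0 * k 1 + k 1 ^ 2 + 3 * k 2 ^ 2

/-- The eigenvalue of a wave. -/
def eigen (k : Fin 3 → ℤ) : ℝ := 4 * Real.pi ^ 2 * (quad k / 3)

theorem sum_freq_sq (k : Fin 3 → ℤ) :
    ∑ i, freq k (EuclideanSpace.single i 1) ^ 2 = quad k / 3 := by
  have h3 : √3 * √3 = (3 : ℝ) := sqrt_three_mul_self
  have h0 := sqrt_three_pos.ne'
  -- The standard basis is expressed in lattice coordinates, so the sum is the squared length of the
  -- frequency as a covector.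
  have e0 : (EuclideanSpace.single 0 1 : E 3) = pt (1 / 2) 0 0 := by
    ext i; fin_cases i <;> simp [pt]
  have e1 : (EuclideanSpace.single 1 1 : E 3) = pt (-(√3 / 6)) (√3 / 3) 0 := by
    ext i
    fin_cases i <;> simp [pt]
    · ring
    · linarith
  have e2 : (EuclideanSpace.single 2 1 : E 3) = pt 0 0 1 := by
    ext i; fin_cases i <;> simp [pt]
  rw [Fin.sum_univ_three, e0, e1, e2, freq_pt, freq_pt, freq_pt, quad]
  push_cast
  linear_combination (k 0 ^ 2 / 36 - k 0 * k 1 / 9 + k 1 ^ 2 / 9 : ℝ) * h3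

theorem isPeriodic_of_mem {Γ : Subgroup (I 3)} (hΓ : translationGroup hexLattice ≤ Γ)
    {f : E 3 → ℝ} (hf : f ∈ smoothFunctions Γ) : IsPeriodic f := fun v hv x => by
  rw [add_comm]
  exact hf.2 _ (hΓ (trans_mem hv)) x

theorem laplacian_eq_sum {f : E 3 → ℝ} (hc : ContDiff ℝ ∞ f) (x : E 3) :
    Laplacian.laplacian f x = ∑ i : Fin 3,
      fderiv ℝ (fun y => fderiv ℝ f y (EuclideanSpace.single i 1)) x
        (EuclideanSpace.single i 1) := by
  rw [InnerProductSpace.laplacian_eq_iteratedFDeriv_orthonormalBasis f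
    (EuclideanSpace.basisFun (Fin 3) ℝ)]
  refine Finset.sum_congr rfl fun i _ => ?_
  have h1 : DifferentiableAt ℝ (fderiv ℝ f) x :=
    ((hc.fderiv_right (m := ∞) (by simp)).differentiable (by simp)) x
  rw [iteratedFDeriv_two_apply, fderiv_clm_apply h1 (differentiableAt_const _)]
  simp

/-- The second derivative in a coordinate direction. -/
def secondDeriv (i : Fin 3) (f : E 3 → ℝ) (x : E 3) : ℝ :=
  fderiv ℝ (fun y => fderiv ℝ f y (EuclideanSpace.single i 1)) x (EuclideanSpace.single i 1)

theorem laplacian_eq {f : E 3 → ℝ} (hc : ContDiff ℝ ∞ f) :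
    Laplacian.laplacian f = secondDeriv 0 f + secondDeriv 1 f + secondDeriv 2 f := by
  ext x
  rw [laplacian_eq_sum hc, Fin.sum_univ_three]
  rfl

theorem contDiff_directional {f : E 3 → ℝ} (hc : ContDiff ℝ ∞ f) (w : E 3) :
    ContDiff ℝ ∞ fun y => fderiv ℝ f y w :=
  (hc.fderiv_right (m := ∞) (by simp)).clm_apply contDiff_const

theorem continuous_secondDeriv {f : E 3 → ℝ} (hc : ContDiff ℝ ∞ f) (i : Fin 3) :
    Continuous (secondDeriv i f) :=
  (contDiff_directional (contDiff_directional hc _) _).continuous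

theorem isPeriodic_secondDeriv {f : E 3 → ℝ} (hf : IsPeriodic f) (i : Fin 3) :
    IsPeriodic (secondDeriv i f) := isPeriodic_fderiv (isPeriodic_fderiv hf _) _

theorem IsPeriodic.add {f g : E 3 → ℝ} (hf : IsPeriodic f) (hg : IsPeriodic g) :
    IsPeriodic (f + g) := fun v hv x => by
  simp only [Pi.add_apply, hf v hv x, hg v hv x]

theorem IsPeriodic.smul {f : E 3 → ℝ} (hf : IsPeriodic f) (c : ℝ) :
    IsPeriodic (c • f) := fun v hv x => by
  simp only [Pi.smul_apply, hf v hv x]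

theorem continuous_laplacian {f : E 3 → ℝ} (hc : ContDiff ℝ ∞ f) :
    Continuous (Laplacian.laplacian f) := by
  rw [laplacian_eq hc]
  exact ((continuous_secondDeriv hc 0).add (continuous_secondDeriv hc 1)).add
    (continuous_secondDeriv hc 2)

theorem isPeriodic_laplacian {f : E 3 → ℝ} (hf : IsPeriodic f) (hc : ContDiff ℝ ∞ f) :
    IsPeriodic (Laplacian.laplacian f) := by
  rw [laplacian_eq hc]
  exact ((isPeriodic_secondDeriv hf 0).add (isPeriodic_secondDeriv hf 1)).add
    (isPeriodic_secondDeriv hf 2)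

theorem coeff_secondDeriv {f : E 3 → ℝ} (hf : IsPeriodic f) (hc : ContDiff ℝ ∞ f) (i : Fin 3)
    (k : Fin 3 → ℤ) : coeff (secondDeriv i f) k =
      -(4 * Real.pi ^ 2 * freq k (EuclideanSpace.single i 1) ^ 2 : ℂ) * coeff f k := by
  have h1 := coeff_fderiv (isPeriodic_fderiv hf (EuclideanSpace.single i 1))
    ((contDiff_directional hc _).of_le (by simp)) (EuclideanSpace.single i 1) k
  rw [coeff_fderiv hf (hc.of_le (by simp))] at h1
  refine h1.trans ?_
  linear_combination (4 * Real.pi ^ 2 * (freq k (EuclideanSpace.single i 1) : ℂ) ^ 2 *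
    coeff f k) * Complex.I_sq

theorem coeff_laplacian {f : E 3 → ℝ} (hf : IsPeriodic f) (hc : ContDiff ℝ ∞ f)
    (k : Fin 3 → ℤ) : coeff (Laplacian.laplacian f) k = -(eigen k * coeff f k : ℂ) := by
  have hc2 := continuous_secondDeriv hc
  have hp2 := isPeriodic_secondDeriv hf
  rw [laplacian_eq hc, coeff_add ((hp2 0).add (hp2 1)) ((hc2 0).add (hc2 1)) (hp2 2) (hc2 2),
    coeff_add (hp2 0) (hc2 0) (hp2 1) (hc2 1), coeff_secondDeriv hf hc, coeff_secondDeriv hf hc,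
    coeff_secondDeriv hf hc]
  have h3 := sum_freq_sq k
  rw [Fin.sum_univ_three] at h3
  have h4 := congrArg (fun r : ℝ => (r : ℂ)) h3
  push_cast at h4
  rw [eigen]
  push_cast
  linear_combination (-(4 * Real.pi ^ 2 : ℂ) * coeff f k) * h4

/-- The Laplace operator multiplies the coefficient at k by `eigen k` up to sign, so the eigenvalue
equation reads (`eigen k` - c) · coefficient = 0. -/
theorem coeff_eq_zero {f : E 3 → ℝ} (hf : IsPeriodic f) (hc : ContDiff ℝ ∞ f) {c : ℝ}
    (h : -(Laplacian.laplacian f) = c • f) {k : Fin 3 → ℤ} (hk : eigen k ≠ c) :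
    coeff f k = 0 := by
  have h1 : Laplacian.laplacian f = (-c) • f := by
    rw [neg_smul, ← h, neg_neg]
  have h2 := coeff_laplacian hf hc k
  rw [h1, coeff_smul] at h2
  have h3 : ((eigen k - c : ℝ) : ℂ) * coeff f k = 0 := by
    push_cast at h2 ⊢
    linear_combination h2
  rcases mul_eq_zero.1 h3 with h4 | h4
  · exact absurd (sub_eq_zero.1 (by exact_mod_cast h4)) hk
  · exact h4

theorem quad_nonneg_bound (k : Fin 3 → ℤ) :
    k 0 ^ 2 ≤ 2 * quad k ∧ k 1 ^ 2 ≤ 2 * quad k ∧ k 2 ^ 2 ≤ 2 * quad k := by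
  unfold quad
  refine ⟨?_, ?_, ?_⟩ <;>
    nlinarith [sq_nonneg (k 0 - k 1), sq_nonneg (k 0), sq_nonneg (k 1), sq_nonneg (k 2)]

theorem finite_eigen (c : ℝ) : {k | eigen k = c}.Finite := by
  -- N bounds 2 · `quad k`, which dominates the square of every entry of k; for an integer, the
  -- square dominates the absolute value.
  set N : ℤ := ⌈2 * (3 * (c / (4 * Real.pi ^ 2)))⌉
  refine (Set.finite_Icc (fun _ => -N : Fin 3 → ℤ) (fun _ => N)).subset fun k hk => ?_
  have h1 : (quad k : ℝ) = 3 * (c / (4 * Real.pi ^ 2)) := by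
    have hpi := Real.pi_pos.ne'
    rw [← hk, eigen]
    field_simp
  have h2 : 2 * quad k ≤ N := by
    have : (2 * quad k : ℝ) ≤ N := by
      rw [h1]
      exact Int.le_ceil _
    exact_mod_cast this
  have h3 : ∀ i, k i ^ 2 ≤ N := fun i => by
    obtain ⟨q0, q1, q2⟩ := quad_nonneg_bound k
    fin_cases i
    exacts [q0.trans h2, q1.trans h2, q2.trans h2]
  refine ⟨fun i => ?_, fun i => ?_⟩
  · simp only
    nlinarith [h3 i, Int.le_self_sq (-(k i))]
  · exact (Int.le_self_sq (k i)).trans (h3 i)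

/-- The frequencies of the eigenfunctions for the eigenvalue `c`. -/
def eigenSet (c : ℝ) : Finset (Fin 3 → ℤ) := (finite_eigen c).toFinset

theorem mem_eigenSet {c : ℝ} {k : Fin 3 → ℤ} : k ∈ eigenSet c ↔ eigen k = c := by
  simp [eigenSet]

theorem quad_neg (k : Fin 3 → ℤ) : quad (-k) = quad k := by
  simp only [quad, Pi.neg_apply]
  ring

theorem eigen_neg (k : Fin 3 → ℤ) : eigen (-k) = eigen k := by
  rw [eigen, eigen, quad_neg]

/-- The coefficient functions of real eigenfunctions for the eigenvalue `c`. -/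
def IsCoeff (c : ℝ) (a : (Fin 3 → ℤ) → ℂ) : Prop :=
  (∀ k, eigen k ≠ c → a k = 0) ∧ ∀ k, a (-k) = (starRingEnd ℂ) (a k)

/-- The function with given Fourier coefficients. -/
def synth (c : ℝ) : ((Fin 3 → ℤ) → ℂ) →ₗ[ℝ] (E 3 → ℝ) where
  toFun a x := (∑ k ∈ eigenSet c, a k * wave k x).re
  map_add' a b := by
    ext x
    simp only [Pi.add_apply, add_mul, Finset.sum_add_distrib, Complex.add_re]
  map_smul' r a := by
    ext x
    simp only [Pi.smul_apply, smul_mul_assoc, ← Finset.smul_sum, Complex.smul_re, RingHom.id_apply]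

/-- Replacing k by -k conjugates the sum, so it is real and nothing is lost by the real part in
`synth`. -/
theorem synth_apply {c : ℝ} {a : (Fin 3 → ℤ) → ℂ} (ha : IsCoeff c a) (x : E 3) :
    (synth c a x : ℂ) = ∑ k ∈ eigenSet c, a k * wave k x := by
  refine Complex.conj_eq_iff_re.1 ?_
  rw [map_sum]
  refine Finset.sum_equiv (Equiv.neg _) (fun k => ?_) fun k _ => ?_
  · simp [mem_eigenSet, eigen_neg]
  · simp only [Equiv.neg_apply]
    rw [map_mul, ha.2, wave_neg]

theorem contDiff_synth (c : ℝ) (a : (Fin 3 → ℤ) → ℂ) : ContDiff ℝ ∞ (synth c a) := by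
  refine Complex.reCLM.contDiff.comp (?_ : ContDiff ℝ ∞ fun x => ∑ k ∈ eigenSet c, a k * wave k x)
  exact ContDiff.sum fun k _ => contDiff_const.mul (contDiff_wave k)

theorem isPeriodic_synth (c : ℝ) (a : (Fin 3 → ℤ) → ℂ) : IsPeriodic (synth c a) := by
  intro v hv x
  simp only [synth, LinearMap.coe_mk, AddHom.coe_mk, wave_add_lattice _ hv]

theorem coeff_synth {c : ℝ} {a : (Fin 3 → ℤ) → ℂ} (ha : IsCoeff c a) :
    coeff (synth c a) = a := by
  ext m
  rw [coeff_of_eq_sum (isPeriodic_synth c a) (eigenSet c) a id (synth_apply ha)]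
  simp only [id_eq, Finset.sum_ite_eq, mem_eigenSet]
  split_ifs with h
  · rfl
  · exact (ha.1 m h).symm

/-- The difference has no nonzero coefficient, so its finite expansion is the empty sum. -/
theorem eq_of_coeff_eq {f g : E 3 → ℝ} (hf : IsPeriodic f) (hfc : Continuous f)
    (hg : IsPeriodic g) (hgc : Continuous g) (h : coeff f = coeff g) : f = g := by
  have hp : IsPeriodic (f + (-1 : ℝ) • g) := hf.add (hg.smul _)
  have hc : Continuous (f + (-1 : ℝ) • g) := hfc.add (hgc.const_smul _)
  ext x
  have h1 := eq_sum_coeff hp hc ∅ (fun k _ => by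
    rw [coeff_add hf hfc (hg.smul _) (hgc.const_smul _), coeff_smul, h]
    push_cast
    ring) x
  rw [Finset.sum_empty] at h1
  have h2 : (f + (-1 : ℝ) • g) x = 0 := by exact_mod_cast h1
  simp at h2
  linarith

theorem laplacian_synth {c : ℝ} {a : (Fin 3 → ℤ) → ℂ} (ha : IsCoeff c a) :
    -(Laplacian.laplacian (synth c a)) = c • synth c a := by
  have hs := contDiff_synth c a
  have hp := isPeriodic_synth c a
  rw [neg_eq_iff_eq_neg, ← neg_smul]
  refine eq_of_coeff_eq (isPeriodic_laplacian hp hs) (continuous_laplacian hs) (hp.smul _)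
    (hs.continuous.const_smul _) ?_
  ext k
  rw [coeff_laplacian hp hs, coeff_smul, coeff_synth ha]
  by_cases h : eigen k = c
  · rw [h]; push_cast; ring
  · rw [ha.1 k h]; simp

theorem isCoeff_coeff {f : E 3 → ℝ} (hf : IsPeriodic f) (hc : ContDiff ℝ ∞ f) {c : ℝ}
    (h : -(Laplacian.laplacian f) = c • f) : IsCoeff c (coeff f) :=
  ⟨fun _ hk => coeff_eq_zero hf hc h hk, coeff_neg f⟩

theorem wave_comp {g : I 3} {σ : (Fin 3 → ℤ) → Fin 3 → ℤ}
    (hσ : ∀ k x, freq k (g x) = freq (σ k) x) (k : Fin 3 → ℤ) (x : E 3) :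
    wave k (g x) = wave (σ k) x := by
  rw [wave, hσ, wave]

/-- Invariance of an eigenfunction gives invariance of its coefficients. -/
theorem coeff_invariant {f : E 3 → ℝ} (hf : IsPeriodic f) (hc : ContDiff ℝ ∞ f) {c : ℝ}
    (h : -(Laplacian.laplacian f) = c • f) {g : I 3} (hg : ∀ x, f (g x) = f x)
    {σ : (Fin 3 → ℤ) ≃ (Fin 3 → ℤ)} (hσ : ∀ k x, freq k (g x) = freq (σ k) x) (m : Fin 3 → ℤ) :
    coeff f (σ m) = coeff f m := by
  -- Composed with g, the expansion of f has frequencies σ k with unchanged coefficients; uniqueness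
  -- of coefficients compares it with the original one.
  rw [coeff_of_eq_sum hf (eigenSet c) (coeff f) σ (fun x => ?_)]
  · simp only [EmbeddingLike.apply_eq_iff_eq, Finset.sum_ite_eq, mem_eigenSet]
    split_ifs with h1
    · rfl
    · exact (coeff_eq_zero hf hc h h1).symm
  · rw [← hg, eq_sum_coeff hf hc.continuous (eigenSet c) fun k hk =>
      coeff_eq_zero hf hc h (fun h1 => hk (mem_eigenSet.2 h1))]
    exact Finset.sum_congr rfl fun k _ => by rw [wave_comp hσ]

theorem synth_invariant {c : ℝ} {a : (Fin 3 → ℤ) → ℂ} {g : I 3}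
    {σ : (Fin 3 → ℤ) ≃ (Fin 3 → ℤ)} (hσ : ∀ k x, freq k (g x) = freq (σ k) x)
    (hq : ∀ k, quad (σ k) = quad k) (h : ∀ k, a (σ k) = a k) (x : E 3) :
    synth c a (g x) = synth c a x := by
  simp only [synth, LinearMap.coe_mk, AddHom.coe_mk]
  congr 1
  refine Finset.sum_equiv σ (fun k => ?_) fun k _ => ?_
  · rw [mem_eigenSet, mem_eigenSet, eigen, eigen, hq]
  · rw [wave_comp hσ, h]

theorem invariant_closure {n : ℕ} {S : Set (I n)} {f : E n → ℝ} (h : ∀ g ∈ S, ∀ x, f (g x) = f x)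
    {g : I n} (hg : g ∈ Subgroup.closure S) : ∀ x, f (g x) = f x := by
  induction hg using Subgroup.closure_induction with
  | mem g hg => exact h g hg
  | one => exact fun _ => rfl
  | mul a b _ _ iha ihb => exact fun x => (iha _).trans (ihb x)
  | inv a _ iha =>
    intro x
    rw [← iha]
    exact congrArg f (a.apply_symm_apply x)

theorem invariant_translationGroup {f : E 3 → ℝ} (hf : IsPeriodic f) {g : I 3}
    (hg : g ∈ translationGroup hexLattice) (x : E 3) : f (g x) = f x := by
  obtain ⟨v, hv, rfl⟩ := hg
  have := hf v hv x
  rwa [add_comm] at this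

/-! ### The action on frequencies -/

/-- The action of `H` on frequencies. -/
def freqH : (Fin 3 → ℤ) ≃ (Fin 3 → ℤ) where
  toFun k := ![k 1, k 1 - k 0, k 2]
  invFun k := ![k 0 - k 1, k 0, k 2]
  left_inv k := by ext i; fin_cases i <;> simp
  right_inv k := by ext i; fin_cases i <;> simp

/-- The action of `R` on frequencies. -/
def freqR : (Fin 3 → ℤ) ≃ (Fin 3 → ℤ) where
  toFun k := ![k 0, k 0 - k 1, -k 2]
  invFun k := ![k 0, k 0 - k 1, -k 2]
  left_inv k := by ext i; fin_cases i <;> simp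
  right_inv k := by ext i; fin_cases i <;> simp

@[simp] theorem freqH_zero (k : Fin 3 → ℤ) : freqH k 0 = k 1 := rfl
@[simp] theorem freqH_one (k : Fin 3 → ℤ) : freqH k 1 = k 1 - k 0 := rfl
@[simp] theorem freqH_two (k : Fin 3 → ℤ) : freqH k 2 = k 2 := rfl
@[simp] theorem freqR_zero (k : Fin 3 → ℤ) : freqR k 0 = k 0 := rfl
@[simp] theorem freqR_one (k : Fin 3 → ℤ) : freqR k 1 = k 0 - k 1 := rfl
@[simp] theorem freqR_two (k : Fin 3 → ℤ) : freqR k 2 = -k 2 := rfl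

theorem freq_isoH (k : Fin 3 → ℤ) (x : E 3) : freq k (isoH x) = freq (freqH k) x := by
  obtain ⟨s, t, u, rfl⟩ := exists_pt x
  rw [acts_isoH, freq_pt, freq_pt]
  simp
  ring

theorem freq_isoH_sq (k : Fin 3 → ℤ) (x : E 3) :
    freq k ((isoH ^ 2) x) = freq ((freqH.trans freqH) k) x := by
  rw [Equiv.trans_apply, ← freq_isoH, ← freq_isoH, pow_two]
  rfl

theorem freq_isoR (k : Fin 3 → ℤ) (x : E 3) : freq k (isoR x) = freq (freqR k) x := by
  obtain ⟨s, t, u, rfl⟩ := exists_pt x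
  rw [acts_isoR, freq_pt, freq_pt]
  simp
  ring

theorem quad_freqH (k : Fin 3 → ℤ) : quad (freqH k) = quad k := by
  simp [quad]
  ring

theorem quad_freqR (k : Fin 3 → ℤ) : quad (freqR k) = quad k := by
  simp [quad]
  ring

/-- The coefficient functions of eigenfunctions on the first orbifold. -/
def IsCoeff₁ (c : ℝ) (a : (Fin 3 → ℤ) → ℂ) : Prop := IsCoeff c a ∧ ∀ k, a (freqH k) = a k

/-- The coefficient functions of eigenfunctions on the second orbifold. -/
def IsCoeff₂ (c : ℝ) (a : (Fin 3 → ℤ) → ℂ) : Prop :=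
  IsCoeff c a ∧ (∀ k, a (freqH (freqH k)) = a k) ∧ ∀ k, a (freqR k) = a k

theorem isCoeff₁_of_mem {c : ℝ} {f : E 3 → ℝ} (hf : f ∈ functionEigenspace Γ₁ c) :
    IsCoeff₁ c (coeff f) := by
  have hp := isPeriodic_of_mem translationGroup_le_Γ₁ hf.1
  exact ⟨isCoeff_coeff hp hf.1.1 hf.2,
    coeff_invariant hp hf.1.1 hf.2 (hf.1.2 _ isoH_mem) freq_isoH⟩

theorem isCoeff₂_of_mem {c : ℝ} {f : E 3 → ℝ} (hf : f ∈ functionEigenspace Γ₂ c) :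
    IsCoeff₂ c (coeff f) := by
  have hp := isPeriodic_of_mem translationGroup_le_Γ₂ hf.1
  have h1 := coeff_invariant hp hf.1.1 hf.2 (hf.1.2 _ isoH_sq_mem) freq_isoH_sq
  have h2 := coeff_invariant hp hf.1.1 hf.2 (hf.1.2 _ isoR_mem) freq_isoR
  refine ⟨isCoeff_coeff hp hf.1.1 hf.2, fun k => ?_, h2⟩
  rw [← h1 k, Equiv.trans_apply]

theorem synth_mem₁ {c : ℝ} {a : (Fin 3 → ℤ) → ℂ} (ha : IsCoeff₁ c a) :
    synth c a ∈ functionEigenspace Γ₁ c := by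
  refine ⟨⟨contDiff_synth c a, fun g hg => invariant_closure ?_ hg⟩, laplacian_synth ha.1⟩
  rintro g (hg | rfl)
  · exact invariant_translationGroup (isPeriodic_synth c a) hg
  · exact synth_invariant freq_isoH quad_freqH ha.2

theorem synth_mem₂ {c : ℝ} {a : (Fin 3 → ℤ) → ℂ} (ha : IsCoeff₂ c a) :
    synth c a ∈ functionEigenspace Γ₂ c := by
  refine ⟨⟨contDiff_synth c a, fun g hg => invariant_closure ?_ hg⟩, laplacian_synth ha.1⟩
  rintro g (hg | rfl | rfl)
  · exact invariant_translationGroup (isPeriodic_synth c a) hg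
  · exact synth_invariant freq_isoH_sq (fun k => by simp [quad_freqH]) ha.2.1
  · exact synth_invariant freq_isoR quad_freqR ha.2.2

/-- A transplantation of coefficients gives an inequality of multiplicities. -/
theorem rank_le_of_transplantation {Γ Γ' : Subgroup (I 3)}
    (hΓ : translationGroup hexLattice ≤ Γ) {c : ℝ}
    (Φ : ((Fin 3 → ℤ) → ℂ) →ₗ[ℝ] ((Fin 3 → ℤ) → ℂ)) {P : ((Fin 3 → ℤ) → ℂ) → Prop}
    (hP : ∀ f ∈ functionEigenspace Γ c, P (coeff f))
    (hΦ : ∀ a, P a → IsCoeff c (Φ a) ∧ synth c (Φ a) ∈ functionEigenspace Γ' c)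
    (hinj : ∀ a, P a → Φ a = 0 → a = 0) :
    Module.rank ℝ (functionEigenspace Γ c) ≤ Module.rank ℝ (functionEigenspace Γ' c) := by
  have hper : ∀ f ∈ functionEigenspace Γ c, IsPeriodic f := fun f hf => isPeriodic_of_mem hΓ hf.1
  have hcont : ∀ f ∈ functionEigenspace Γ c, Continuous f := fun f hf => hf.1.1.continuous
  let C : functionEigenspace Γ c →ₗ[ℝ] ((Fin 3 → ℤ) → ℂ) :=
    { toFun := fun f => coeff f
      map_add' := fun f g => funext fun k =>
        coeff_add (hper _ f.2) (hcont _ f.2) (hper _ g.2) (hcont _ g.2) k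
      map_smul' := fun r f => funext fun k => by
        simpa using coeff_smul r f k }
  let L := ((synth c).comp (Φ.comp C)).codRestrict (functionEigenspace Γ' c)
    fun f => (hΦ _ (hP f f.2)).2
  refine LinearMap.rank_le_of_injective L ?_
  rw [injective_iff_map_eq_zero]
  intro f hf
  have h1 : synth c (Φ (coeff f)) = 0 := congrArg Subtype.val hf
  have hP1 := hP f f.2
  -- The coefficients of a synthesised function are the given ones, so injectivity can be tested on
  -- the transplanted coefficients.
  have h2 := coeff_synth (hΦ _ hP1).1
  have hzero : coeff (0 : E 3 → ℝ) = 0 := by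
    ext k
    simpa using coeff_smul 0 0 k
  rw [h1, hzero] at h2
  have h3 := hinj _ hP1 h2.symm
  ext1
  exact eq_of_coeff_eq (hper f f.2) (hcont f f.2) (fun _ _ _ => rfl) continuous_const
    (h3.trans hzero.symm)

/-! ### Transplantation of eigenfunctions -/

/-- A cubic polynomial that is odd under `freqH` and `freqR`. -/
def polyP (k : Fin 3 → ℤ) : ℤ := (k 0 - 2 * k 1) * (k 1 - 2 * k 0) * (k 0 + k 1)

/-- A quartic polynomial that is odd under `freqH` and `freqR`. -/
def polyQ (k : Fin 3 → ℤ) : ℤ := k 2 * k 0 * k 1 * (k 0 - k 1)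

/-- The multiplier of the transplantation. -/
def factor (k : Fin 3 → ℤ) : ℂ := ⟨polyQ k, polyP k⟩

theorem factor_eq_zero {k : Fin 3 → ℤ} : factor k = 0 ↔ polyQ k = 0 ∧ polyP k = 0 := by
  simp [factor, Complex.ext_iff]

/-- The real part has even degree and the imaginary part odd degree; this is what keeps transplanted
functions real. -/
theorem factor_neg (k : Fin 3 → ℤ) : factor (-k) = (starRingEnd ℂ) (factor k) := by
  apply Complex.ext
  · simp [factor, polyQ]; ring
  · simp [factor, polyP]; ring

theorem factor_freqH (k : Fin 3 → ℤ) : factor (freqH k) = -factor k := by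
  apply Complex.ext
  · simp [factor, polyQ]; ring
  · simp [factor, polyP]; ring

theorem factor_freqR (k : Fin 3 → ℤ) : factor (freqR k) = -factor k := by
  apply Complex.ext
  · simp [factor, polyQ]; ring
  · simp [factor, polyP]; ring

theorem polyP_eq_zero {k : Fin 3 → ℤ} :
    polyP k = 0 ↔ k 0 = 2 * k 1 ∨ k 1 = 2 * k 0 ∨ k 1 = -k 0 := by
  simp only [polyP, mul_eq_zero]
  omega

/-- Apart from k₂ = 0, the first polynomial vanishes on three lines of the plane and the second on
three others, which meet only at the origin. -/
theorem factor_eq_zero_cases {k : Fin 3 → ℤ} (h : factor k = 0) :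
    (k 0 = 0 ∧ k 1 = 0) ∨
      k 2 = 0 ∧ (k 0 = 2 * k 1 ∨ k 1 = 2 * k 0 ∨ k 1 = -k 0) := by
  obtain ⟨h1, h2⟩ := factor_eq_zero.1 h
  rw [polyP_eq_zero] at h2
  simp only [polyQ, mul_eq_zero] at h1
  omega

/-- The multiplication of `b` by the multiplier, with the zeros of the multiplier satisfying `C`
filled by the values of `b` along `τ`. -/
def twist (C : (Fin 3 → ℤ) → Prop) [DecidablePred C] (τ : (Fin 3 → ℤ) → Fin 3 → ℤ)
    (b : (Fin 3 → ℤ) → ℂ) (k : Fin 3 → ℤ) : ℂ :=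
  if factor k ≠ 0 then factor k * b k else if C k then b (τ k) else 0

/-- The odd part under `σ`. -/
def oddPart (σ : (Fin 3 → ℤ) → Fin 3 → ℤ) (a : (Fin 3 → ℤ) → ℂ) (k : Fin 3 → ℤ) : ℂ :=
  (a k - a (σ k)) / 2

/-- The transplantation of coefficients: the identity on the `σ`-even part and `twist` on the
`σ`-odd part. -/
def transplant (σ : (Fin 3 → ℤ) → Fin 3 → ℤ) (C : (Fin 3 → ℤ) → Prop) [DecidablePred C]
    (τ : (Fin 3 → ℤ) → Fin 3 → ℤ) : ((Fin 3 → ℤ) → ℂ) →ₗ[ℝ] ((Fin 3 → ℤ) → ℂ) where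
  toFun a k := (a k + a (σ k)) / 2 + twist C τ (oddPart σ a) k
  map_add' a b := by
    ext k
    simp only [twist, oddPart, Pi.add_apply]
    split_ifs <;> ring
  map_smul' r a := by
    ext k
    simp only [twist, oddPart, Pi.smul_apply, Complex.real_smul, RingHom.id_apply]
    split_ifs <;> ring

theorem transplant_apply (σ : (Fin 3 → ℤ) → Fin 3 → ℤ) (C : (Fin 3 → ℤ) → Prop)
    [DecidablePred C] (τ : (Fin 3 → ℤ) → Fin 3 → ℤ) (a : (Fin 3 → ℤ) → ℂ) (k : Fin 3 → ℤ) :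
    transplant σ C τ a k =
      (a k + a (σ k)) / 2 + twist C τ (oddPart σ a) k := rfl

theorem isCoeff_twist {C : (Fin 3 → ℤ) → Prop} [DecidablePred C] {τ : (Fin 3 → ℤ) → Fin 3 → ℤ}
    (hC : ∀ k, C (-k) ↔ C k) (hτ : ∀ k, factor k = 0 → C k → τ (-k) = -τ k)
    (hq : ∀ k, factor k = 0 → C k → quad (τ k) = quad k)
    {c : ℝ} {b : (Fin 3 → ℤ) → ℂ} (hb : IsCoeff c b) : IsCoeff c (twist C τ b) := by
  refine ⟨fun k hk => ?_, fun k => ?_⟩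
  · simp only [twist]
    split_ifs with h1 h2
    · rw [hb.1 k hk, mul_zero]
    · rw [not_not] at h1
      refine hb.1 _ ?_
      rwa [eigen, hq k h1 h2]
    · rfl
  · simp only [twist, factor_neg, hC, ne_eq, map_eq_zero]
    split_ifs with h1 h2
    · rw [hτ k h1 h2, hb.2]
    · rw [map_zero]
    · rw [map_mul, hb.2]

/-- With r = 1 and r = -1 this covers the even and the odd part. -/
theorem isCoeff_comp {σ : (Fin 3 → ℤ) → Fin 3 → ℤ} (hσ : ∀ k, σ (-k) = -σ k)
    (hq : ∀ k, quad (σ k) = quad k) {c : ℝ} {a : (Fin 3 → ℤ) → ℂ} (ha : IsCoeff c a) (r : ℝ) :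
    IsCoeff c (fun k => (a k + r * a (σ k)) / 2) := by
  refine ⟨fun k hk => ?_, fun k => ?_⟩
  · have h2 : a (σ k) = 0 := ha.1 _ (by rwa [eigen, hq])
    simp only [ha.1 k hk, h2]
    simp
  · simp only [hσ, ha.2]
    rw [map_div₀, map_add, map_mul, Complex.conj_ofReal, map_ofNat]

theorem isCoeff_transplant {σ : (Fin 3 → ℤ) → Fin 3 → ℤ} {C : (Fin 3 → ℤ) → Prop}
    [DecidablePred C] {τ : (Fin 3 → ℤ) → Fin 3 → ℤ} (hσ : ∀ k, σ (-k) = -σ k)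
    (hqσ : ∀ k, quad (σ k) = quad k)
    (hC : ∀ k, C (-k) ↔ C k) (hτ : ∀ k, factor k = 0 → C k → τ (-k) = -τ k)
    (hq : ∀ k, factor k = 0 → C k → quad (τ k) = quad k)
    {c : ℝ} {a : (Fin 3 → ℤ) → ℂ} (ha : IsCoeff c a) : IsCoeff c (transplant σ C τ a) := by
  have h1 := isCoeff_comp hσ hqσ ha 1
  have h2 := isCoeff_comp hσ hqσ ha (-1)
  have h3 : (fun k => (a k + ((-1 : ℝ) : ℂ) * a (σ k)) / 2) = oddPart σ a := by
    ext k
    rw [oddPart]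
    push_cast
    ring
  have h4 : (fun k => (a k + ((1 : ℝ) : ℂ) * a (σ k)) / 2) = fun l => (a l + a (σ l)) / 2 := by
    ext k
    push_cast
    ring
  rw [h3] at h2
  rw [h4] at h1
  have h5 := isCoeff_twist hC hτ hq h2
  refine ⟨fun k hk => ?_, fun k => ?_⟩
  · exact (congrArg₂ (· + ·) (h1.1 k hk) (h5.1 k hk)).trans (add_zero 0)
  · rw [transplant_apply, transplant_apply, map_add, h5.2 k, ← h1.2 k]

theorem freqH_neg (k : Fin 3 → ℤ) : freqH (-k) = -freqH k := by
  ext i; fin_cases i <;> simp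
  ring

theorem freqR_neg (k : Fin 3 → ℤ) : freqR (-k) = -freqR k := by
  ext i; fin_cases i <;> simp
  ring

theorem freqH_freqR_freqH (k : Fin 3 → ℤ) : freqH (freqR (freqH k)) = freqR k := by
  ext i; fin_cases i <;> simp

theorem freqR_freqR (k : Fin 3 → ℤ) : freqR (freqR k) = k := by
  ext i; fin_cases i <;> simp

theorem freqH_cube (k : Fin 3 → ℤ) : freqH (freqH (freqH k)) = ![-k 0, -k 1, k 2] := by
  ext i; fin_cases i <;> simp
  ring

/-- The length along the axis of a frequency in the plane with vanishing `polyP`. -/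
def axial (k : Fin 3 → ℤ) : ℤ := if k 0 = 2 * k 1 then k 1 else -k 0

theorem axial_neg (k : Fin 3 → ℤ) : axial (-k) = -axial k := by
  simp only [axial, Pi.neg_apply]
  split_ifs <;> omega

theorem axial_freqH {k : Fin 3 → ℤ} (h : polyP k = 0) : axial (freqH k) = -axial k := by
  rw [polyP_eq_zero] at h
  simp only [axial, freqH_zero, freqH_one]
  split_ifs <;> omega

theorem axial_freqR (k : Fin 3 → ℤ) : axial (freqR k) = axial k := by
  simp only [axial, freqR_zero, freqR_one]
  split_ifs <;> omega

/-- On the three lines `quad k` is three times the square of `axial k`, like at a vertical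
frequency; so the exchange preserves eigenvalues. -/
theorem quad_axial {k : Fin 3 → ℤ} (h : polyP k = 0) (h2 : k 2 = 0) :
    quad ![0, 0, axial k] = quad k := by
  rw [polyP_eq_zero] at h
  simp only [quad, axial, h2]
  simp
  split_ifs with h0
  · rw [h0]; ring
  · rcases h with h | h | h
    · exact absurd h h0
    · rw [h]; ring
    · rw [h]; ring

/-! #### From the first orbifold to the second -/

/-- The odd part of the transplantation from the first orbifold to the second. -/
abbrev twist₁ : ((Fin 3 → ℤ) → ℂ) → (Fin 3 → ℤ) → ℂ :=
  twist (fun k => k 2 = 0) fun k => ![0, 0, axial k]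

/-- The transplantation of coefficients from the first orbifold to the second. -/
abbrev transplant₁ : ((Fin 3 → ℤ) → ℂ) →ₗ[ℝ] ((Fin 3 → ℤ) → ℂ) :=
  transplant freqR (fun k => k 2 = 0) fun k => ![0, 0, axial k]

theorem transplant₁_apply (a : (Fin 3 → ℤ) → ℂ) (k : Fin 3 → ℤ) :
    transplant₁ a k = (a k + a (freqR k)) / 2 + twist₁ (oddPart freqR a) k := rfl

/-- Type (+,-) becomes type (-,+). Away from the zeros the sign comes from `factor`; at the zeros it
arises because `freqH` reverses `axial` and b is odd along the vertical axis. -/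
theorem twist₁_freqH {b : (Fin 3 → ℤ) → ℂ} (hH : ∀ k, b (freqH k) = b k)
    (hR : ∀ k, b (freqR k) = -b k) (k : Fin 3 → ℤ) : twist₁ b (freqH k) = -twist₁ b k := by
  by_cases h1 : factor k = 0
  · by_cases h2 : k 2 = 0
    · have h3 : (![0, 0, -axial k] : Fin 3 → ℤ) = freqR ![0, 0, axial k] := by
        ext i; fin_cases i <;> simp
      simp [twist, factor_freqH, h1, h2, axial_freqH (factor_eq_zero.1 h1).2, h3, hR]
    · simp [twist, factor_freqH, h1, h2]
  · simp [twist, factor_freqH, h1, hH]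

theorem twist₁_freqR {b : (Fin 3 → ℤ) → ℂ} (hR : ∀ k, b (freqR k) = -b k) (k : Fin 3 → ℤ) :
    twist₁ b (freqR k) = twist₁ b k := by
  by_cases h1 : factor k = 0
  · simp [twist, factor_freqR, h1, axial_freqR]
  · simp [twist, factor_freqR, h1, hR]

/-- Vertical values of b reappear at (2m, m, 0). On the three horizontal lines nothing is lost:
rotated onto the first line the frequency is fixed by `freqR`, so the odd function b vanishes there.
-/
theorem eq_zero_of_twist₁ {b : (Fin 3 → ℤ) → ℂ} (hH : ∀ k, b (freqH k) = b k)
    (hR : ∀ k, b (freqR k) = -b k) (h : ∀ k, twist₁ b k = 0) (k : Fin 3 → ℤ) : b k = 0 := by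
  by_cases hk : factor k = 0
  · rcases factor_eq_zero_cases hk with ⟨h0, h1⟩ | ⟨h2, h3⟩
    · have h4 := h ![2 * k 2, k 2, 0]
      have h5 : factor ![2 * k 2, k 2, 0] = 0 := factor_eq_zero.2 ⟨by simp [polyQ], by simp [polyP]⟩
      have h6 : (![0, 0, k 2] : Fin 3 → ℤ) = k := by
        ext i; fin_cases i <;> simp [h0, h1]
      simpa [twist, h5, axial, h6] using h4
    · have fixed : ∀ l : Fin 3 → ℤ, l 2 = 0 → l 0 = 2 * l 1 → b l = 0 := by
        intro l h4 h5
        have h6 := hR l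
        have h7 : freqR l = l := by
          ext i; fin_cases i <;> simp <;> omega
        rw [h7] at h6
        exact self_eq_neg.1 h6
      rcases h3 with h3 | h3 | h3
      · exact fixed k h2 h3
      · rw [← hH]
        exact fixed _ h2 (by simp; omega)
      · rw [← hH, ← hH]
        exact fixed _ h2 (by simp; omega)
  · have h1 := h k
    simpa [twist, hk] using h1

/-- By the dihedral relation `freqH` ∘ `freqR` ∘ `freqH` = `freqR`, composition with `freqR`
preserves `freqH`-invariance. -/
theorem odd_part₁ {a : (Fin 3 → ℤ) → ℂ} (ha : ∀ k, a (freqH k) = a k) (k : Fin 3 → ℤ) :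
    a (freqR (freqH k)) = a (freqR k) := by
  rw [← ha (freqR (freqH k)), freqH_freqR_freqH]

theorem rank_le₁₂ (c : ℝ) :
    Module.rank ℝ (functionEigenspace Γ₁ c) ≤ Module.rank ℝ (functionEigenspace Γ₂ c) := by
  have hbH : ∀ a, IsCoeff₁ c a → ∀ k, oddPart freqR a (freqH k) = oddPart freqR a k :=
    fun a ha k => by rw [oddPart, oddPart, odd_part₁ ha.2, ha.2]
  have hbR : ∀ (a : (Fin 3 → ℤ) → ℂ) (k), oddPart freqR a (freqR k) = -oddPart freqR a k :=
    fun a k => by rw [oddPart, oddPart, freqR_freqR]; ring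
  refine rank_le_of_transplantation translationGroup_le_Γ₁
    transplant₁ (P := IsCoeff₁ c)
    (fun f hf => isCoeff₁_of_mem hf) (fun a ha => ?_) fun a ha h => ?_
  · have key : IsCoeff₂ c (transplant₁ a) := by
      refine ⟨isCoeff_transplant freqR_neg quad_freqR (fun k => by simp) ?_ ?_ ha.1, fun k => ?_,
        fun k => ?_⟩
      · intro k _ _
        rw [axial_neg]
        ext i; fin_cases i <;> simp
      · exact fun k h1 h2 => quad_axial (factor_eq_zero.1 h1).2 h2
      · have h1 := twist₁_freqH (hbH a ha) (hbR a)
        rw [transplant₁_apply, transplant₁_apply, h1, h1, neg_neg, odd_part₁ ha.2, odd_part₁ ha.2,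
          ha.2, ha.2]
      · have h1 := twist₁_freqR (hbR a)
        rw [transplant₁_apply, transplant₁_apply, h1, freqR_freqR, add_comm (a (freqR k))]
    exact ⟨key.1, synth_mem₂ key⟩
  · have h1 : ∀ k, (a k + a (freqR k)) / 2 + twist₁ (oddPart freqR a) k = 0 :=
      fun k => congrFun h k
    -- The even part is invariant under `freqH` and the twisted part changes sign, so both vanish
    -- separately.
    have h2 : ∀ k, (a k + a (freqR k)) / 2 - twist₁ (oddPart freqR a) k = 0 := by
      intro k
      have h3 := h1 (freqH k)
      rwa [twist₁_freqH (hbH a ha) (hbR a), odd_part₁ ha.2, ha.2, ← sub_eq_add_neg] at h3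
    have h3 := eq_zero_of_twist₁ (hbH a ha) (hbR a) fun k => by
      linear_combination (h1 k - h2 k) / 2
    ext k
    have h4 := h3 k
    rw [oddPart] at h4
    rw [Pi.zero_apply]
    linear_combination h4 + (h1 k + h2 k) / 2

/-! #### From the second orbifold to the first -/

/-- The odd part of the transplantation from the second orbifold to the first. -/
abbrev twist₂ : ((Fin 3 → ℤ) → ℂ) → (Fin 3 → ℤ) → ℂ :=
  twist (fun k => k 0 = 0 ∧ k 1 = 0) fun k => ![2 * k 2, k 2, 0]

/-- The transplantation of coefficients from the second orbifold to the first. -/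
abbrev transplant₂ : ((Fin 3 → ℤ) → ℂ) →ₗ[ℝ] ((Fin 3 → ℤ) → ℂ) :=
  transplant freqH (fun k => k 0 = 0 ∧ k 1 = 0) fun k => ![2 * k 2, k 2, 0]

theorem transplant₂_apply (a : (Fin 3 → ℤ) → ℂ) (k : Fin 3 → ℤ) :
    transplant₂ a k = (a k + a (freqH k)) / 2 + twist₂ (oddPart freqH a) k := rfl

theorem twist₂_freqH {b : (Fin 3 → ℤ) → ℂ} (hH : ∀ k, b (freqH k) = -b k) (k : Fin 3 → ℤ) :
    twist₂ b (freqH k) = twist₂ b k := by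
  have h0 : (k 1 = 0 ∧ k 1 - k 0 = 0) ↔ (k 0 = 0 ∧ k 1 = 0) := by omega
  simp only [twist, factor_freqH, ne_eq, neg_eq_zero, freqH_zero, freqH_one, freqH_two, h0, hH,
    neg_mul_neg]

theorem twist₂_freqR {b : (Fin 3 → ℤ) → ℂ} (hH : ∀ k, b (freqH k) = -b k)
    (hR : ∀ k, b (freqR k) = b k) (k : Fin 3 → ℤ) : twist₂ b (freqR k) = -twist₂ b k := by
  have h0 : (k 0 = 0 ∧ k 0 - k 1 = 0) ↔ (k 0 = 0 ∧ k 1 = 0) := by omega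
  simp only [twist, factor_freqR, ne_eq, neg_eq_zero, freqR_zero, freqR_one, freqR_two, h0, hR]
  split_ifs with h1 h2
  -- The cube of `freqH` is -1 on the plane, and b changes sign under each of the three factors.
  · have h3 : (![2 * -k 2, -k 2, 0] : Fin 3 → ℤ) = freqH (freqH (freqH ![2 * k 2, k 2, 0])) := by
      rw [freqH_cube]
      ext i; fin_cases i <;> simp
    rw [h3, hH, hH, hH, neg_neg]
  · rw [neg_zero]
  · rw [neg_mul]

/-- The roles are exchanged: vertical frequencies are fixed by `freqH`, under which b is odd, while
the values on the horizontal lines are recovered at vertical frequencies. -/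
theorem eq_zero_of_twist₂ {b : (Fin 3 → ℤ) → ℂ} (hH : ∀ k, b (freqH k) = -b k)
    (h : ∀ k, twist₂ b k = 0) (k : Fin 3 → ℤ) : b k = 0 := by
  by_cases hk : factor k = 0
  · rcases factor_eq_zero_cases hk with ⟨h0, h1⟩ | ⟨h2, h3⟩
    · have h4 := hH k
      have h5 : freqH k = k := by
        ext i; fin_cases i <;> simp [h0, h1]
      rw [h5] at h4
      exact self_eq_neg.1 h4
    · have fixed : ∀ l : Fin 3 → ℤ, l 2 = 0 → l 0 = 2 * l 1 → b l = 0 := by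
        intro l h4 h5
        have h6 := h ![0, 0, l 1]
        have h7 : factor ![0, 0, l 1] = 0 := factor_eq_zero.2 ⟨by simp [polyQ], by simp [polyP]⟩
        have h8 : (![2 * l 1, l 1, 0] : Fin 3 → ℤ) = l := by
          ext i; fin_cases i <;> simp [h4, h5]
        simpa [twist, h7, h8] using h6
      rcases h3 with h3 | h3 | h3
      · exact fixed k h2 h3
      · rw [← neg_eq_zero, ← hH]
        exact fixed _ h2 (by simp; omega)
      · rw [← neg_neg (b k), ← hH, ← hH]
        exact fixed _ h2 (by simp; omega)
  · have h1 := h k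
    simpa [twist, hk] using h1

theorem odd_part₂ {a : (Fin 3 → ℤ) → ℂ} (ha : ∀ k, a (freqH (freqH k)) = a k)
    (hR : ∀ k, a (freqR k) = a k) (k : Fin 3 → ℤ) : a (freqH (freqR k)) = a (freqH k) := by
  rw [← hR (freqH k), ← freqH_freqR_freqH k, ha]

theorem rank_le₂₁ (c : ℝ) :
    Module.rank ℝ (functionEigenspace Γ₂ c) ≤ Module.rank ℝ (functionEigenspace Γ₁ c) := by
  have hbH : ∀ a, IsCoeff₂ c a → ∀ k, oddPart freqH a (freqH k) = -oddPart freqH a k :=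
    fun a ha k => by rw [oddPart, oddPart, ha.2.1]; ring
  have hbR : ∀ a, IsCoeff₂ c a → ∀ k, oddPart freqH a (freqR k) = oddPart freqH a k :=
    fun a ha k => by rw [oddPart, oddPart, odd_part₂ ha.2.1 ha.2.2, ha.2.2]
  refine rank_le_of_transplantation translationGroup_le_Γ₂
    transplant₂ (P := IsCoeff₂ c)
    (fun f hf => isCoeff₂_of_mem hf) (fun a ha => ?_) fun a ha h => ?_
  · have key : IsCoeff₁ c
        (transplant₂ a) := by
      refine ⟨isCoeff_transplant freqH_neg quad_freqH (fun k => by simp) ?_ ?_ ha.1, fun k => ?_⟩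
      · intro k _ _
        ext i; fin_cases i <;> simp
      · rintro k - ⟨h1, h2⟩
        simp [quad, h1, h2]
        ring
      · have h1 := twist₂_freqH (hbH a ha)
        rw [transplant₂_apply, transplant₂_apply, h1, ha.2.1, add_comm (a (freqH k))]
    exact ⟨key.1, synth_mem₁ key⟩
  · have h1 : ∀ k, (a k + a (freqH k)) / 2 + twist₂ (oddPart freqH a) k = 0 :=
      fun k => congrFun h k
    have h2 : ∀ k, (a k + a (freqH k)) / 2 - twist₂ (oddPart freqH a) k = 0 := by
      intro k
      have h3 := h1 (freqR k)
      rwa [twist₂_freqR (hbH a ha) (hbR a ha), odd_part₂ ha.2.1 ha.2.2, ha.2.2,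
        ← sub_eq_add_neg] at h3
    have h3 := eq_zero_of_twist₂ (hbH a ha) fun k => by
      linear_combination (h1 k - h2 k) / 2
    ext k
    have h4 := h3 k
    rw [oddPart] at h4
    rw [Pi.zero_apply]
    linear_combination h4 + (h1 k + h2 k) / 2

theorem isospectralOnFunctions_Γ₁_Γ₂ : IsospectralOnFunctions Γ₁ Γ₂ :=
  fun c => le_antisymm (rank_le₁₂ c) (rank_le₂₁ c)

/-! ### Harmonic 1-forms -/

theorem contDiff_component {n k : ℕ} {α : Form n k} (h : ContDiff ℝ ∞ α) (v : Fin k → E n) :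
    ContDiff ℝ ∞ fun y => α y v :=
  ((ContinuousAlternatingMap.apply ℝ (E n) ℝ v).contDiff).comp h

theorem fderiv_component {n k : ℕ} {α : Form n k} (h : ContDiff ℝ ∞ α) (v : Fin k → E n)
    (x w : E n) : fderiv ℝ α x w v = fderiv ℝ (fun y => α y v) x w :=
  (fderiv_continuousAlternatingMap_apply_const_apply ((h.differentiable (by simp)) x) v w).symm

theorem codiff_one_apply {n : ℕ} {α : Form n 1} (h : ContDiff ℝ ∞ α) (x : E n)
    (v : Fin 0 → E n) : codiff α x v =
      -∑ i, fderiv ℝ (fun y => α y fun _ => EuclideanSpace.single i 1) x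
        (EuclideanSpace.single i 1) := by
  have h1 : ∀ w : E n, Matrix.vecCons w v = fun _ => w := fun w => by
    ext1 j
    rw [Subsingleton.elim j 0]
    rfl
  rw [codiff, ContinuousAlternatingMap.neg_apply, ContinuousAlternatingMap.sum_apply]
  simp only [ContinuousAlternatingMap.curryLeft_apply_apply, h1, fderiv_component h]

theorem extDeriv_zero_apply {n : ℕ} {β : Form n 0} (h : ContDiff ℝ ∞ β) (x w : E n)
    (v : Fin 0 → E n) : extDeriv β x (fun _ => w) = fderiv ℝ (fun y => β y v) x w := by
  rw [extDeriv, ContinuousAlternatingMap.alternatizeUncurryFin_apply, Fin.sum_univ_one,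
    fderiv_component h, Subsingleton.elim (Fin.removeNth 0 fun _ => w) v]
  simp

theorem extDeriv_one_apply {n : ℕ} {α : Form n 1} (h : ContDiff ℝ ∞ α) (x u w : E n) :
    extDeriv α x ![u, w] =
      fderiv ℝ (fun y => α y fun _ => w) x u - fderiv ℝ (fun y => α y fun _ => u) x w := by
  have h1 : Fin.removeNth 0 ![u, w] = fun _ => w := by
    ext1 j
    rw [Subsingleton.elim j 0]
    rfl
  have h2 : Fin.removeNth 1 ![u, w] = fun _ => u := by
    ext1 j
    rw [Subsingleton.elim j 0]
    rfl
  rw [extDeriv, ContinuousAlternatingMap.alternatizeUncurryFin_apply, Fin.sum_univ_two, h1, h2,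
    fderiv_component h, fderiv_component h]
  simp [sub_eq_add_neg]

theorem fderiv_fderiv_comm {n : ℕ} {f : E n → ℝ} (h : ContDiff ℝ ∞ f) (x u w : E n) :
    fderiv ℝ (fun y => fderiv ℝ f y u) x w = fderiv ℝ (fun y => fderiv ℝ f y w) x u := by
  have h1 : ContDiff ℝ ∞ (fderiv ℝ f) := h.fderiv_right (by simp)
  have h2 := (h1.differentiable (by simp)) x
  have h3 : ∀ a b, fderiv ℝ (fun y => fderiv ℝ f y a) x b = fderiv ℝ (fderiv ℝ f) x b a := by
    intro a b
    rw [fderiv_clm_apply h2 (differentiableAt_const a)]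
    simp
  rw [h3, h3]
  exact (h.contDiffAt.isSymmSndFDerivAt (by simp; norm_cast)) w u

/-- On 1-forms of euclidean space the Laplace operator acts on each component. -/
theorem hodgeLaplacian_one_apply {n : ℕ} {α : Form n 1} (h : ContDiff ℝ ∞ α) (x w : E n) :
    hodgeLaplacian α x (fun _ => w) =
      -∑ i, fderiv ℝ (fun y => fderiv ℝ (fun z => α z fun _ => w) y (EuclideanSpace.single i 1)) x
        (EuclideanSpace.single i 1) := by
  have hd : ∀ (u v : E n), DifferentiableAt ℝ
      (fun y => fderiv ℝ (fun z => α z fun _ => u) y v) x := fun u v => by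
    have h1 : ContDiff ℝ ∞ (fderiv ℝ fun z => α z fun _ => u) :=
      (contDiff_component h _).fderiv_right (by simp)
    exact ((h1.clm_apply contDiff_const).differentiable (by simp)) x
  have h1 : ∀ u : E n, Matrix.vecCons u (fun _ : Fin 1 => w) = ![u, w] := fun u => by
    ext1 j
    fin_cases j <;> rfl
  have h2 : extDeriv (codiff α) x (fun _ => w) =
      -∑ i, fderiv ℝ (fun y => fderiv ℝ (fun z => α z fun _ => EuclideanSpace.single i 1) y
        (EuclideanSpace.single i 1)) x w := by
    rw [extDeriv_zero_apply (contDiff_codiff h) x w Fin.elim0]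
    simp only [codiff_one_apply h]
    rw [fderiv_fun_neg, fderiv_fun_sum fun i _ => hd _ _]
    simp
  have h3 : codiff (extDeriv α) x (fun _ => w) = -∑ i,
      (fderiv ℝ (fun y => fderiv ℝ (fun z => α z fun _ => w) y (EuclideanSpace.single i 1)) x
        (EuclideanSpace.single i 1) -
      fderiv ℝ (fun y => fderiv ℝ (fun z => α z fun _ => EuclideanSpace.single i 1) y w) x
        (EuclideanSpace.single i 1)) := by
    rw [codiff, ContinuousAlternatingMap.neg_apply, ContinuousAlternatingMap.sum_apply]
    simp only [ContinuousAlternatingMap.curryLeft_apply_apply, h1,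
      fderiv_component (contDiff_extDeriv h), extDeriv_one_apply h]
    congr 1
    refine Finset.sum_congr rfl fun i _ => ?_
    rw [fderiv_fun_sub (hd _ _) (hd _ _)]
    rfl
  change extDeriv (codiff α) x (fun _ => w) + codiff (extDeriv α) x (fun _ => w) = _
  rw [h2, h3, Finset.sum_sub_distrib]
  -- The mixed second derivatives from d d* and d* d cancel by symmetry.
  simp only [fderiv_fderiv_comm (contDiff_component h _) x w]
  ring

theorem hasFDerivAt_isometry {n : ℕ} (g : I n) (x : E n) :
    HasFDerivAt g (g.linearIsometryEquiv.toContinuousLinearEquiv : E n →L[ℝ] E n) x := by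
  have h : ∀ y, g y = g.linearIsometryEquiv y + g 0 := fun y => by
    simpa using g.map_vadd 0 y
  have h1 := (g.linearIsometryEquiv.toContinuousLinearEquiv : E n →L[ℝ] E n).hasFDerivAt (x := x)
  exact (h1.add_const (g 0)).congr_of_eventuallyEq (Filter.Eventually.of_forall h)

/-- The derivative is the linear part, written through values of g so that lattice coordinates
apply. -/
theorem fderiv_isometry_apply {n : ℕ} (g : I n) (x w : E n) : fderiv ℝ g x w = g w - g 0 := by
  rw [(hasFDerivAt_isometry g x).fderiv, eq_sub_iff_add_eq]
  simpa using (g.map_vadd 0 w).symm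

theorem eq_pt_zero : (0 : E 3) = pt 0 0 0 := by
  rw [pt_zero]

theorem hodgeLaplacian_const {n : ℕ} (η : E n [⋀^Fin 1]→L[ℝ] ℝ) :
    hodgeLaplacian (fun _ => η : Form n 1) = 0 := by
  ext x v
  have hv : v = fun _ => v 0 := by
    ext1 j
    rw [Subsingleton.elim j 0]
  rw [hv, hodgeLaplacian_one_apply contDiff_const]
  simp

/-- The constant 1-form `dx₃`. -/
def verticalForm : Form 3 1 := fun _ =>
  ContinuousAlternatingMap.ofSubsingleton ℝ (E 3) ℝ (0 : Fin 1) (EuclideanSpace.proj (2 : Fin 3))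

theorem verticalForm_apply (x : E 3) (v : Fin 1 → E 3) : verticalForm x v = v 0 2 := rfl

theorem Acts.vertical_sub {g : I 3} {m n p q a b c : ℤ} (hg : Acts g m n p q 1 a b c) (w : E 3) :
    (g w - g 0) 2 = w 2 := by
  obtain ⟨s, t, u, rfl⟩ := exists_pt w
  rw [eq_pt_zero, hg, hg, pt_sub]
  simp [pt]

theorem verticalForm_mem : verticalForm ∈ formEigenspace 1 Γ₁ 0 := by
  refine ⟨⟨contDiff_const, fun g hg x => ?_⟩, ?_⟩
  · ext v
    rw [ContinuousAlternatingMap.compContinuousLinearMap_apply, verticalForm_apply,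
      verticalForm_apply, Function.comp_apply, fderiv_isometry_apply]
    obtain ⟨a, b, c, h | h | h | h | h | h⟩ := mem_Γ₁.1 hg <;> exact h.vertical_sub _
  · rw [zero_smul]
    exact hodgeLaplacian_const _

theorem eigen_eq_zero {k : Fin 3 → ℤ} (h : eigen k = 0) : k = 0 := by
  have h1 : quad k = 0 := by
    have : (quad k : ℝ) = 0 := by
      have hpi := Real.pi_ne_zero
      simpa [eigen, hpi] using h
    exact_mod_cast this
  have h2 : 4 * quad k = (2 * k 0 - k 1) ^ 2 + 3 * k 1 ^ 2 + 12 * k 2 ^ 2 := by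
    rw [quad]; ring
  have h3 : k 2 = 0 := by nlinarith [sq_nonneg (2 * k 0 - k 1), sq_nonneg (k 1), sq_nonneg (k 2)]
  have h4 : k 1 = 0 := by nlinarith [sq_nonneg (2 * k 0 - k 1), sq_nonneg (k 1), sq_nonneg (k 2)]
  have h5 : k 0 = 0 := by nlinarith [sq_nonneg (2 * k 0 - k 1), sq_nonneg (k 1), sq_nonneg (k 2)]
  ext i
  fin_cases i
  · exact h5
  · exact h4
  · exact h3

/-- Periodic harmonic functions are constant. -/
theorem eq_of_harmonic {f : E 3 → ℝ} (hf : IsPeriodic f) (hc : ContDiff ℝ ∞ f)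
    (h : Laplacian.laplacian f = 0) (x y : E 3) : f x = f y := by
  have h0 : -(Laplacian.laplacian f) = (0 : ℝ) • f := by rw [h, neg_zero, zero_smul]
  have h1 := fun z => eq_sum_coeff hf hc.continuous {0} (fun k hk =>
    coeff_eq_zero hf hc h0 fun h2 => hk (Finset.mem_singleton.2 (eigen_eq_zero h2))) z
  have hw : ∀ z, wave 0 z = 1 := fun z => by
    obtain ⟨s, t, u, rfl⟩ := exists_pt z
    simp [wave, freq_pt]
  have h2 : (f x : ℂ) = f y := by
    rw [h1, h1, Finset.sum_singleton, Finset.sum_singleton, hw, hw]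
  exact_mod_cast h2

/-- Each component of a harmonic form is periodic and harmonic, hence constant. What remains is a
linear form invariant under `H²` and `R`, which has to vanish. -/
theorem formEigenspace_Γ₂ : formEigenspace 1 Γ₂ 0 = ⊥ := by
  refine (Submodule.eq_bot_iff _).2 fun α hα => ?_
  obtain ⟨⟨hc, hinv⟩, hα⟩ := hα
  have hinv' : ∀ g ∈ Γ₂, ∀ x w, α (g x) (fun _ => g w - g 0) = α x fun _ => w := by
    intro g hg x w
    rw [← hinv g hg x, ContinuousAlternatingMap.compContinuousLinearMap_apply]
    congr 1
    ext1 _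
    exact (fderiv_isometry_apply g x w).symm
  have hconst : ∀ x y w, α x (fun _ => w) = α y fun _ => w := by
    intro x y w
    refine eq_of_harmonic (f := fun z => α z fun _ => w) ?_ (contDiff_component hc _) ?_ x y
    · intro v hv z
      have h1 := hinv' _ (translationGroup_le_Γ₂ (trans_mem hv)) z w
      simp only [trans, AffineIsometryEquiv.coe_constVAdd, vadd_eq_add, add_zero,
        add_sub_cancel_left] at h1
      rwa [add_comm] at h1
    · ext z
      have h1 := hodgeLaplacian_one_apply hc z w
      rw [hα, zero_smul] at h1
      rw [laplacian_eq_sum (contDiff_component hc _), Pi.zero_apply, ← neg_eq_zero, ← h1]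
      rfl
  let ℓ : E 3 →L[ℝ] ℝ := (ContinuousAlternatingMap.ofSubsingleton ℝ (E 3) ℝ (0 : Fin 1)).symm (α 0)
  have hℓ : ∀ w, ℓ w = α 0 fun _ => w := fun w => rfl
  have hH : ∀ w, ℓ ((isoH ^ 2) w) = ℓ w := by
    intro w
    have h1 := hinv' _ isoH_sq_mem 0 w
    rw [eq_pt_zero, acts_isoH_sq 0 0 0] at h1
    simpa [hℓ, ← eq_pt_zero] using h1
  have hR : ∀ w, ℓ (isoR w) = ℓ w := by
    intro w
    have h1 := hinv' _ isoR_mem 0 w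
    rw [eq_pt_zero, acts_isoR 0 0 0] at h1
    simpa [hℓ, ← eq_pt_zero] using h1
  -- `R` negates vertical vectors.
  have hz : ∀ u, ℓ (pt 0 0 u) = 0 := by
    intro u
    have h1 := hR (pt 0 0 u)
    rw [acts_isoR] at h1
    have h2 : pt 0 0 (-u) = (-1 : ℝ) • pt 0 0 u := by rw [pt_smul]; norm_num
    norm_num at h1
    rw [h2, map_smul, smul_eq_mul] at h1
    linarith
  have hzero : ∀ w, ℓ w = 0 := by
    intro w
    obtain ⟨s, t, u, rfl⟩ := exists_pt w
    have h1 := hH (pt s t u)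
    have h2 := hH ((isoH ^ 2) (pt s t u))
    have h3 := hz (3 * u)
    -- The sum of a vector and its two rotated copies is vertical, and ℓ takes the same value on all
    -- three.
    have h4 : pt 0 0 (3 * u) = pt s t u + (isoH ^ 2) (pt s t u) +
        (isoH ^ 2) ((isoH ^ 2) (pt s t u)) := by
      simp only [acts_isoH_sq _ _ _, pt_add, pt_inj]
      push_cast
      refine ⟨?_, ?_, ?_⟩ <;> ring
    rw [h4, map_add, map_add] at h3
    linarith
  ext x v
  have hv : v = fun _ => v 0 := by
    ext1 j
    rw [Subsingleton.elim j 0]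
  rw [hv, hconst x 0, ← hℓ, hzero]
  rfl

/-- The eigenvalue zero distinguishes the two: dx₃ is a nonzero harmonic form for `Γ₁`, and `Γ₂` has
none. -/
theorem not_isospectralOnForms_Γ₁_Γ₂ : ¬ IsospectralOnForms 1 Γ₁ Γ₂ := by
  intro h
  have h1 := h 0
  rw [formEigenspace_Γ₂, rank_bot] at h1
  have := (rank_zero_iff (R := ℝ) (M := formEigenspace 1 Γ₁ 0)).1 h1
  have h2 : verticalForm = 0 :=
    congrArg Subtype.val
      (Subsingleton.elim (⟨verticalForm, verticalForm_mem⟩ : formEigenspace 1 Γ₁ 0) 0)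
  have h3 : verticalForm 0 (fun _ => pt 0 0 1) = 0 := by rw [h2]; rfl
  rw [verticalForm_apply] at h3
  simp [pt] at h3

/-! ### Cartesian coordinates of the singular points -/

theorem cartesian_vertical (t : ℝ) : (!₂[0, 0, t] : E 3) = pt 0 0 t := by
  simp [pt]

theorem cartesian_horizontal (t u : ℝ) : (!₂[t, 0, u] : E 3) = pt (t / 2) 0 u := by
  simp [pt, mul_div_cancel₀]

theorem cartesian_center (t : ℝ) : (!₂[1, 1 / √3, t] : E 3) = pt (1 / 3) (1 / 3) t := by
  have h3 : √3 * (1 / 3) = 1 / √3 := by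
    rw [eq_div_iff sqrt_three_pos.ne']
    linear_combination (1 / 3 : ℝ) * sqrt_three_mul_self
  rw [pt, h3]
  norm_num

theorem image_cartesian_horizontal (u : ℝ) :
    (fun t : ℝ => proj Γ₂ !₂[t, 0, u]) '' Set.Ioo 0 2 =
      (fun s => proj Γ₂ (pt s 0 u)) '' Set.Ioo 0 1 := by
  ext a
  constructor
  · rintro ⟨t, ht, rfl⟩
    exact ⟨t / 2, ⟨by linarith [ht.1], by linarith [ht.2]⟩, by simp only [cartesian_horizontal]⟩
  · rintro ⟨s, hs, rfl⟩
    refine ⟨2 * s, ⟨by linarith [hs.1], by linarith [hs.2]⟩, ?_⟩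
    simp only [cartesian_horizontal]
    rw [mul_div_cancel_left₀ s two_ne_zero]

end

end FlatOrbifold

open FlatOrbifold in
theorem mainTheorem10 :
    -- the elements of the two groups
    (∀ g : I 3, g ∈ Γ₁ ↔ ∃ j < 6, ∃ v ∈ hexLattice, g = isoH ^ j * trans v) ∧
    (∀ g : I 3, g ∈ Γ₂ ↔
      ∃ j < 3, ∃ k < 2, ∃ v ∈ hexLattice, g = isoH ^ (2 * j) * isoR ^ k * trans v) ∧
    -- they are crystallographic, with the prism as a common fundamental domain
    IsCrystallographic Γ₁ ∧ IsCrystallographic Γ₂ ∧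
    IsFundamentalDomain Γ₁ prism ∧ IsFundamentalDomain Γ₂ prism ∧
    -- isospectral on functions but not on 1-forms
    IsospectralOnFunctions Γ₁ Γ₂ ∧ ¬ IsospectralOnForms 1 Γ₁ Γ₂ ∧
    -- the maximal isotropy groups
    (∀ a ∈ maximalIsotropySet Γ₁, HasIsotropy Γ₁ a (Multiplicative (ZMod 6))) ∧
    (∀ a ∈ maximalIsotropySet Γ₂, HasIsotropy Γ₂ a (DihedralGroup 3)) ∧
    -- the points of maximal isotropy: a circle of length one, respectively two points
    maximalIsotropySet Γ₁ = Set.range (fun t : ℝ => proj Γ₁ !₂[0, 0, t]) ∧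
    IsCircleOfLength Γ₁ 1 (maximalIsotropySet Γ₁) ∧
    maximalIsotropySet Γ₂ = {proj Γ₂ !₂[0, 0, 0], proj Γ₂ !₂[0, 0, 1 / 2]} ∧
    proj Γ₂ !₂[0, 0, 0] ≠ proj Γ₂ !₂[0, 0, 1 / 2] ∧
    -- the first orbifold is the product of a 236-orbifold and a circle of length one
    (∃ Δ : Subgroup (I 2), Is236Orbifold Δ ∧
      AreIsometric Γ₁ (prodGroup Δ (translationGroup (AddSubgroup.zmultiples (1 : ℝ))))) ∧
    -- the remaining isotropy groups of the first orbifold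
    (∀ a : Orbifold Γ₁, a ∉ maximalIsotropySet Γ₁ → HasIsotropy Γ₁ a Unit ∨
      HasIsotropy Γ₁ a (Multiplicative (ZMod 2)) ∨ HasIsotropy Γ₁ a (Multiplicative (ZMod 3))) ∧
    IsCircleOfLength Γ₁ 1 {a | HasIsotropy Γ₁ a (Multiplicative (ZMod 2))} ∧
    IsCircleOfLength Γ₁ 1 {a | HasIsotropy Γ₁ a (Multiplicative (ZMod 3))} ∧
    -- the remaining isotropy groups of the second orbifold
    (∀ a : Orbifold Γ₂, a ∉ maximalIsotropySet Γ₂ → HasIsotropy Γ₂ a Unit ∨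
      HasIsotropy Γ₂ a (Multiplicative (ZMod 2)) ∨ HasIsotropy Γ₂ a (Multiplicative (ZMod 3))) ∧
    (∃ S T : Set (Orbifold Γ₂),
      S = (fun t : ℝ => proj Γ₂ !₂[t, 0, 0]) '' Set.Ioo 0 2 ∧
      T = (fun t : ℝ => proj Γ₂ !₂[t, 0, 1 / 2]) '' Set.Ioo 0 2 ∧
      {a | HasIsotropy Γ₂ a (Multiplicative (ZMod 2))} = S ∪ T ∧ Disjoint S T ∧
      IsOpenSegmentOfLength Γ₂ 2 S ∧ IsOpenSegmentOfLength Γ₂ 2 T) ∧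
    (∃ S C : Set (Orbifold Γ₂),
      S = (fun t : ℝ => proj Γ₂ !₂[0, 0, t]) '' Set.Ioo 0 (1 / 2) ∧
      C = Set.range (fun t : ℝ => proj Γ₂ !₂[1, 1 / √3, t]) ∧
      {a | HasIsotropy Γ₂ a (Multiplicative (ZMod 3))} = S ∪ C ∧ Disjoint S C ∧
      IsOpenSegmentOfLength Γ₂ (1 / 2) S ∧ IsCircleOfLength Γ₂ 1 C) := by
  simp only [image_cartesian_horizontal, cartesian_vertical, cartesian_center]
  refine ⟨mem_Γ₁_iff, mem_Γ₂_iff, isCrystallographic_Γ₁, isCrystallographic_Γ₂,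
    isFundamentalDomain_Γ₁, isFundamentalDomain_Γ₂, isospectralOnFunctions_Γ₁_Γ₂,
    not_isospectralOnForms_Γ₁_Γ₂, ?_, fun _ => hasIsotropy_of_mem_maximalIsotropySet_Γ₂,
    maximalIsotropySet_Γ₁, ?_, maximalIsotropySet_Γ₂, proj_Γ₂_height_ne 0 0 0 0,
    ⟨planeGroup, is236Orbifold_planeGroup, areIsometric_Γ₁⟩, fun _ => isotropy_not_maximal_Γ₁,
    ?_, ?_, fun _ => isotropy_not_maximal_Γ₂,
    ⟨_, _, rfl, rfl, isotropy_two_Γ₂, ?_, isOpenSegmentOfLength_horizontal 0,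
      isOpenSegmentOfLength_horizontal _⟩,
    ⟨_, _, rfl, rfl, isotropy_three_Γ₂, ?_, isOpenSegmentOfLength_vertical, isCircleOfLength_Γ₂⟩⟩
  · rw [maximalIsotropySet_Γ₁]
    rintro _ ⟨u, rfl⟩
    exact hasIsotropy_Γ₁_axis₆ u
  · rw [maximalIsotropySet_Γ₁]
    exact isCircleOfLength_Γ₁ 0 0
  · rw [isotropy_two_Γ₁]
    exact isCircleOfLength_Γ₁ _ _
  · rw [isotropy_three_Γ₁]
    exact isCircleOfLength_Γ₁ _ _
  · rw [Set.disjoint_left]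
    rintro _ ⟨s, -, rfl⟩ ⟨t, -, h⟩
    exact proj_Γ₂_height_ne _ _ _ _ h.symm
  · rw [Set.disjoint_left]
    rintro _ ⟨s, -, rfl⟩ ⟨t, h⟩
    exact proj_Γ₂_axis_ne _ _ h.symm
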